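/- A real-valued, locally integrable function $V$ on $[0,\infty)$ is called $L^2$-sparse if for all $\delta,N>0$ there is a subinterval $(a,b)$ of $[0,\infty)$ with $b-a=N$ and $\int_a^b V(x)^2\,dx<\delta$. Let $V$ be $L^2$-sparse. For real $\lambda$ let $v(\cdot,\lambda)$ be the solution of $-f''+Vf=\lambda f$ on $[0,\infty)$ with $v(0,\lambda)=0$, $v'(0,\lambda)=1$, where the prime denotes differentiation with respect to $x$. For $a\ge 0$ and $\operatorname{Im} z>0$ let $m^a(z)$ be the Dirichlet Weyl $m$-function of $-\frac{d^2}{dx^2}+V$ on $(a,\infty)$, that is, the unique complex number such that the solution $f$ of $-f''+Vf=zf$ on $[a,\infty)$ with $f(a)=1$, $f'(a)=m^a(z)$ lies in $L^2(a,\infty)$, and let $m^a_+(\lambda)=\lim_{d\to 0^+}m^a(\lambda+id)$ for almost every real $\lambda$. For a Borel set $S\subseteq\mathbb{R}$ let $\theta(z,S)=\int_S\frac{\operatorname{Im} z}{|t-z|^2}\,dt$ be the angle subtended at $z$ by $S$ if $\operatorname{Im} z>0$, and for real $z$ let $\theta(z,S)=\pi$ if $z\in S$ and $\theta(z,S)=0$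 otherwise. Put $i\sqrt{\lambda}=-\sqrt{|\lambda|}$ for $\lambda<0$, and write $|\cdot|$ for Lebesgue measure. Let $(a_k,b_k)$, with $0\le a_k<b_k$, be a sequence of intervals such that $\lim_{k\to\infty}(b_k-a_k)=\infty$ and $\lim_{k\to\infty}\int_{a_k}^{b_k}V(t)^2\,dt=0$. Then $m^{a_k}(z)$ is well defined for all $k$ and all $z$ with $\operatorname{Im} z>0$, its boundary values $m^{a_k}_+(\lambda)$ exist for almost every $\lambda\in\mathbb{R}$, and for all Borel subsets $A,S$ of $\mathbb{R}$ with $|A|<\infty$ the functions $\lambda\mapsto\theta(m^{a_k}_+(\lambda),S)$ are integrable on $A$ and $$\lim_{k\to\infty}\frac1\pi\int_A\theta\bigl(m^{a_k}_+(\lambda),S\bigr)\,d\lambda=\frac1\pi\int_A\theta\bigl(i\sqrt{\lambda},S\bigr)\,d\lambda,$$ $$\lim_{k\to\infty}\left|\left\{\lambda\in A:\ \frac{v'(b_k,\lambda)}{v(b_k,\lambda)}\in S\right\}\right|=\frac1\pi\int_A\theta\bigl(i\sqrt{\lambda},-S\bigr)\,d\lambda.$$ -/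

import Mathlib

open MeasureTheory Filter Topology Set
open scoped Pointwise

/-- `V : ℝ → ℝ`, of which only the restriction to `[0, ∞)` matters, is an `L²`-sparse potential:
it is locally integrable on `[0, ∞)`, and there are intervals of any given length on which the
integral of `V²` (a Lebesgue integral with values in `[0, ∞]`) is as small as we please. -/
structure IsL2Sparse (V : ℝ → ℝ) : Prop where
  locallyIntegrable : LocallyIntegrableOn V (Ici 0) volume
  exists_interval : ∀ δ : ℝ, 0 < δ → ∀ N : ℝ, 0 < N → ∃ a b : ℝ, 0 ≤ a ∧ b - a = N ∧
    ∫⁻ x in Ioo a b, ENNReal.ofReal (V x ^ 2) < ENNReal.ofReal δ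

/-- `f`, with derivative `f'`, solves `-f'' + V f = z f` on `[a, ∞)`: the function `f'` is the
derivative of `f` (one-sided at `a`), it is locally absolutely continuous, and
`f'' = (V - z) f` almost everywhere. The last two conditions are written as one integral equation. -/
structure IsSchrodingerSolution (V : ℝ → ℝ) (z : ℂ) (a : ℝ) (f f' : ℝ → ℂ) : Prop where
  hasDeriv : ∀ x, a ≤ x → HasDerivWithinAt f (f' x) (Ici a) x
  deriv_eq : ∀ x, a ≤ x → f' x = f' a + ∫ t in a..x, ((V t : ℂ) - z) * f t

/-- `w` is a value at `z` of the Dirichlet Weyl `m`-function of `-d²/dx² + V` on `(a, ∞)`: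
the solution `f = u + w v` with `f(a) = 1`, `f'(a) = w` lies in `L²(a, ∞)`. (Here `u`, `v` are
the solutions with `u(a) = 1`, `u'(a) = 0` and `v(a) = 0`, `v'(a) = 1`.) -/
def IsWeylValue (V : ℝ → ℝ) (a : ℝ) (z w : ℂ) : Prop :=
  ∃ f f' : ℝ → ℂ, IsSchrodingerSolution V z a f f' ∧ f a = 1 ∧ f' a = w ∧
    MemLp f 2 (volume.restrict (Ioi a))

open Classical in
/-- The Dirichlet Weyl `m`-function `m^a(z)` of `-d²/dx² + V` on `(a, ∞)`, for `Im z > 0`. -/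
noncomputable def weylM (V : ℝ → ℝ) (a : ℝ) (z : ℂ) : ℂ :=
  if h : ∃ w, IsWeylValue V a z w then h.choose else 0

/-- The boundary value `F₊(l) = lim_{d → 0+} F(l + i d)` at a real point `l`. -/
noncomputable def boundaryValue (F : ℂ → ℂ) (l : ℝ) : ℂ :=
  limUnder (𝓝[>] (0 : ℝ)) fun d : ℝ => F ((l : ℂ) + (d : ℂ) * Complex.I)

open Classical in
/-- The angle `θ(z, S)` subtended at the point `z` by the subset `S` of the real line;
for real `z` it is `π` if `z ∈ S` and `0` otherwise. -/
noncomputable def angleSubtended (z : ℂ) (S : Set ℝ) : ℝ :=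
  if z.im = 0 then (if z.re ∈ S then Real.pi else 0)
  else ∫ t in S, |z.im| / ((t - z.re) ^ 2 + z.im ^ 2)

/-- `i √l` for real `l`, with the branch of the square root that has nonnegative imaginary part:
it is `i √l` for `l ≥ 0` and `-√|l|` for `l < 0`. -/
noncomputable def iSqrt (l : ℝ) : ℂ :=
  if 0 ≤ l then Complex.I * (Real.sqrt l : ℂ) else ((-Real.sqrt (-l) : ℝ) : ℂ)

/-! ### Products of primitives -/

/-! On a long interval where `V` is small in `L²`, the equation is nearly free, so at every `z` in
the upper half-plane the `m`-functions seen from its two ends are near `i√z`. To see this, put `κ =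
-i√z` and test the equation by Green's identity against `ψ(s) = (1 - s/L)² e^{-κ s}`, with `s` the
distance from one end and `L` the length. Only boundary terms at that end survive, and at the left
end, for `f(a) = 1`, they give `|m + κ + 2/L| ≤ ‖f‖ (‖V‖ + O(L^{-1/2}))` with `L²` norms over the
interval. Lagrange's identity bounds `‖f‖²` by `Im m / Im z`, so the estimate closes up and `m → -κ`
(`IsSolutionOn.norm_deriv_add_le`, `tendsto_of_norm_add_le`). The right end is treated in the same
way, with `-v'/v` in the role of `m`.

It remains to pass from the half-plane to the real line. Let `ω_w` be the harmonic measure of the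
upper half-plane at `w`, a point mass for real `w`; then `θ(w, S) = π ω_w(S)`. For a Herglotz
function `F` one has `ω_{F(z)}(S) = ∫ ω_{F₊(x)}(S) dω_z(x)`. This is checked on half-lines, where `π
ω_w((-∞, t)) = arg (w - t)` and `arg (F - t)` is a bounded harmonic function, hence the Poisson
integral of its boundary values (`IsHerglotz.harmonicMeasure_real_eq`). By the symmetry of the
Poisson kernel, replacing `F₊(x)` by `F(x + id)` in `∫_A ω_{F₊(x)}(S) dx` costs at most `∫ |1_A(t) -
ω_{t+id}(A)| dt`. This tends to zero with `d` and does not involve `F`, so pointwise convergence in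
the half-plane implies convergence of the integrals over `A`
(`tendsto_setIntegral_harmonicMeasure_boundaryValue`).

Applied to `m^{a_k}` this is the first limit. Applied to `-v'(b_k, ·)/v(b_k, ·)`, whose boundary
values are real, it counts the `λ` with `-v'/v ∈ -S`, which is the second limit. Sparseness itself
serves only to make the `m`-functions well defined: it puts `V` in the limit point case at infinity.
-/

theorem intervalIntegral_primitive_mul_primitive {𝕜 : Type*} [RCLike 𝕜] {f g : ℝ → 𝕜} {a b : ℝ}
    (hab : a ≤ b) (hf : IntervalIntegrable f volume a b) (hg : IntervalIntegrable g volume a b) :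
    (∫ t in a..b, f t) * (∫ t in a..b, g t)
      = ∫ x in a..b, (f x * (∫ t in a..x, g t) + (∫ t in a..x, f t) * g x) := by
  have hfi : IntegrableOn f (Ioc a b) := (intervalIntegrable_iff_integrableOn_Ioc_of_le hab).1 hf
  have hgi : IntegrableOn g (Ioc a b) := (intervalIntegrable_iff_integrableOn_Ioc_of_le hab).1 hg
  set μ := (volume : Measure ℝ).restrict (Ioc a b) with hμ
  -- Fubini on the square: the product of the two integrals is a double integral, and the two
  -- triangles cut off by the diagonal give the two terms.
  have hP : Integrable (fun p : ℝ × ℝ => f p.1 * g p.2) (μ.prod μ) :=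
    Integrable.mul_prod hfi hgi
  have hm : MeasurableSet {p : ℝ × ℝ | p.2 ≤ p.1} := measurableSet_le measurable_snd measurable_fst
  have h1 : ∫ p, f p.1 * g p.2 ∂(μ.prod μ)
      = (∫ t in a..b, f t) * (∫ t in a..b, g t) := by
    rw [integral_prod_mul, intervalIntegral.integral_of_le hab, intervalIntegral.integral_of_le hab]
  have hsub : ∀ x ∈ Ioc a b, Iic x ∩ Ioc a b = Ioc a x := by
    intro x hx; ext y; simp only [mem_inter_iff, mem_Iic, mem_Ioc]; grind
  have hsub' : ∀ x ∈ Ioc a b, Iio x ∩ Ioc a b = Ioo a x := by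
    intro x hx; ext y; simp only [mem_inter_iff, mem_Iio, mem_Ioc, mem_Ioo]; grind
  have h2 : ∫ p in {p : ℝ × ℝ | p.2 ≤ p.1}, f p.1 * g p.2 ∂(μ.prod μ)
      = ∫ x in a..b, f x * (∫ t in a..x, g t) := by
    rw [← integral_indicator hm, integral_prod _ (hP.indicator hm),
      intervalIntegral.integral_of_le hab]
    refine setIntegral_congr_fun measurableSet_Ioc fun x hx => ?_
    have : ∀ y, ({p : ℝ × ℝ | p.2 ≤ p.1}.indicator (fun p : ℝ × ℝ => f p.1 * g p.2)) (x, y)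
        = f x * (Iic x).indicator g y := by
      intro y; by_cases h : y ≤ x <;> simp [indicator, h]
    simp only [this]
    rw [integral_const_mul, integral_indicator measurableSet_Iic, hμ,
      Measure.restrict_restrict measurableSet_Iic, hsub x hx,
      intervalIntegral.integral_of_le hx.1.le]
  have h3 : ∫ p in {p : ℝ × ℝ | p.2 ≤ p.1}ᶜ, f p.1 * g p.2 ∂(μ.prod μ)
      = ∫ x in a..b, (∫ t in a..x, f t) * g x := by
    rw [← integral_indicator hm.compl, integral_prod_symm _ (hP.indicator hm.compl),
      intervalIntegral.integral_of_le hab]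
    refine setIntegral_congr_fun measurableSet_Ioc fun x hx => ?_
    have : ∀ y, ({p : ℝ × ℝ | p.2 ≤ p.1}ᶜ.indicator (fun p : ℝ × ℝ => f p.1 * g p.2)) (y, x)
        = (Iio x).indicator f y * g x := by
      intro y; by_cases h : y < x <;> simp [indicator, h]
    simp only [this]
    rw [integral_mul_const, integral_indicator measurableSet_Iio, hμ,
      Measure.restrict_restrict measurableSet_Iio, hsub' x hx,
      intervalIntegral.integral_of_le hx.1.le, integral_Ioc_eq_integral_Ioo]
  have hF : ContinuousOn (fun x => ∫ t in a..x, f t) (uIcc a b) :=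
    intervalIntegral.continuousOn_primitive_interval' hf left_mem_uIcc
  have hG : ContinuousOn (fun x => ∫ t in a..x, g t) (uIcc a b) :=
    intervalIntegral.continuousOn_primitive_interval' hg left_mem_uIcc
  rw [intervalIntegral.integral_add (hf.mul_continuousOn hG) (hg.continuousOn_mul hF),
    ← h1, ← h2, ← h3, integral_add_compl hm hP]

/-- The product rule, in integrated form, for two absolutely continuous functions. -/
theorem mul_sub_mul_eq_integral_of_primitive {𝕜 : Type*} [RCLike 𝕜] {f f' g g' : ℝ → 𝕜} {a b : ℝ}
    (hab : a ≤ b) (hf' : IntervalIntegrable f' volume a b)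
    (hg' : IntervalIntegrable g' volume a b)
    (hf : ∀ x ∈ Icc a b, f x = f a + ∫ t in a..x, f' t)
    (hg : ∀ x ∈ Icc a b, g x = g a + ∫ t in a..x, g' t) :
    f b * g b - f a * g a = ∫ x in a..b, (f' x * g x + f x * g' x) := by
  have hF : ContinuousOn (fun x => ∫ t in a..x, f' t) (uIcc a b) :=
    intervalIntegral.continuousOn_primitive_interval' hf' left_mem_uIcc
  have hG : ContinuousOn (fun x => ∫ t in a..x, g' t) (uIcc a b) :=
    intervalIntegral.continuousOn_primitive_interval' hg' left_mem_uIcc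
  have key := intervalIntegral_primitive_mul_primitive hab hf' hg'
  have e : ∫ x in a..b, (f' x * g x + f x * g' x)
      = ∫ x in a..b, ((f' x * (∫ t in a..x, g' t) + (∫ t in a..x, f' t) * g' x)
          + (f' x * g a + f a * g' x)) := by
    refine intervalIntegral.integral_congr fun x hx => ?_
    rw [uIcc_of_le hab] at hx
    rw [hf x hx, hg x hx]; ring
  rw [e, intervalIntegral.integral_add, ← key, intervalIntegral.integral_add,
    intervalIntegral.integral_mul_const, intervalIntegral.integral_const_mul,
    hf b (right_mem_Icc.2 hab), hg b (right_mem_Icc.2 hab)]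
  · ring
  · exact hf'.mul_const _
  · exact hg'.const_mul _
  · exact (hf'.mul_continuousOn hG).add (hg'.continuousOn_mul hF)
  · exact (hf'.mul_const _).add (hg'.const_mul _)

/-- This is the chain rule for `Q ^ (n + 1)` with `Q` a primitive of a merely integrable `ρ`,
obtained by induction from the product rule. It produces the factorials in the bounds on Volterra
iterates. -/
theorem integral_mul_pow_primitive {ρ : ℝ → ℝ} {a : ℝ}
    (hρ : ∀ x, IntervalIntegrable ρ volume a x) (n : ℕ) {x : ℝ} (hx : a ≤ x) :
    (n + 1) * ∫ t in a..x, ρ t * (∫ s in a..t, ρ s) ^ n = (∫ t in a..x, ρ t) ^ (n + 1) := by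
  induction n generalizing x with
  | zero => simp
  | succ n ih =>
    have hQ : ContinuousOn (fun x => ∫ t in a..x, ρ t) (uIcc a x) :=
      intervalIntegral.continuousOn_primitive_interval' (hρ x) left_mem_uIcc
    have h := mul_sub_mul_eq_integral_of_primitive (f := fun x => (∫ t in a..x, ρ t) ^ (n + 1))
      (f' := fun t => (n + 1) * (ρ t * (∫ s in a..t, ρ s) ^ n)) (g := fun x => ∫ t in a..x, ρ t)
      (g' := ρ) hx (((hρ x).mul_continuousOn (hQ.pow n)).const_mul _) (hρ x)
      (fun y hy => by
        rw [← ih hy.1, intervalIntegral.integral_const_mul]; simp) (fun y hy => by simp)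
    simp only [intervalIntegral.integral_same, mul_zero, sub_zero] at h
    rw [pow_succ, h, ← intervalIntegral.integral_const_mul]
    refine intervalIntegral.integral_congr fun t _ => ?_
    push_cast
    ring

/-! ### Solutions on compact intervals -/

/-- `(f, f')` solves the first order system `f' = f'`, `(f')' = q f` on `[a, b]`, in integrated
form. -/
structure IsSolutionOn (q : ℝ → ℂ) (a b : ℝ) (f f' : ℝ → ℂ) : Prop where
  cont : ContinuousOn f (Icc a b)
  cont' : ContinuousOn f' (Icc a b)
  eq : ∀ x ∈ Icc a b, f x = f a + ∫ t in a..x, f' t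
  eq' : ∀ x ∈ Icc a b, f' x = f' a + ∫ t in a..x, q t * f t

/-! ### The Volterra operator of the first order system -/

namespace Volterra

variable {a b : ℝ}

/-- The operator `(f, g) ↦ (∫ₐˣ c g, ∫ₐˣ q f)` on `C([a, b], ℂ × ℂ)`. -/
noncomputable def op (hab : a ≤ b) (c : ℂ) (q : ℝ → ℂ)
    (hq : ∀ x y, IntervalIntegrable q volume x y) :
    C(Icc a b, ℂ × ℂ) →L[ℂ] C(Icc a b, ℂ × ℂ) :=
  LinearMap.mkContinuous
    { toFun := fun Y =>
        { toFun := fun x => (∫ t in a..x, c * (Y (projIcc a b hab t)).2,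
            ∫ t in a..x, q t * (Y (projIcc a b hab t)).1)
          continuous_toFun := by
            have hY : Continuous fun t => Y (projIcc a b hab t) :=
              Y.continuous.comp continuous_projIcc
            refine Continuous.prodMk ?_ ?_
            · exact (intervalIntegral.continuous_primitive (fun x y =>
                (Continuous.intervalIntegrable (by fun_prop) _ _)) a).comp continuous_subtype_val
            · exact (intervalIntegral.continuous_primitive (fun x y =>
                (hq x y).mul_continuousOn (by fun_prop)) a).comp continuous_subtype_val }
      map_add' := by
        intro Y Z
        have hY : Continuous fun t => Y (projIcc a b hab t) :=
          Y.continuous.comp continuous_projIcc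
        have hZ : Continuous fun t => Z (projIcc a b hab t) :=
          Z.continuous.comp continuous_projIcc
        ext x
        · simp only [ContinuousMap.add_apply, Prod.snd_add, mul_add, ContinuousMap.coe_mk]
          exact intervalIntegral.integral_add (Continuous.intervalIntegrable (by fun_prop) _ _)
            (Continuous.intervalIntegrable (by fun_prop) _ _)
        · simp only [ContinuousMap.add_apply, Prod.fst_add, mul_add, ContinuousMap.coe_mk]
          exact intervalIntegral.integral_add ((hq _ _).mul_continuousOn (by fun_prop))
            ((hq _ _).mul_continuousOn (by fun_prop))
      map_smul' := by
        intro r Y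
        ext x
        · simp [mul_left_comm _ r]
        · simp [mul_left_comm _ r] }
    (‖c‖ * (b - a) + ∫ t in a..b, ‖q t‖) <| by
      intro Y
      have hY : Continuous fun t => Y (projIcc a b hab t) :=
        Y.continuous.comp continuous_projIcc
      have hb : 0 ≤ b - a := sub_nonneg.2 hab
      have hI : 0 ≤ ∫ t in a..b, ‖q t‖ :=
        intervalIntegral.integral_nonneg hab fun _ _ => norm_nonneg _
      have hq' : ∀ x y, IntervalIntegrable (fun t => ‖q t‖) volume x y := fun x y => (hq x y).norm
      rw [ContinuousMap.norm_le _ (by positivity)]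
      intro x
      refine max_le ?_ ?_
      · refine (intervalIntegral.norm_integral_le_of_norm_le_const (C := ‖c‖ * ‖Y‖)
          fun t _ => ?_).trans ?_
        · rw [norm_mul]
          gcongr
          exact (norm_snd_le _).trans (Y.norm_coe_le_norm _)
        · rw [abs_of_nonneg (sub_nonneg.2 x.2.1)]
          have : (x : ℝ) - a ≤ b - a := by linarith [x.2.2]
          have := mul_le_mul_of_nonneg_left this (by positivity : 0 ≤ ‖c‖ * ‖Y‖)
          have := mul_nonneg hI (norm_nonneg Y)
          nlinarith
      · calc ‖∫ t in a..x, q t * (Y (projIcc a b hab t)).1‖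
            ≤ ∫ t in a..x, ‖q t‖ * ‖Y‖ := by
              refine intervalIntegral.norm_integral_le_of_norm_le x.2.1
                (ae_of_all _ fun t _ => ?_) ((hq' _ _).mul_const _)
              rw [norm_mul]
              gcongr
              exact (norm_fst_le _).trans (Y.norm_coe_le_norm _)
          _ = (∫ t in a..x, ‖q t‖) * ‖Y‖ := intervalIntegral.integral_mul_const _ _
          _ ≤ _ := by
              gcongr
              have := intervalIntegral.integral_mono_interval (c := a) (d := b) (a := a) (b := x)
                le_rfl x.2.1 x.2.2 (ae_of_all _ fun t => norm_nonneg (q t)) (hq' a b)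
              have : 0 ≤ ‖c‖ * (b - a) := by positivity
              linarith

theorem op_apply (hab : a ≤ b) (c : ℂ) (q : ℝ → ℂ) (hq : ∀ x y, IntervalIntegrable q volume x y)
    (Y : C(Icc a b, ℂ × ℂ)) (x : Icc a b) :
    op hab c q hq Y x = (∫ t in a..x, c * (Y (projIcc a b hab t)).2,
            ∫ t in a..x, q t * (Y (projIcc a b hab t)).1) := rfl

/-- Each application integrates once more over `[a, x]`, and `1 + ‖q‖` dominates the kernels of both
components, so the iterates decay like the terms of an exponential series. -/
theorem norm_op_pow_apply_le (hab : a ≤ b) (q : ℝ → ℂ) (hq : ∀ x y, IntervalIntegrable q volume x y) (n : ℕ)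
    (Y : C(Icc a b, ℂ × ℂ)) (x : Icc a b) :
    ‖((op hab 1 q hq) ^ n) Y x‖ ≤ ‖Y‖ * ((∫ t in a..x, (1 + ‖q t‖)) ^ n / n.factorial) := by
  have hρ : ∀ x y, IntervalIntegrable (fun t => 1 + ‖q t‖) volume x y := fun x y =>
    intervalIntegrable_const.add (hq x y).norm
  induction n generalizing x with
  | zero => simpa using Y.norm_coe_le_norm x
  | succ n ih =>
    set Z := ((op hab 1 q hq) ^ n) Y with hZ
    have hZc : Continuous fun t => Z (projIcc a b hab t) := Z.continuous.comp continuous_projIcc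
    have e : ((op hab 1 q hq) ^ (n + 1)) Y = op hab 1 q hq Z := by
      rw [pow_succ']; rfl
    have hQ : ContinuousOn (fun x => ∫ t in a..x, (1 + ‖q t‖)) (uIcc a x) :=
      intervalIntegral.continuousOn_primitive_interval' (hρ _ _) left_mem_uIcc
    have hint : IntervalIntegrable (fun t => (1 + ‖q t‖) *
        (‖Y‖ * ((∫ s in a..t, (1 + ‖q s‖)) ^ n / n.factorial))) volume a x :=
      (hρ _ _).mul_continuousOn (((hQ.pow n).div_const _).const_mul _)
    have hval : ∫ t in a..x, (1 + ‖q t‖) *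
        (‖Y‖ * ((∫ s in a..t, (1 + ‖q s‖)) ^ n / n.factorial))
        = ‖Y‖ * ((∫ t in a..x, (1 + ‖q t‖)) ^ (n + 1) / (n + 1).factorial) := by
      rw [← integral_mul_pow_primitive (fun y => hρ a y) n x.2.1, Nat.factorial_succ]
      have : ∀ t, (1 + ‖q t‖) * (‖Y‖ * ((∫ s in a..t, (1 + ‖q s‖)) ^ n / n.factorial))
        = (‖Y‖ / n.factorial) * ((1 + ‖q t‖) * (∫ s in a..t, (1 + ‖q s‖)) ^ n) := by
        intro t; ring
      simp only [this]
      rw [intervalIntegral.integral_const_mul]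
      push_cast
      field_simp
    have hbd : ∀ t ∈ Ioc a (x : ℝ), ‖Z (projIcc a b hab t)‖
        ≤ ‖Y‖ * ((∫ s in a..t, (1 + ‖q s‖)) ^ n / n.factorial) := by
      intro t ht
      have ht' : t ∈ Icc a b := ⟨ht.1.le, ht.2.trans x.2.2⟩
      rw [projIcc_of_mem hab ht']
      exact ih ⟨t, ht'⟩
    rw [e, ← hval, op_apply]
    refine max_le ?_ ?_
    · refine intervalIntegral.norm_integral_le_of_norm_le x.2.1 (ae_of_all _ fun t ht => ?_) hint
      rw [one_mul]
      refine (norm_snd_le _).trans ((hbd t ht).trans ?_)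
      have h0 := (norm_nonneg _).trans (hbd t ht)
      nlinarith [norm_nonneg (q t)]
    · refine intervalIntegral.norm_integral_le_of_norm_le x.2.1 (ae_of_all _ fun t ht => ?_) hint
      rw [norm_mul]
      have h0 := (norm_nonneg _).trans (hbd t ht)
      have h1 := (norm_fst_le _).trans (hbd t ht)
      have := mul_le_mul_of_nonneg_left h1 (norm_nonneg (q t))
      nlinarith [norm_nonneg (q t)]

/-- Some power `T ^ n` has norm less than one, so `1 - T ^ n` is invertible by the Neumann series,
and `1 - T` is one of its two commuting factors. -/
theorem isUnit_one_sub_op (hab : a ≤ b) (q : ℝ → ℂ) (hq : ∀ x y, IntervalIntegrable q volume x y) :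
    IsUnit (1 - op hab 1 q hq) := by
  set T := op hab 1 q hq
  set Q := ∫ t in a..b, (1 + ‖q t‖)
  have hρ : ∀ x y, IntervalIntegrable (fun t => 1 + ‖q t‖) volume x y := fun x y =>
    intervalIntegrable_const.add (hq x y).norm
  have h1 : ∀ n : ℕ, ‖T ^ n‖ ≤ Q ^ n / n.factorial := by
    intro n
    have hQ0 : 0 ≤ Q := intervalIntegral.integral_nonneg hab fun _ _ => by positivity
    refine ContinuousLinearMap.opNorm_le_bound _ (by positivity) fun Y => ?_
    rw [ContinuousMap.norm_le _ (by positivity)]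
    intro x
    refine (norm_op_pow_apply_le hab q hq n Y x).trans ?_
    rw [mul_comm]
    gcongr
    · exact intervalIntegral.integral_nonneg x.2.1 fun _ _ => by positivity
    · exact intervalIntegral.integral_mono_interval (c := a) (d := b) (a := a) (b := x)
        le_rfl x.2.1 x.2.2 (ae_of_all _ fun t => by simp only [Pi.zero_apply]; positivity) (hρ a b)
  have h2 : Tendsto (fun n : ℕ => Q ^ n / n.factorial) atTop (𝓝 0) :=
    FloorSemiring.tendsto_pow_div_factorial_atTop Q
  obtain ⟨n, hn⟩ := (h2.eventually (gt_mem_nhds one_pos)).exists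
  have h3 : IsUnit (1 - T ^ n) := by
    exact isUnit_one_sub_of_norm_lt_one (x := T ^ n) ((h1 n).trans_lt hn)
  rw [← mul_neg_geom_sum T n] at h3
  refine ((Commute.isUnit_mul_iff ?_).1 h3).1
  show _ * _ = _ * _
  rw [mul_neg_geom_sum, geom_sum_mul_neg]

end Volterra

namespace IsSolutionOn

variable {q : ℝ → ℂ} {a b : ℝ} {f f' g g' : ℝ → ℂ}

theorem mono (h : IsSolutionOn q a b f f') {c : ℝ} (hc : c ≤ b) : IsSolutionOn q a c f f' :=
  ⟨h.cont.mono (Icc_subset_Icc_right hc), h.cont'.mono (Icc_subset_Icc_right hc),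
    fun x hx => h.eq x ⟨hx.1, hx.2.trans hc⟩, fun x hx => h.eq' x ⟨hx.1, hx.2.trans hc⟩⟩

theorem congr_potential {r : ℝ → ℂ} (h : IsSolutionOn q a b f f')
    (hqr : ∀ x ∈ Icc a b, q x = r x) : IsSolutionOn r a b f f' := by
  refine ⟨h.cont, h.cont', h.eq, fun x hx => ?_⟩
  rw [h.eq' x hx]
  congr 1
  refine intervalIntegral.integral_congr fun t ht => ?_
  rw [uIcc_of_le hx.1] at ht
  simp only [hqr t ⟨ht.1, ht.2.trans hx.2⟩]

theorem intervalIntegrable_deriv (h : IsSolutionOn q a b f f') (hab : a ≤ b) :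
    IntervalIntegrable f' volume a b :=
  ContinuousOn.intervalIntegrable (by rw [uIcc_of_le hab]; exact h.cont')

theorem intervalIntegrable_mul (h : IsSolutionOn q a b f f') (hab : a ≤ b)
    (hq : IntervalIntegrable q volume a b) : IntervalIntegrable (fun t => q t * f t) volume a b :=
  hq.mul_continuousOn (by rw [uIcc_of_le hab]; exact h.cont)

theorem lin_comb (hf : IsSolutionOn q a b f f') (hg : IsSolutionOn q a b g g')
    (hq : ∀ x ∈ Icc a b, IntervalIntegrable q volume a x) (r s : ℂ) :
    IsSolutionOn q a b (fun x => r * f x + s * g x) (fun x => r * f' x + s * g' x) := by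
  refine ⟨(hf.cont.const_smul r).add (hg.cont.const_smul s),
    (hf.cont'.const_smul r).add (hg.cont'.const_smul s), fun x hx => ?_, fun x hx => ?_⟩
  · rw [intervalIntegral.integral_add, intervalIntegral.integral_const_mul,
      intervalIntegral.integral_const_mul, hf.eq x hx, hg.eq x hx]
    · ring
    · exact ((hf.mono hx.2).intervalIntegrable_deriv hx.1).const_mul _
    · exact ((hg.mono hx.2).intervalIntegrable_deriv hx.1).const_mul _
  · have : ∀ t, q t * (r * f t + s * g t) = r * (q t * f t) + s * (q t * g t) := by
      intro t; ring
    simp only [this]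
    rw [intervalIntegral.integral_add, intervalIntegral.integral_const_mul,
      intervalIntegral.integral_const_mul, hf.eq' x hx, hg.eq' x hx]
    · ring
    · exact ((hf.mono hx.2).intervalIntegrable_mul hx.1 (hq x hx)).const_mul _
    · exact ((hg.mono hx.2).intervalIntegrable_mul hx.1 (hq x hx)).const_mul _

/-- With zero initial values, `(f, f')` is a fixed point of the Volterra operator, and `1 - T` is
injective. -/
theorem eq_zero (hab : a ≤ b) (hq : ∀ x y, IntervalIntegrable q volume x y)
    (h : IsSolutionOn q a b f f') (h0 : f a = 0) (h0' : f' a = 0) :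
    ∀ x ∈ Icc a b, f x = 0 ∧ f' x = 0 := by
  let Y : C(Icc a b, ℂ × ℂ) :=
    ⟨fun x => (f x, f' x), by
      have h1 := continuousOn_iff_continuous_domRestrict.1 h.cont
      have h2 := continuousOn_iff_continuous_domRestrict.1 h.cont'
      exact h1.prodMk h2⟩
  have hY : Volterra.op hab 1 q hq Y = Y := by
    ext x
    · rw [Volterra.op_apply]
      show _ = f x
      rw [h.eq x x.2, h0, zero_add]
      refine intervalIntegral.integral_congr fun t ht => ?_
      rw [uIcc_of_le x.2.1] at ht
      simp only [projIcc_of_mem hab ⟨ht.1, ht.2.trans x.2.2⟩, one_mul]; rfl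
    · rw [Volterra.op_apply]
      show _ = f' x
      rw [h.eq' x x.2, h0', zero_add]
      refine intervalIntegral.integral_congr fun t ht => ?_
      rw [uIcc_of_le x.2.1] at ht
      simp only [projIcc_of_mem hab ⟨ht.1, ht.2.trans x.2.2⟩]; rfl
  obtain ⟨u, hu⟩ := Volterra.isUnit_one_sub_op hab q hq
  have h1 : (u : C(Icc a b, ℂ × ℂ) →L[ℂ] C(Icc a b, ℂ × ℂ)) Y = 0 := by
    rw [hu]; simp [hY]
  have h2 : Y = 0 := by
    have : ((↑u⁻¹ * ↑u : C(Icc a b, ℂ × ℂ) →L[ℂ] C(Icc a b, ℂ × ℂ))) Y = 0 := by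
      rw [mul_apply_eq_comp, h1, map_zero]
    rwa [Units.inv_mul] at this
  intro x hx
  have := DFunLike.congr_fun h2 ⟨x, hx⟩
  exact ⟨congrArg Prod.fst this, congrArg Prod.snd this⟩

theorem unique (hab : a ≤ b) (hq : ∀ x y, IntervalIntegrable q volume x y)
    (hf : IsSolutionOn q a b f f') (hg : IsSolutionOn q a b g g') (h0 : f a = g a)
    (h0' : f' a = g' a) : ∀ x ∈ Icc a b, f x = g x ∧ f' x = g' x := by
  intro x hx
  have := (hf.lin_comb hg (fun x _ => hq a x) 1 (-1)).eq_zero hab hq (by simp [h0])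
    (by simp [h0']) x hx
  constructor
  · linear_combination this.1
  · linear_combination this.2

end IsSolutionOn

/-- Inversion is holomorphic on the units of a Banach algebra. This is the source of the holomorphic
dependence of solutions on the spectral parameter. -/
theorem differentiable_inverse_add_smul {E : Type*} [NormedAddCommGroup E] [NormedSpace ℂ E]
    [CompleteSpace E] (B S : E →L[ℂ] E) (h : ∀ z : ℂ, IsUnit (B + z • S)) (y : E) :
    Differentiable ℂ fun z : ℂ => Ring.inverse (B + z • S) y := fun z => by
  have h1 : DifferentiableAt ℂ Ring.inverse (B + z • S) := differentiableAt_inverse (h z)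
  have h2 : DifferentiableAt ℂ (fun z : ℂ => B + z • S) z := by fun_prop
  exact (h1.comp z h2).clm_apply (differentiableAt_const _)

/-- Solutions with fixed initial values exist and depend holomorphically on the spectral
parameter. -/
theorem exists_isSolutionOn {a b : ℝ} (hab : a ≤ b) {W : ℝ → ℂ}
    (hW : ∀ x y, IntervalIntegrable W volume x y) (c d : ℂ) :
    ∃ f f' : ℂ → ℝ → ℂ,
      (∀ z, IsSolutionOn (fun t => W t - z) a b (f z) (f' z) ∧ f z a = c ∧ f' z a = d) ∧
      ∀ x ∈ Icc a b, Differentiable ℂ (fun z => f z x) ∧ Differentiable ℂ (fun z => f' z x) := by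
  have hq : ∀ z : ℂ, ∀ x y, IntervalIntegrable (fun t => W t - z) volume x y := fun z x y =>
    (hW x y).sub intervalIntegrable_const
  set A := fun z => 1 - Volterra.op hab 1 (fun t => W t - z) (hq z) with hA
  -- The operator is affine in `z`. The slope is itself a Volterra operator, with `c = 0` and `q =
  -- 1`; this is the reason for the parameter `c` in `op`.
  have hAlin : ∀ z, A z = A 0 + z • Volterra.op hab 0 (fun _ => 1)
      (fun _ _ => intervalIntegrable_const) := by
    intro z
    ext Y x
    · simp [hA, Volterra.op_apply]
    · have hY : Continuous fun t => Y (projIcc a b hab t) :=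
        Y.continuous.comp continuous_projIcc
      change (Y x).2 - (∫ t in a..x, (W t - z) * (Y (projIcc a b hab t)).1)
        = ((Y x).2 - ∫ t in a..x, (W t - 0) * (Y (projIcc a b hab t)).1)
          + z * ∫ t in a..x, 1 * (Y (projIcc a b hab t)).1
      simp only [sub_zero, one_mul]
      rw [← intervalIntegral.integral_const_mul, sub_add, ← intervalIntegral.integral_sub
        ((hW _ _).mul_continuousOn (by fun_prop))
        (Continuous.intervalIntegrable (by fun_prop) _ _)]
      simp only [sub_mul]
  have hAu : ∀ z, IsUnit (A z) := fun z => Volterra.isUnit_one_sub_op hab _ _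
  let Y0 : C(Icc a b, ℂ × ℂ) := ContinuousMap.const _ (c, d)
  let Y : ℂ → C(Icc a b, ℂ × ℂ) := fun z => Ring.inverse (A z) Y0
  have hYd : Differentiable ℂ Y := by
    have hA' : A = fun z => A 0 + z • Volterra.op hab 0 (fun _ => 1)
      (fun _ _ => intervalIntegrable_const) := funext hAlin
    have h1 := differentiable_inverse_add_smul (A 0) (Volterra.op hab 0 (fun _ => 1)
      (fun _ _ => intervalIntegrable_const)) (fun z => by rw [← hAlin]; exact hAu z) Y0
    simp only [← hAlin] at h1
    exact h1
  have hYeq : ∀ z, Y z = Y0 + Volterra.op hab 1 (fun t => W t - z) (hq z) (Y z) := by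
    intro z
    have : A z (Y z) = Y0 := by
      show A z (Ring.inverse (A z) Y0) = Y0
      rw [← mul_apply_eq_comp, Ring.mul_inverse_cancel _ (hAu z)]; rfl
    have h2 : A z (Y z) = Y z - Volterra.op hab 1 (fun t => W t - z) (hq z) (Y z) := rfl
    rw [h2] at this
    rw [← this]; abel
  have hYx : ∀ z (x : Icc a b), Y z x = (c + ∫ t in a..x, (Y z (projIcc a b hab t)).2,
      d + ∫ t in a..x, (W t - z) * (Y z (projIcc a b hab t)).1) := by
    intro z x
    conv_lhs => rw [hYeq z]
    rw [ContinuousMap.add_apply, Volterra.op_apply]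
    simp [Y0]
  have hYc : ∀ z, Continuous fun t => Y z (projIcc a b hab t) := fun z =>
    (Y z).continuous.comp continuous_projIcc
  have hYa : ∀ z, Y z (projIcc a b hab a) = (c, d) := by
    intro z
    rw [projIcc_left, hYx]; simp
  refine ⟨fun z x => (Y z (projIcc a b hab x)).1, fun z x => (Y z (projIcc a b hab x)).2,
    fun z => ⟨⟨(hYc z).fst.continuousOn, (hYc z).snd.continuousOn, fun x hx => ?_, fun x hx => ?_⟩,
      congrArg Prod.fst (hYa z), congrArg Prod.snd (hYa z)⟩, fun x hx => ⟨?_, ?_⟩⟩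
  · beta_reduce
    rw [hYa]
    conv_lhs => rw [projIcc_of_mem hab hx, hYx]
  · beta_reduce
    rw [hYa]
    conv_lhs => rw [projIcc_of_mem hab hx, hYx]
  · exact fun z => (((ContinuousMap.evalCLM ℂ (projIcc a b hab x)).differentiableAt).comp z
      (hYd z)).fst
  · exact fun z => (((ContinuousMap.evalCLM ℂ (projIcc a b hab x)).differentiableAt).comp z
      (hYd z)).snd

/-! ### Solutions on half-lines -/

theorem intervalIntegrable_of_locallyIntegrableOn_Ici {V : ℝ → ℝ}
    (hV : LocallyIntegrableOn V (Ici 0) volume) {x y : ℝ} (hx : 0 ≤ x) (hy : 0 ≤ y) :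
    IntervalIntegrable (fun t => (V t : ℂ)) volume x y := by
  have h : IntegrableOn V (uIcc x y) :=
    hV.integrableOn_compact_subset (fun t ht => le_trans (le_min hx hy) ht.1) isCompact_uIcc
  have h2 : IntegrableOn (fun t => (V t : ℂ)) (uIcc x y) := h.ofReal
  exact h2.intervalIntegrable

/-- Nothing is known about `V` to the left of `0`, while the Volterra operator asks for
integrability on every interval. Cutting `V` off by zero does not affect solutions on `[a, b]` with
`0 ≤ a`. -/
theorem intervalIntegrable_indicator_Ici {V : ℝ → ℝ}
    (hV : LocallyIntegrableOn V (Ici 0) volume) (x y : ℝ) :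
    IntervalIntegrable ((Ici 0).indicator fun t => (V t : ℂ)) volume x y := by
  have h : IntegrableOn V (Icc 0 (max x y)) :=
    hV.integrableOn_compact_subset (fun t ht => ht.1) isCompact_Icc
  have h2 : IntegrableOn (fun t => (V t : ℂ)) (Icc 0 (max x y)) := h.ofReal
  rw [intervalIntegrable_iff, ← integrable_indicator_iff measurableSet_uIoc, indicator_indicator,
    integrable_indicator_iff (measurableSet_uIoc.inter measurableSet_Ici)]
  exact h2.mono_set fun t ht => ⟨ht.2, ht.1.2⟩

section

variable {V : ℝ → ℝ} {z : ℂ} {a b : ℝ} {f f' g g' : ℝ → ℂ}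

theorem IsSchrodingerSolution.continuousOn (h : IsSchrodingerSolution V z a f f') :
    ContinuousOn f (Ici a) := fun x hx => (h.hasDeriv x hx).continuousWithinAt

theorem IsSchrodingerSolution.isSolutionOn (h : IsSchrodingerSolution V z a f f')
    (hV : LocallyIntegrableOn V (Ici 0) volume) (ha : 0 ≤ a) (hab : a ≤ b) :
    IsSolutionOn (fun t => (V t : ℂ) - z) a b f f' := by
  have hc : ContinuousOn f (Icc a b) := h.continuousOn.mono Icc_subset_Ici_self
  have hi : IntervalIntegrable (fun t => ((V t : ℂ) - z) * f t) volume a b :=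
    ((intervalIntegrable_of_locallyIntegrableOn_Ici hV ha (ha.trans hab)).sub
      intervalIntegrable_const).mul_continuousOn (by rwa [uIcc_of_le hab])
  have hc' : ContinuousOn f' (Icc a b) := by
    have h1 := intervalIntegral.continuousOn_primitive_interval' hi (left_mem_uIcc (a := a))
    rw [uIcc_of_le hab] at h1
    exact (continuousOn_const.add h1).congr fun x hx => h.deriv_eq x hx.1
  refine ⟨hc, hc', fun x hx => ?_, fun x hx => h.deriv_eq x hx.1⟩
  have := intervalIntegral.integral_eq_sub_of_hasDeriv_right_of_le hx.1
    (hc.mono (Icc_subset_Icc_right hx.2))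
    (fun t ht => (h.hasDeriv t ht.1.le).mono (fun s hs => ht.1.le.trans (le_of_lt hs)))
    (ContinuousOn.intervalIntegrable (by
      rw [uIcc_of_le hx.1]; exact hc'.mono (Icc_subset_Icc_right hx.2)))
  rw [this]; ring

theorem isSchrodingerSolution_of_isSolutionOn
    (h : ∀ b, a ≤ b → IsSolutionOn (fun t => (V t : ℂ) - z) a b f f') :
    IsSchrodingerSolution V z a f f' := by
  refine ⟨fun x hx => ?_, fun x hx => (h x hx).eq' x (right_mem_Icc.2 hx)⟩
  have hc' : ContinuousOn f' (Ici a) := fun t ht =>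
    ((h (t + 1) (le_trans ht (by linarith))).cont' t ⟨ht, by linarith⟩).mono_of_mem_nhdsWithin
      (by
        refine mem_nhdsWithin.2 ⟨Iio (t + 1), isOpen_Iio, by simp, ?_⟩
        rintro s ⟨hs1, hs2⟩
        exact ⟨hs2, le_of_lt hs1⟩)
  -- Freezing `f'` to the left of `a` makes the integrand continuous on the whole line, so the
  -- fundamental theorem of calculus also covers the end point `a`.
  have hg : Continuous fun t => f' (max a t) :=
    hc'.comp_continuous (by fun_prop) fun t => mem_Ici.2 (le_max_left _ _)
  have h1 : HasDerivAt (fun t => f a + ∫ s in a..t, f' (max a s)) (f' (max a x)) x :=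
    (hg.integral_hasStrictDerivAt a x).hasDerivAt.const_add _
  rw [max_eq_right hx] at h1
  refine h1.hasDerivWithinAt.congr_of_mem (fun t ht => ?_) hx
  rw [(h t ht).eq t (right_mem_Icc.2 ht)]
  congr 1
  refine intervalIntegral.integral_congr fun s hs => ?_
  rw [uIcc_of_le ht] at hs
  simp only [max_eq_right hs.1]

theorem IsSchrodingerSolution.lin_comb (hf : IsSchrodingerSolution V z a f f')
    (hg : IsSchrodingerSolution V z a g g') (hV : LocallyIntegrableOn V (Ici 0) volume)
    (ha : 0 ≤ a) (r s : ℂ) :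
    IsSchrodingerSolution V z a (fun x => r * f x + s * g x) (fun x => r * f' x + s * g' x) :=
  isSchrodingerSolution_of_isSolutionOn fun _ hb =>
    (hf.isSolutionOn hV ha hb).lin_comb (hg.isSolutionOn hV ha hb) (fun _ hx =>
      (intervalIntegrable_of_locallyIntegrableOn_Ici hV ha (ha.trans hx.1)).sub
        intervalIntegrable_const) r s

theorem IsSolutionOn.schrodinger_unique (hV : LocallyIntegrableOn V (Ici 0) volume) (ha : 0 ≤ a)
    (hab : a ≤ b) (hf : IsSolutionOn (fun t => (V t : ℂ) - z) a b f f')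
    (hg : IsSolutionOn (fun t => (V t : ℂ) - z) a b g g') (h0 : f a = g a) (h0' : f' a = g' a) :
    ∀ x ∈ Icc a b, f x = g x ∧ f' x = g' x := by
  have hW : ∀ x ∈ Icc a b, (V x : ℂ) - z = (Ici 0).indicator (fun t => (V t : ℂ)) x - z := by
    intro x hx
    rw [indicator_of_mem (show x ∈ Ici 0 from ha.trans hx.1)]
  exact (hf.congr_potential hW).unique hab (fun x y =>
    (intervalIntegrable_indicator_Ici hV x y).sub intervalIntegrable_const)
    (hg.congr_potential hW) h0 h0'

theorem IsSchrodingerSolution.unique (hf : IsSchrodingerSolution V z a f f')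
    (hg : IsSchrodingerSolution V z a g g') (hV : LocallyIntegrableOn V (Ici 0) volume)
    (ha : 0 ≤ a) (h0 : f a = g a) (h0' : f' a = g' a) {x : ℝ} (hx : a ≤ x) :
    f x = g x ∧ f' x = g' x :=
  (hf.isSolutionOn hV ha hx).schrodinger_unique hV ha hx (hg.isSolutionOn hV ha hx) h0 h0' x
    (right_mem_Icc.2 hx)

/-- The solutions on `[a, a + n]` agree on overlaps by uniqueness, so they glue to one on the
half-line; at `x` the piece with `n = ⌈x - a⌉₊` is used. -/
theorem exists_isSchrodingerSolution (hV : LocallyIntegrableOn V (Ici 0) volume) (ha : 0 ≤ a)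
    (c d : ℂ) :
    ∃ f f' : ℂ → ℝ → ℂ,
      (∀ z, IsSchrodingerSolution V z a (f z) (f' z) ∧ f z a = c ∧ f' z a = d) ∧
      ∀ x, a ≤ x → Differentiable ℂ (fun z => f z x) ∧ Differentiable ℂ (fun z => f' z x) := by
  have hW : ∀ z : ℂ, ∀ x, a ≤ x →
      (Ici 0).indicator (fun t => (V t : ℂ)) x - z = (V x : ℂ) - z := by
    intro z x hx
    rw [indicator_of_mem (show x ∈ Ici 0 from ha.trans hx)]
  have hn : ∀ n : ℕ, a ≤ a + n := fun n => by linarith [n.cast_nonneg (α := ℝ)]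
  choose F F' hF hd using fun n : ℕ =>
    exists_isSolutionOn (hn n) (intervalIntegrable_indicator_Ici hV) c d
  have hsol : ∀ (n : ℕ) z, IsSolutionOn (fun t => (V t : ℂ) - z) a (a + n) (F n z) (F' n z) :=
    fun n z => (hF n z).1.congr_potential fun x hx => hW z x hx.1
  have hcons : ∀ (n m : ℕ) z x, n ≤ m → x ∈ Icc a (a + n) → F n z x = F m z x ∧ F' n z x = F' m z x := by
    intro n m z x hnm hx
    have hnm' : a + (n : ℝ) ≤ a + m := by gcongr
    exact (hsol n z).schrodinger_unique hV ha (hn n) ((hsol m z).mono hnm')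
      ((hF n z).2.1.trans (hF m z).2.1.symm) ((hF n z).2.2.trans (hF m z).2.2.symm) x hx
  have hceil : ∀ x, x ≤ a + ⌈x - a⌉₊ := fun x => by linarith [Nat.le_ceil (x - a)]
  refine ⟨fun z x => F ⌈x - a⌉₊ z x, fun z x => F' ⌈x - a⌉₊ z x, fun z => ⟨?_, ?_, ?_⟩, ?_⟩
  · refine isSchrodingerSolution_of_isSolutionOn fun b hb => ?_
    have hs := (hsol ⌈b - a⌉₊ z).mono (hceil b)
    have e : ∀ x ∈ Icc a b, F ⌈x - a⌉₊ z x = F ⌈b - a⌉₊ z x ∧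
        F' ⌈x - a⌉₊ z x = F' ⌈b - a⌉₊ z x := fun x hx =>
      hcons _ _ z x (Nat.ceil_mono (by linarith [hx.2])) ⟨hx.1, hceil x⟩
    have ha' : a ∈ Icc a b := left_mem_Icc.2 hb
    refine ⟨hs.cont.congr fun x hx => (e x hx).1, hs.cont'.congr fun x hx => (e x hx).2,
      fun x hx => ?_, fun x hx => ?_⟩
    · beta_reduce
      rw [(e x hx).1, (e a ha').1, hs.eq x hx]
      congr 1
      refine intervalIntegral.integral_congr fun t ht => ?_
      rw [uIcc_of_le hx.1] at ht
      exact (e t ⟨ht.1, ht.2.trans hx.2⟩).2.symm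
    · beta_reduce
      rw [(e x hx).2, (e a ha').2, hs.eq' x hx]
      congr 1
      refine intervalIntegral.integral_congr fun t ht => ?_
      rw [uIcc_of_le hx.1] at ht
      simp only [(e t ⟨ht.1, ht.2.trans hx.2⟩).1]
  · exact (hF _ z).2.1
  · exact (hF _ z).2.2
  · exact fun x hx => hd _ x ⟨hx, hceil x⟩

end

/-! ### Lagrange, Wronski and Green identities -/

theorem integral_abs_mul_abs_le_sqrt {α : Type*} [MeasurableSpace α] {μ : Measure α} {f g : α → ℝ}
    (hf : MemLp f 2 μ) (hg : MemLp g 2 μ) :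
    ∫ x, |f x| * |g x| ∂μ ≤ √(∫ x, f x ^ 2 ∂μ) * √(∫ x, g x ^ 2 ∂μ) := by
  have h2 : ENNReal.ofReal 2 = 2 := by simp
  have h := integral_mul_le_Lp_mul_Lq_of_nonneg (μ := μ) (p := 2) (q := 2)
    (f := fun x => |f x|) (g := fun x => |g x|) Real.HolderConjugate.two_two
    (ae_of_all _ fun x => abs_nonneg _) (ae_of_all _ fun x => abs_nonneg _)
    (by rw [h2]; exact hf.abs) (by rw [h2]; exact hg.abs)
  simpa [Real.sqrt_eq_rpow] using h

namespace IsSolutionOn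

variable {a b : ℝ} {q : ℝ → ℂ} {f f' g g' : ℝ → ℂ}

/-- Take imaginary parts in `(f̄ f')' = |f'|² + (V - z)|f|²`. The real potential drops out, and the
`L²` norm of a solution is expressed by its boundary data. -/
theorem lagrange_identity {V : ℝ → ℝ} {z : ℂ} (hab : a ≤ b)
    (hV : IntervalIntegrable (fun t => (V t : ℂ)) volume a b)
    (h : IsSolutionOn (fun t => (V t : ℂ) - z) a b f f') :
    ((starRingEnd ℂ) (f a) * f' a).im - ((starRingEnd ℂ) (f b) * f' b).im
      = z.im * ∫ t in a..b, ‖f t‖ ^ 2 := by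
  have hq : IntervalIntegrable (fun t => (V t : ℂ) - z) volume a b := hV.sub intervalIntegrable_const
  have hc : ContinuousOn f (uIcc a b) := by rw [uIcc_of_le hab]; exact h.cont
  have hc' : ContinuousOn f' (uIcc a b) := by rw [uIcc_of_le hab]; exact h.cont'
  have hcc : ContinuousOn (fun t => (starRingEnd ℂ) (f t)) (uIcc a b) :=
    Complex.continuous_conj.comp_continuousOn hc
  have hcc' : ContinuousOn (fun t => (starRingEnd ℂ) (f' t)) (uIcc a b) :=
    Complex.continuous_conj.comp_continuousOn hc'
  have key := mul_sub_mul_eq_integral_of_primitive (f := fun t => (starRingEnd ℂ) (f t))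
    (f' := fun t => (starRingEnd ℂ) (f' t)) hab hcc'.intervalIntegrable
    (h.intervalIntegrable_mul hab hq)
    (fun x hx => by
      rw [h.eq x hx, map_add, intervalIntegral.integral_of_le hx.1,
        intervalIntegral.integral_of_le hx.1, integral_conj]) h.eq'
  have hint : IntervalIntegrable (fun x => (starRingEnd ℂ) (f' x) * f' x
      + (starRingEnd ℂ) (f x) * (((V x : ℂ) - z) * f x)) volume a b :=
    (hcc'.mul hc').intervalIntegrable.add
      ((h.intervalIntegrable_mul hab hq).continuousOn_mul hcc)
  have him := Complex.imCLM.intervalIntegral_comp_comm hint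
  rw [← key] at him
  simp only [Complex.imCLM_apply, Complex.sub_im] at him
  have e : ∀ x, ((starRingEnd ℂ) (f' x) * f' x
      + (starRingEnd ℂ) (f x) * (((V x : ℂ) - z) * f x)).im = (-z.im) * ‖f x‖ ^ 2 := by
    intro x
    rw [← Complex.normSq_eq_norm_sq, Complex.normSq_apply]
    simp only [Complex.add_im, Complex.mul_im, Complex.conj_re, Complex.conj_im, Complex.sub_re,
      Complex.ofReal_re, Complex.sub_im, Complex.ofReal_im, Complex.mul_re]
    ring
  simp only [e] at him
  rw [intervalIntegral.integral_const_mul] at him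
  linarith

theorem wronskian_eq (hab : a ≤ b) (hq : IntervalIntegrable q volume a b)
    (hf : IsSolutionOn q a b f f') (hg : IsSolutionOn q a b g g') :
    f b * g' b - f' b * g b = f a * g' a - f' a * g a := by
  have h1 := mul_sub_mul_eq_integral_of_primitive hab (hf.intervalIntegrable_deriv hab)
    (hg.intervalIntegrable_mul hab hq) hf.eq hg.eq'
  have h2 := mul_sub_mul_eq_integral_of_primitive hab (hf.intervalIntegrable_mul hab hq)
    (hg.intervalIntegrable_deriv hab) hf.eq' hg.eq
  have : ∫ x in a..b, (f' x * g' x + f x * (q x * g x))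
      = ∫ x in a..b, (q x * f x * g x + f' x * g' x) := by
    refine intervalIntegral.integral_congr fun x _ => ?_
    ring
  linear_combination h1 - h2 + this

/-- Integrates `(f' ψ - f ψ')' = f (q ψ - ψ'')`. All derivatives on the right fall on the smooth
function `ψ`, so boundary data of `f` are controlled by its `L²` norm alone. -/
theorem green_identity (hab : a ≤ b) (hq : IntervalIntegrable q volume a b)
    (h : IsSolutionOn q a b f f') {ψ ψ' ψ'' : ℝ → ℂ} (hψ : ∀ x, HasDerivAt ψ (ψ' x) x)
    (hψ' : ∀ x, HasDerivAt ψ' (ψ'' x) x) (hc : Continuous ψ'') :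
    f' b * ψ b - f b * ψ' b - (f' a * ψ a - f a * ψ' a)
      = ∫ x in a..b, f x * (q x * ψ x - ψ'' x) := by
  have hψc : Continuous ψ := continuous_iff_continuousAt.2 fun x => (hψ x).continuousAt
  have hψc' : Continuous ψ' := continuous_iff_continuousAt.2 fun x => (hψ' x).continuousAt
  have p1 : ∀ x ∈ Icc a b, ψ x = ψ a + ∫ t in a..x, ψ' t := fun x _ => by
    rw [intervalIntegral.integral_eq_sub_of_hasDerivAt (fun t _ => hψ t)
      (hψc'.intervalIntegrable _ _)]; ring
  have p2 : ∀ x ∈ Icc a b, ψ' x = ψ' a + ∫ t in a..x, ψ'' t := fun x _ => by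
    rw [intervalIntegral.integral_eq_sub_of_hasDerivAt (fun t _ => hψ' t)
      (hc.intervalIntegrable _ _)]; ring
  have hfc : ContinuousOn f (uIcc a b) := by rw [uIcc_of_le hab]; exact h.cont
  have hfc' : ContinuousOn f' (uIcc a b) := by rw [uIcc_of_le hab]; exact h.cont'
  have h1 := mul_sub_mul_eq_integral_of_primitive hab (h.intervalIntegrable_mul hab hq)
    (hψc'.intervalIntegrable _ _) h.eq' p1
  have h2 := mul_sub_mul_eq_integral_of_primitive hab (h.intervalIntegrable_deriv hab)
    (hc.intervalIntegrable _ _) h.eq p2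
  have i1 : IntervalIntegrable (fun x => q x * f x * ψ x + f' x * ψ' x) volume a b :=
    ((h.intervalIntegrable_mul hab hq).mul_continuousOn hψc.continuousOn).add
      (hfc'.mul hψc'.continuousOn).intervalIntegrable
  have i2 : IntervalIntegrable (fun x => f' x * ψ' x + f x * ψ'' x) volume a b :=
    ((hfc'.mul hψc'.continuousOn).add (hfc.mul hc.continuousOn)).intervalIntegrable
  have h3 : ∫ x in a..b, f x * (q x * ψ x - ψ'' x) =
      (∫ x in a..b, (q x * f x * ψ x + f' x * ψ' x)) - ∫ x in a..b, (f' x * ψ' x + f x * ψ'' x) := by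
    rw [← intervalIntegral.integral_sub i1 i2]
    refine intervalIntegral.integral_congr fun x _ => ?_
    ring
  rw [h3, ← h1, ← h2]
  ring

/-- A bound on the boundary terms in Green's identity by `L²` norms. -/
theorem norm_green_le {V : ℝ → ℝ} {z : ℂ} (hab : a ≤ b)
    (hV : IntervalIntegrable (fun t => (V t : ℂ)) volume a b)
    (hV2 : IntegrableOn (fun t => V t ^ 2) (Ioc a b))
    (h : IsSolutionOn (fun t => (V t : ℂ) - z) a b f f')
    {ψ ψ' ψ'' : ℝ → ℂ} (hψ : ∀ x, HasDerivAt ψ (ψ' x) x)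
    (hψ' : ∀ x, HasDerivAt ψ' (ψ'' x) x) (hc : Continuous ψ'') {C D : ℝ}
    (hC : ∀ x ∈ Icc a b, ‖ψ x‖ ≤ C) (hD : ∀ x ∈ Icc a b, ‖z * ψ x + ψ'' x‖ ≤ D) :
    ‖f' b * ψ b - f b * ψ' b - (f' a * ψ a - f a * ψ' a)‖
      ≤ √(∫ t in a..b, ‖f t‖ ^ 2) * (C * √(∫ t in a..b, V t ^ 2) + D * √(b - a)) := by
  have hC0 : 0 ≤ C := (norm_nonneg _).trans (hC a (left_mem_Icc.2 hab))
  have hD0 : 0 ≤ D := (norm_nonneg _).trans (hD a (left_mem_Icc.2 hab))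
  have hVi : IntegrableOn (fun t => (V t : ℂ)) (Ioc a b) :=
    (intervalIntegrable_iff_integrableOn_Ioc_of_le hab).1 hV
  have hVm : AEStronglyMeasurable V (volume.restrict (Ioc a b)) := by
    simpa using hVi.re.aestronglyMeasurable
  have hVL : MemLp V 2 (volume.restrict (Ioc a b)) := (memLp_two_iff_integrable_sq hVm).2 hV2
  have hfm : AEStronglyMeasurable f (volume.restrict (Ioc a b)) :=
    (h.cont.mono Ioc_subset_Icc_self).aestronglyMeasurable measurableSet_Ioc
  have hf2 : IntegrableOn (fun t => ‖f t‖ ^ 2) (Ioc a b) :=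
    ((h.cont.norm.pow 2).integrableOn_Icc).mono_set Ioc_subset_Icc_self
  have hfL : MemLp (fun t => ‖f t‖) 2 (volume.restrict (Ioc a b)) :=
    ((memLp_two_iff_integrable_sq_norm hfm).2 hf2).norm
  have h1L : MemLp (fun _ : ℝ => (1 : ℝ)) 2 (volume.restrict (Ioc a b)) := memLp_const 1
  have hfV : Integrable (fun t => |‖f t‖| * |V t|) (volume.restrict (Ioc a b)) :=
    hfL.abs.integrable_mul hVL.abs
  have hf1 : Integrable (fun t => |‖f t‖| * |(1 : ℝ)|) (volume.restrict (Ioc a b)) :=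
    hfL.abs.integrable_mul h1L.abs
  have cs1 := integral_abs_mul_abs_le_sqrt hfL hVL
  have cs2 := integral_abs_mul_abs_le_sqrt hfL h1L
  have hq : IntervalIntegrable (fun t => (V t : ℂ) - z) volume a b := hV.sub intervalIntegrable_const
  rw [h.green_identity hab hq hψ hψ' hc]
  simp only [intervalIntegral.integral_of_le hab]
  have hlen : ∫ _ in Ioc a b, (1 : ℝ) ^ 2 = b - a := by simp [hab]
  rw [hlen] at cs2
  calc ‖∫ t in Ioc a b, f t * (((V t : ℂ) - z) * ψ t - ψ'' t)‖
      ≤ ∫ t in Ioc a b, (C * (|‖f t‖| * |V t|) + D * (|‖f t‖| * |(1 : ℝ)|)) := by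
        refine norm_integral_le_of_norm_le ((hfV.const_mul C).add (hf1.const_mul D)) ?_
        filter_upwards [ae_restrict_mem measurableSet_Ioc] with t ht
        have ht' : t ∈ Icc a b := Ioc_subset_Icc_self ht
        -- The first term is small because `V` is small in `L²`; the second is the defect of `ψ` as
        -- a solution of the free equation.
        have e : ((V t : ℂ) - z) * ψ t - ψ'' t = V t * ψ t - (z * ψ t + ψ'' t) := by ring
        rw [norm_mul, e, abs_one, mul_one, abs_norm]
        have h1 : ‖(V t : ℂ) * ψ t - (z * ψ t + ψ'' t)‖ ≤ |V t| * C + D := by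
          refine (norm_sub_le _ _).trans (add_le_add ?_ (hD t ht'))
          rw [norm_mul, Complex.norm_real, Real.norm_eq_abs]
          gcongr
          exact hC t ht'
        calc ‖f t‖ * ‖(V t : ℂ) * ψ t - (z * ψ t + ψ'' t)‖ ≤ ‖f t‖ * (|V t| * C + D) := by gcongr
          _ = _ := by ring
    _ = C * (∫ t in Ioc a b, |‖f t‖| * |V t|) + D * ∫ t in Ioc a b, |‖f t‖| * |(1 : ℝ)| := by
        rw [integral_add (hfV.const_mul C) (hf1.const_mul D), integral_const_mul,
          integral_const_mul]
    _ ≤ C * (√(∫ t in Ioc a b, ‖f t‖ ^ 2) * √(∫ t in Ioc a b, V t ^ 2))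
        + D * (√(∫ t in Ioc a b, ‖f t‖ ^ 2) * √(b - a)) := by gcongr
    _ = _ := by ring

end IsSolutionOn

/-! ### Limit point case at infinity -/

theorem integrableOn_sq_of_lintegral_lt_top {V : ℝ → ℝ} (hV : LocallyIntegrableOn V (Ici 0) volume) {x y : ℝ}
    (hx : 0 ≤ x) (hxy : x ≤ y)
    (h : ∫⁻ t in Ioo x y, ENNReal.ofReal (V t ^ 2) < ⊤) :
    IntegrableOn (fun t => V t ^ 2) (Ioc x y) ∧
      ∫ t in x..y, V t ^ 2 = (∫⁻ t in Ioo x y, ENNReal.ofReal (V t ^ 2)).toReal := by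
  have hi : IntegrableOn V (Icc x y) :=
    hV.integrableOn_compact_subset (fun t ht => hx.trans ht.1) isCompact_Icc
  have hm : AEStronglyMeasurable V (volume.restrict (Ioc x y)) :=
    (hi.mono_set Ioc_subset_Icc_self).aestronglyMeasurable
  have hr : (volume : Measure ℝ).restrict (Ioo x y) = volume.restrict (Ioc x y) :=
    Measure.restrict_congr_set Ioo_ae_eq_Ioc
  rw [hr] at h ⊢
  refine ⟨⟨hm.pow 2, ?_⟩, ?_⟩
  · rw [hasFiniteIntegral_iff_ofReal (ae_of_all _ fun t => sq_nonneg _)]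
    exact h
  · rw [intervalIntegral.integral_of_le hxy,
      integral_eq_lintegral_of_nonneg_ae (ae_of_all _ fun t => sq_nonneg _) (hm.pow 2)]

/-- A sparse interval of length `n + 1` inside `[0, ∞)` has a last unit piece that starts at `n` or
later. These pieces are all that the limit point argument needs. -/
theorem IsL2Sparse.exists_seq {V : ℝ → ℝ} (hV : IsL2Sparse V) :
    ∃ x : ℕ → ℝ, Tendsto x atTop atTop ∧ ∀ n, 0 ≤ x n ∧
      IntegrableOn (fun t => V t ^ 2) (Ioc (x n) (x n + 1)) ∧
      ∫ t in (x n)..(x n + 1), V t ^ 2 ≤ 1 := by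
  have h : ∀ n : ℕ, ∃ x : ℝ, (n : ℝ) ≤ x ∧ IntegrableOn (fun t => V t ^ 2) (Ioc x (x + 1)) ∧
      ∫ t in x..(x + 1), V t ^ 2 ≤ 1 := by
    intro n
    obtain ⟨a, b, ha, hab, h⟩ := hV.exists_interval 1 one_pos (n + 1) (by positivity)
    have hn : (0 : ℝ) ≤ n := n.cast_nonneg
    have h1 : ∫⁻ t in Ioo (b - 1) (b - 1 + 1), ENNReal.ofReal (V t ^ 2) < ENNReal.ofReal 1 :=
      (lintegral_mono_set (Ioo_subset_Ioo (by linarith) (by linarith))).trans_lt h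
    obtain ⟨h2, h3⟩ := integrableOn_sq_of_lintegral_lt_top hV.locallyIntegrable (x := b - 1)
      (y := b - 1 + 1) (by linarith) (by linarith) (h1.trans ENNReal.ofReal_lt_top)
    refine ⟨b - 1, by linarith, h2, ?_⟩
    rw [h3]
    exact ENNReal.toReal_le_of_le_ofReal zero_le_one h1.le
  choose x hx using h
  refine ⟨x, tendsto_atTop_mono (fun n => (hx n).1) tendsto_natCast_atTop_atTop, fun n =>
    ⟨(Nat.cast_nonneg n).trans (hx n).1, (hx n).2⟩⟩

section

variable {V : ℝ → ℝ} {z : ℂ} {a b : ℝ} {f f' g g' : ℝ → ℂ}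

/-- A Sobolev type estimate at the left end point of a unit interval. -/
theorem IsSolutionOn.abs_im_conj_mul_le {x : ℝ} (h : IsSolutionOn (fun t => (V t : ℂ) - z) x (x + 1) f f')
    (hV : IntervalIntegrable (fun t => (V t : ℂ)) volume x (x + 1))
    (hV2 : IntegrableOn (fun t => V t ^ 2) (Ioc x (x + 1)))
    (hV1 : ∫ t in x..(x + 1), V t ^ 2 ≤ 1) :
    |((starRingEnd ℂ) (f x) * f' x).im| ≤ 3 * (‖z‖ + 5) ^ 2 * ∫ t in x..(x + 1), ‖f t‖ ^ 2 := by
  set N := √(∫ t in x..(x + 1), ‖f t‖ ^ 2) with hN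
  have hx : x ≤ x + 1 := by linarith
  have hN2 : N ^ 2 = ∫ t in x..(x + 1), ‖f t‖ ^ 2 :=
    Real.sq_sqrt (intervalIntegral.integral_nonneg hx fun _ _ => by positivity)
  have hs : √(∫ t in x..(x + 1), V t ^ 2) ≤ 1 :=
    Real.sqrt_le_iff.2 ⟨zero_le_one, by simpa using hV1⟩
  have hN0 : 0 ≤ N := Real.sqrt_nonneg _
  have hd : ∀ t : ℝ, HasDerivAt (fun t : ℝ => ((t : ℂ) - x)) 1 t := fun t =>
    (Complex.ofRealCLM.hasDerivAt (x := t)).sub_const (x : ℂ)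
  -- Test functions that vanish with their derivative at `x + 1` leave only the boundary terms at
  -- `x`. With `s = t - x`, the choice `(1 - s)²` gives `f' + 2 f` and the choice `s (1 - s)²` gives
  -- `f`. Both are at most `1` in modulus on `[0, 1]`, with second derivatives `2` and `-4 + 6 s` of
  -- modulus at most `4`.
  have hfin : ∀ u v w : ℝ → ℂ, (∀ t, HasDerivAt u (v t) t) → (∀ t, HasDerivAt v (w t) t) →
      Continuous w → (∀ t ∈ Icc x (x + 1), ‖u t‖ ≤ 1) → (∀ t ∈ Icc x (x + 1), ‖w t‖ ≤ 4) →
      u (x + 1) = 0 → v (x + 1) = 0 → ‖f' x * u x - f x * v x‖ ≤ N * (‖z‖ + 5) := by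
    intro u v w hu hv hw hub hwb hu1 hv1
    have := h.norm_green_le hx hV hV2 hu hv hw (C := 1) (D := ‖z‖ + 4) hub (fun t ht => by
      refine (norm_add_le _ _).trans (add_le_add ?_ (hwb t ht))
      rw [norm_mul]
      exact mul_le_of_le_one_right (norm_nonneg _) (hub t ht))
    rw [hu1, hv1, mul_zero, mul_zero, sub_zero, zero_sub, norm_neg] at this
    refine this.trans ?_
    rw [← hN]
    refine mul_le_mul_of_nonneg_left ?_ hN0
    rw [show x + 1 - x = 1 by ring, Real.sqrt_one]
    linarith
  have hreal : ∀ t ∈ Icc x (x + 1), ∃ s : ℝ, (t : ℂ) - x = s ∧ 0 ≤ s ∧ s ≤ 1 := fun t ht =>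
    ⟨t - x, by push_cast; ring, by linarith [ht.1], by linarith [ht.2]⟩
  have e1 := hfin (fun t => (1 - ((t : ℂ) - x)) ^ 2) (fun t => -2 * (1 - ((t : ℂ) - x)))
    (fun _ => 2)
    (fun t => (((hd t).const_sub 1).pow 2).congr_deriv (by norm_num))
    (fun t => (((hd t).const_sub 1).const_mul (-2)).congr_deriv (by norm_num))
    continuous_const
    (fun t ht => by
      obtain ⟨s, hs, h0, h1⟩ := hreal t ht
      rw [hs, ← Complex.ofReal_one, ← Complex.ofReal_sub, ← Complex.ofReal_pow, Complex.norm_real,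
        Real.norm_eq_abs, abs_le]
      constructor <;> nlinarith)
    (fun t ht => by norm_num) (by push_cast; ring) (by push_cast; ring)
  have e2 := hfin (fun t => ((t : ℂ) - x) * (1 - ((t : ℂ) - x)) ^ 2)
    (fun t => (1 - ((t : ℂ) - x)) ^ 2 - 2 * ((t : ℂ) - x) * (1 - ((t : ℂ) - x)))
    (fun t => -4 + 6 * ((t : ℂ) - x))
    (fun t => ((hd t).mul (((hd t).const_sub 1).pow 2)).congr_deriv (by simp; ring))
    (fun t => ((((hd t).const_sub 1).pow 2).sub
      (((hd t).const_mul 2).mul ((hd t).const_sub 1))).congr_deriv (by simp; ring))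
    (by fun_prop)
    (fun t ht => by
      obtain ⟨s, hs, h0, h1⟩ := hreal t ht
      rw [hs, ← Complex.ofReal_one, ← Complex.ofReal_sub, ← Complex.ofReal_pow,
        ← Complex.ofReal_mul, Complex.norm_real, Real.norm_eq_abs, abs_le]
      have h3 : 0 ≤ (1 - s) ^ 2 := by positivity
      have h4 : (1 - s) ^ 2 ≤ 1 := by nlinarith
      constructor <;> nlinarith)
    (fun t ht => by
      obtain ⟨s, hs, h0, h1⟩ := hreal t ht
      rw [hs, show (-4 + 6 * (s : ℂ)) = ((-4 + 6 * s : ℝ) : ℂ) by push_cast; ring,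
        Complex.norm_real, Real.norm_eq_abs, abs_le]
      constructor <;> linarith)
    (by push_cast; ring) (by push_cast; ring)
  simp only [sub_self, sub_zero, one_pow, mul_one, mul_zero, zero_sub, norm_neg] at e1 e2
  have e3 : ‖f' x‖ ≤ 3 * (N * (‖z‖ + 5)) := by
    calc ‖f' x‖ = ‖(f' x - f x * -2) - 2 * f x‖ := by congr 1; ring
      _ ≤ ‖f' x - f x * -2‖ + ‖2 * f x‖ := norm_sub_le _ _
      _ ≤ _ := by
        have h2 : ‖2 * f x‖ = 2 * ‖f x‖ := by simp
        rw [h2]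
        linarith
  calc |((starRingEnd ℂ) (f x) * f' x).im| ≤ ‖(starRingEnd ℂ) (f x) * f' x‖ := Complex.abs_im_le_norm _
    _ = ‖f x‖ * ‖f' x‖ := by rw [norm_mul, RCLike.norm_conj]
    _ ≤ (N * (‖z‖ + 5)) * (3 * (N * (‖z‖ + 5))) := by gcongr
    _ = _ := by rw [← hN2]; ring

theorem IsSolutionOn.restrict_left {q : ℝ → ℂ} {c : ℝ} (hs : IsSolutionOn q a b f f') (hac : a ≤ c)
    (hcb : c ≤ b) (hq : IntervalIntegrable q volume a b) : IsSolutionOn q c b f f' := by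
  have hab := hac.trans hcb
  have hsub : ∀ y ∈ Icc a b, uIcc a y ⊆ uIcc a b := fun y hy => by
    rw [uIcc_of_le hy.1, uIcc_of_le hab]; exact Icc_subset_Icc_right hy.2
  have i1 : ∀ y ∈ Icc a b, IntervalIntegrable f' volume a y := fun y hy =>
    (hs.intervalIntegrable_deriv hab).mono_set (hsub y hy)
  have i2 : ∀ y ∈ Icc a b, IntervalIntegrable (fun t => q t * f t) volume a y := fun y hy =>
    (hs.intervalIntegrable_mul hab hq).mono_set (hsub y hy)
  have m1 : c ∈ Icc a b := ⟨hac, hcb⟩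
  refine ⟨hs.cont.mono (Icc_subset_Icc_left hac), hs.cont'.mono (Icc_subset_Icc_left hac),
    fun y hy => ?_, fun y hy => ?_⟩
  · have m2 : y ∈ Icc a b := ⟨hac.trans hy.1, hy.2⟩
    rw [hs.eq y m2, hs.eq c m1, add_assoc, intervalIntegral.integral_add_adjacent_intervals
      (i1 _ m1) ((i1 _ m1).symm.trans (i1 _ m2))]
  · have m2 : y ∈ Icc a b := ⟨hac.trans hy.1, hy.2⟩
    rw [hs.eq' y m2, hs.eq' c m1, add_assoc, intervalIntegral.integral_add_adjacent_intervals
      (i2 _ m1) ((i2 _ m1).symm.trans (i2 _ m2))]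

/-- In Lagrange's identity on `[a, x n]` the boundary term at `x n` is at most a constant times `∫
|f|²` over `[x n, x n + 1]`, and this tends to zero for square integrable `f`. No boundary condition
at infinity is needed: this is the limit point case. -/
theorem IsSchrodingerSolution.im_conj_mul_eq (hV : IsL2Sparse V) (ha : 0 ≤ a)
    (h : IsSchrodingerSolution V z a f f') (hf : MemLp f 2 (volume.restrict (Ioi a))) :
    ((starRingEnd ℂ) (f a) * f' a).im = z.im * ∫ t in Ioi a, ‖f t‖ ^ 2 := by
  obtain ⟨x, hx, hx'⟩ := hV.exists_seq
  have hi : IntegrableOn (fun t => ‖f t‖ ^ 2) (Ioi a) :=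
    (memLp_two_iff_integrable_sq_norm hf.aestronglyMeasurable).1 hf
  have t1 : Tendsto (fun n => ∫ t in a..x n, ‖f t‖ ^ 2) atTop (𝓝 (∫ t in Ioi a, ‖f t‖ ^ 2)) :=
    intervalIntegral_tendsto_integral_Ioi a hi hx
  have t2 : Tendsto (fun n => ∫ t in a..(x n + 1), ‖f t‖ ^ 2) atTop
      (𝓝 (∫ t in Ioi a, ‖f t‖ ^ 2)) :=
    intervalIntegral_tendsto_integral_Ioi a hi (tendsto_atTop_add_const_right _ 1 hx)
  have hVi : ∀ {s t : ℝ}, 0 ≤ s → 0 ≤ t → IntervalIntegrable (fun t => (V t : ℂ)) volume s t :=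
    fun hs ht => intervalIntegrable_of_locallyIntegrableOn_Ici hV.locallyIntegrable hs ht
  have hev : ∀ᶠ n in atTop, a ≤ x n := hx.eventually_ge_atTop a
  have t3 : Tendsto (fun n => ((starRingEnd ℂ) (f (x n)) * f' (x n)).im) atTop (𝓝 0) := by
    have h0 := ((t2.sub t1).const_mul (3 * (‖z‖ + 5) ^ 2))
    rw [sub_self, mul_zero] at h0
    refine squeeze_zero_norm' ?_ h0
    filter_upwards [hev] with n hn
    have hs : IsSolutionOn (fun t => (V t : ℂ) - z) (x n) (x n + 1) f f' :=
      (h.isSolutionOn hV.locallyIntegrable ha (show a ≤ x n + 1 by linarith)).restrict_left hn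
        (by linarith) ((hVi ha (by linarith)).sub intervalIntegrable_const)
    have hxn := (hx' n).1
    have key := hs.abs_im_conj_mul_le (hVi hxn (by linarith)) (hx' n).2.1 (hx' n).2.2
    rw [Real.norm_eq_abs, intervalIntegral.integral_interval_sub_left]
    · exact key
    · exact (intervalIntegrable_iff_integrableOn_Ioc_of_le (by linarith)).2
        (hi.mono_set fun t ht => ht.1)
    · exact (intervalIntegrable_iff_integrableOn_Ioc_of_le hn).2 (hi.mono_set fun t ht => ht.1)
  have t4 := t3.add (t1.const_mul z.im)
  rw [zero_add] at t4
  refine tendsto_nhds_unique (tendsto_const_nhds.congr' ?_) t4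
  filter_upwards [hev] with n hn
  have := (h.isSolutionOn hV.locallyIntegrable ha hn).lagrange_identity hn (hVi ha (ha.trans hn))
  linarith

theorem IsSchrodingerSolution.deriv_eq_zero_of_eqOn_zero (h : IsSchrodingerSolution V z a f f')
    (hab : a < b) (h0 : ∀ x ∈ Ioo a b, f x = 0) : f' a = 0 ∧ f a = 0 := by
  have hfa : f a = 0 := by
    have h1 : Tendsto f (𝓝[Ioo a b] a) (𝓝 (f a)) :=
      ((h.hasDeriv a le_rfl).continuousWithinAt).mono fun t ht => ht.1.le
    have h2 : Tendsto f (𝓝[Ioo a b] a) (𝓝 0) :=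
      tendsto_const_nhds.congr' (by
        filter_upwards [self_mem_nhdsWithin] with t ht using (h0 t ht).symm)
    have : (𝓝[Ioo a b] a).NeBot := by
      rw [nhdsWithin_Ioo_eq_nhdsGT hab]; infer_instance
    exact tendsto_nhds_unique h1 h2
  refine ⟨?_, hfa⟩
  have h1 : HasDerivWithinAt f (f' a) (Ico a b) a :=
    (h.hasDeriv a le_rfl).mono fun t ht => ht.1
  have h2 : HasDerivWithinAt f 0 (Ico a b) a :=
    (hasDerivWithinAt_const a (Ico a b) (0 : ℂ)).congr (fun t ht => by
      rcases eq_or_lt_of_le ht.1 with rfl | h'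
      · exact hfa
      · exact h0 t ⟨h', ht.2⟩) hfa
  exact (uniqueDiffOn_Ico a b a (left_mem_Ico.2 hab)).eq_deriv _ h1 h2

theorem IsSchrodingerSolution.integral_norm_sq_pos (h : IsSchrodingerSolution V z a f f')
    (hab : a < b) (h0 : f a ≠ 0 ∨ f' a ≠ 0) : 0 < ∫ t in a..b, ‖f t‖ ^ 2 := by
  obtain ⟨x, hx, hfx⟩ : ∃ x ∈ Ioo a b, f x ≠ 0 := by
    by_contra! hcon
    have := h.deriv_eq_zero_of_eqOn_zero hab hcon
    tauto
  refine intervalIntegral.integral_pos hab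
    ((h.continuousOn.mono Icc_subset_Ici_self).norm.pow 2) (fun _ _ => by positivity)
    ⟨x, Ioo_subset_Icc_self hx, by positivity⟩

/-- The difference of the two solutions is square integrable and vanishes at `a`, so the preceding
identity forces its `L²` norm to be zero. -/
theorem IsWeylValue.unique (hV : IsL2Sparse V) (ha : 0 ≤ a) (hz : 0 < z.im) {w₁ w₂ : ℂ}
    (h₁ : IsWeylValue V a z w₁) (h₂ : IsWeylValue V a z w₂) : w₁ = w₂ := by
  obtain ⟨f, f', hf, hfa, hfa', hfL⟩ := h₁
  obtain ⟨g, g', hg, hga, hga', hgL⟩ := h₂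
  have hd := hf.lin_comb hg hV.locallyIntegrable ha 1 (-1)
  have hdL : MemLp (fun x => 1 * f x + -1 * g x) 2 (volume.restrict (Ioi a)) :=
    (hfL.const_mul 1).add (hgL.const_mul (-1))
  have key := hd.im_conj_mul_eq hV ha hdL
  simp only [hfa, hga, hfa', hga', mul_one, add_neg_cancel, map_zero, zero_mul,
    Complex.zero_im] at key
  by_contra hne
  have hpos := hd.integral_norm_sq_pos (b := a + 1) (by linarith) (Or.inr (by
    simp only [hfa', hga']
    intro h
    apply hne
    linear_combination h))
  have hi : IntegrableOn (fun t => ‖1 * f t + -1 * g t‖ ^ 2) (Ioi a) :=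
    (memLp_two_iff_integrable_sq_norm hdL.aestronglyMeasurable).1 hdL
  rw [intervalIntegral.integral_of_le (by linarith)] at hpos
  have := hpos.trans_le (setIntegral_mono_set hi (ae_of_all _ fun t => by
    simp only [Pi.zero_apply]; positivity) (LE.le.eventuallyLE fun t ht => ht.1))
  nlinarith

end

/-! ### Herglotz functions -/

/-- A Herglotz function: a holomorphic map of the upper half-plane into itself. -/
structure IsHerglotz (F : ℂ → ℂ) : Prop where
  differentiableOn : DifferentiableOn ℂ F {z | 0 < z.im}
  im_pos : ∀ z : ℂ, 0 < z.im → 0 < (F z).im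

theorem isOpen_setOf_im_pos : IsOpen {z : ℂ | 0 < z.im} :=
  isOpen_lt continuous_const Complex.continuous_im

/-- A pointwise limit of uniformly bounded holomorphic functions is holomorphic. -/
theorem differentiableOn_of_tendsto_of_norm_le {U : Set ℂ} (hU : IsOpen U) {h : ℕ → ℂ → ℂ}
    {k : ℂ → ℂ} {C : ℝ} (hd : ∀ n, DifferentiableOn ℂ (h n) U) (hb : ∀ n, ∀ z ∈ U, ‖h n z‖ ≤ C)
    (hlim : ∀ z ∈ U, Tendsto (fun n => h n z) atTop (𝓝 (k z))) : DifferentiableOn ℂ k U := by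
  intro c hc
  obtain ⟨r, hr, hrU⟩ := Metric.isOpen_iff.1 hU c hc
  set R : ℝ := r / 2 with hR
  have hR0 : 0 < R := by positivity
  have hsub : Metric.closedBall c R ⊆ U :=
    (Metric.closedBall_subset_ball (by linarith)).trans hrU
  have hcm : ∀ θ, circleMap c R θ ∈ U := fun θ =>
    hsub (Metric.sphere_subset_closedBall (circleMap_mem_sphere _ hR0.le _))
  have hcont : ∀ n, Continuous fun θ => h n (circleMap c R θ) := fun n =>
    (hd n).continuousOn.comp_continuous (continuous_circleMap c R) hcm
  have hm : AEStronglyMeasurable (fun θ => k (circleMap c R θ)) volume :=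
    aestronglyMeasurable_of_tendsto_ae atTop (fun n => (hcont n).aestronglyMeasurable)
      (ae_of_all _ fun θ => hlim _ (hcm θ))
  have hkb : ∀ z ∈ U, ‖k z‖ ≤ C := fun z hz =>
    le_of_tendsto (hlim z hz).norm (Eventually.of_forall fun n => hb n z hz)
  have hci : CircleIntegrable k c R := by
    rw [CircleIntegrable, intervalIntegrable_iff]
    exact Measure.integrableOn_of_bounded (M := C) (by simp [ENNReal.mul_eq_top]) hm
      (ae_of_all _ fun θ => hkb _ (hcm θ))
  -- Cauchy's formula passes to the limit by dominated convergence on the circle, so pointwise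
  -- convergence with a uniform bound suffices.
  have hrep : ∀ w ∈ Metric.ball c R,
      k w = (2 * Real.pi * Complex.I : ℂ)⁻¹ • ∮ ζ in C(c, R), (ζ - w)⁻¹ • k ζ := by
    intro w hw
    have h1 : ∀ n, (2 * Real.pi * Complex.I : ℂ)⁻¹ • ∮ ζ in C(c, R), (ζ - w)⁻¹ • h n ζ = h n w := by
      intro n
      have hdc : DiffContOnCl ℂ (h n) (Metric.ball c R) := by
        refine ((hd n).mono ?_).diffContOnCl
        rwa [closure_ball c hR0.ne']
      exact hdc.two_pi_i_inv_smul_circleIntegral_sub_inv_smul hw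
    have hne : ∀ θ, circleMap c R θ - w ≠ 0 := fun θ h0 => by
      have h2 := circleMap_mem_sphere c hR0.le θ
      rw [sub_eq_zero.1 h0, Metric.mem_sphere] at h2
      exact absurd (Metric.mem_ball.1 hw) (by linarith)
    have hcw : Continuous fun θ => (circleMap c R θ - w)⁻¹ :=
      ((continuous_circleMap c R).sub continuous_const).inv₀ hne
    have h2 : Tendsto (fun n => ∮ ζ in C(c, R), (ζ - w)⁻¹ • h n ζ) atTop
        (𝓝 (∮ ζ in C(c, R), (ζ - w)⁻¹ • k ζ)) := by
      refine intervalIntegral.tendsto_integral_filter_of_dominated_convergence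
        (fun θ => ‖deriv (circleMap c R) θ‖ * (‖(circleMap c R θ - w)⁻¹‖ * C)) ?_ ?_ ?_ ?_
      · refine Eventually.of_forall fun n => Continuous.aestronglyMeasurable ?_
        simp only [deriv_circleMap]
        exact ((continuous_circleMap 0 R).mul continuous_const).smul (hcw.smul (hcont n))
      · refine Eventually.of_forall fun n => ae_of_all _ fun θ _ => ?_
        rw [norm_smul, norm_smul]
        gcongr
        exact hb n _ (hcm θ)
      · refine Continuous.intervalIntegrable ?_ _ _
        simp only [deriv_circleMap]
        exact ((continuous_circleMap 0 R).mul continuous_const).norm.mul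
          (hcw.norm.mul continuous_const)
      · exact ae_of_all _ fun θ _ => ((hlim _ (hcm θ)).const_smul _).const_smul _
    refine tendsto_nhds_unique (hlim w (hsub (Metric.ball_subset_closedBall hw))) ?_
    simp only [← h1]
    exact h2.const_smul _
  have hps := hasFPowerSeriesOn_cauchy_integral (R := ⟨R, hR0.le⟩) hci hR0
  have hd1 : DifferentiableAt ℂ
      (fun w => (2 * Real.pi * Complex.I : ℂ)⁻¹ • ∮ ζ in C(c, R), (ζ - w)⁻¹ • k ζ) c :=
    hps.analyticAt.differentiableAt
  refine (hd1.congr_of_eventuallyEq ?_).differentiableWithinAt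
  filter_upwards [Metric.ball_mem_nhds c hR0] with w hw using hrep w hw

/-- The map `w ↦ 1 / (w + i)` turns Herglotz functions into holomorphic functions bounded by one, to
which limit theorems for bounded functions apply. -/
theorem norm_inv_add_I_le {w : ℂ} (hw : 0 < w.im) : ‖(w + Complex.I)⁻¹‖ ≤ 1 := by
  rw [norm_inv]
  refine inv_le_one_of_one_le₀ ?_
  have h1 := Complex.abs_im_le_norm (w + Complex.I)
  have h2 := le_abs_self (w + Complex.I).im
  simp only [Complex.add_im, Complex.I_im] at h1 h2
  linarith

theorem add_I_ne_zero {w : ℂ} (hw : 0 < w.im) : w + Complex.I ≠ 0 := fun h => by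
  have := congrArg Complex.im h
  simp at this
  linarith

theorem IsHerglotz.differentiableOn_inv_add_I {F : ℂ → ℂ} (hF : IsHerglotz F) :
    DifferentiableOn ℂ (fun z => (F z + Complex.I)⁻¹) {z | 0 < z.im} :=
  (hF.differentiableOn.add_const _).inv fun z hz => add_I_ne_zero (hF.im_pos z hz)

theorem IsHerglotz.of_tendsto {F : ℕ → ℂ → ℂ} {G : ℂ → ℂ} (hF : ∀ n, IsHerglotz (F n))
    (hlim : ∀ z : ℂ, 0 < z.im → Tendsto (fun n => F n z) atTop (𝓝 (G z)))
    (hG : ∀ z : ℂ, 0 < z.im → 0 < (G z).im) : IsHerglotz G := by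
  refine ⟨?_, hG⟩
  have h1 : DifferentiableOn ℂ (fun z => (G z + Complex.I)⁻¹) {z | 0 < z.im} :=
    differentiableOn_of_tendsto_of_norm_le isOpen_setOf_im_pos
      (fun n => (hF n).differentiableOn_inv_add_I)
      (fun n z hz => norm_inv_add_I_le ((hF n).im_pos z hz))
      (fun z hz => ((hlim z hz).add_const _).inv₀ (add_I_ne_zero (hG z hz)))
  have h2 : DifferentiableOn ℂ (fun z => ((G z + Complex.I)⁻¹)⁻¹ - Complex.I) {z | 0 < z.im} :=
    (h1.inv fun z hz => inv_ne_zero (add_I_ne_zero (hG z hz))).sub_const _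
  exact h2.congr fun z _ => by simp

/-! ### The Weyl function -/

section

variable {V : ℝ → ℝ} {z : ℂ} {a b : ℝ}

theorem IsWeylValue.im_eq (hV : IsL2Sparse V) (ha : 0 ≤ a) {f f' : ℝ → ℂ}
    (hf : IsSchrodingerSolution V z a f f') (h1 : f a = 1)
    (hL : MemLp f 2 (volume.restrict (Ioi a))) :
    (f' a).im = z.im * ∫ t in Ioi a, ‖f t‖ ^ 2 := by
  have := hf.im_conj_mul_eq hV ha hL
  rwa [h1, map_one, one_mul] at this

theorem IsWeylValue.im_pos (hV : IsL2Sparse V) (ha : 0 ≤ a) (hz : 0 < z.im) {w : ℂ}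
    (h : IsWeylValue V a z w) : 0 < w.im := by
  obtain ⟨f, f', hf, h1, h2, hL⟩ := h
  rw [← h2, IsWeylValue.im_eq hV ha hf h1 hL]
  refine mul_pos hz ?_
  have hpos := hf.integral_norm_sq_pos (b := a + 1) (by linarith) (Or.inl (by rw [h1]; simp))
  have hi : IntegrableOn (fun t => ‖f t‖ ^ 2) (Ioi a) :=
    (memLp_two_iff_integrable_sq_norm hL.aestronglyMeasurable).1 hL
  rw [intervalIntegral.integral_of_le (by linarith)] at hpos
  exact hpos.trans_le (setIntegral_mono_set hi (ae_of_all _ fun t => by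
    simp only [Pi.zero_apply]; positivity) (LE.le.eventuallyLE fun t ht => ht.1))

/-- This set is Weyl's disc. It is bounded because `‖w‖² ∫ ‖v‖² ≤ 2 ∫ ‖u + w v‖² + 2 ∫ ‖u‖²`, where
the membership condition makes the right side at most linear in `‖w‖`. -/
theorem isCompact_weyl_disc {u v : ℝ → ℂ} (hab : a ≤ b) (hu : ContinuousOn u (Icc a b))
    (hv : ContinuousOn v (Icc a b)) (hz : 0 < z.im) (hpos : 0 < ∫ t in a..b, ‖v t‖ ^ 2) :
    IsCompact {w : ℂ | z.im * ∫ t in a..b, ‖u t + w * v t‖ ^ 2 ≤ w.im} := by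
  set p := ∫ t in a..b, ‖v t‖ ^ 2 with hp
  set U := ∫ t in a..b, ‖u t‖ ^ 2 with hU
  have hu' : ContinuousOn u (uIcc a b) := by rwa [uIcc_of_le hab]
  have hv' : ContinuousOn v (uIcc a b) := by rwa [uIcc_of_le hab]
  refine Metric.isCompact_of_isClosed_isBounded ?_ ?_
  · refine isClosed_le (continuous_const.mul ?_) Complex.continuous_im
    have hu2 : Continuous fun t => u (projIcc a b hab t) :=
      hu.comp_continuous (continuous_subtype_val.comp continuous_projIcc) fun t => Subtype.prop _
    have hv2 : Continuous fun t => v (projIcc a b hab t) :=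
      hv.comp_continuous (continuous_subtype_val.comp continuous_projIcc) fun t => Subtype.prop _
    have : (fun w : ℂ => ∫ t in a..b, ‖u t + w * v t‖ ^ 2)
        = fun w : ℂ => ∫ t in a..b, ‖u (projIcc a b hab t) + w * v (projIcc a b hab t)‖ ^ 2 := by
      funext w
      refine intervalIntegral.integral_congr fun t ht => ?_
      rw [uIcc_of_le hab] at ht
      simp only [projIcc_of_mem hab ht]
    rw [this]
    exact intervalIntegral.continuous_parametric_intervalIntegral_of_continuous' (by
      simp only [Function.uncurry_def]
      exact ((hu2.comp continuous_snd).add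
        (continuous_fst.mul (hv2.comp continuous_snd))).norm.pow 2) a b
  · rw [isBounded_iff_forall_norm_le]
    refine ⟨1 + (2 / z.im + 2 * U) / p, fun w hw => ?_⟩
    have hU0 : 0 ≤ U := intervalIntegral.integral_nonneg hab fun _ _ => by positivity
    have hmain : p * ‖w‖ ^ 2 ≤ 2 / z.im * ‖w‖ + 2 * U := by
      have h1 : p * ‖w‖ ^ 2 ≤ 2 * (∫ t in a..b, ‖u t + w * v t‖ ^ 2) + 2 * U := by
        have i1 : IntervalIntegrable (fun t => 2 * ‖u t + w * v t‖ ^ 2) volume a b :=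
          (((hu'.add (hv'.const_smul w)).norm.pow 2).intervalIntegrable).const_mul 2
        have i2 : IntervalIntegrable (fun t => 2 * ‖u t‖ ^ 2) volume a b :=
          ((hu'.norm.pow 2).intervalIntegrable).const_mul 2
        rw [hp, hU, ← intervalIntegral.integral_mul_const, ← intervalIntegral.integral_const_mul,
          ← intervalIntegral.integral_const_mul, ← intervalIntegral.integral_add i1 i2]
        refine intervalIntegral.integral_mono_on hab
          (((hv'.norm.pow 2).intervalIntegrable).mul_const _) (i1.add i2) fun t _ => ?_
        have h2 : ‖w * v t‖ ≤ ‖u t + w * v t‖ + ‖u t‖ := by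
          calc ‖w * v t‖ = ‖(u t + w * v t) - u t‖ := by congr 1; ring
            _ ≤ _ := norm_sub_le _ _
        rw [norm_mul] at h2
        nlinarith [sq_nonneg (‖u t + w * v t‖ - ‖u t‖), norm_nonneg w, norm_nonneg (v t),
          mul_nonneg (norm_nonneg w) (norm_nonneg (v t))]
      have h3 : ∫ t in a..b, ‖u t + w * v t‖ ^ 2 ≤ ‖w‖ / z.im := by
        rw [le_div_iff₀ hz, mul_comm]
        exact (show _ ≤ w.im from hw).trans ((le_abs_self _).trans (Complex.abs_im_le_norm w))
      calc _ ≤ _ := h1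
        _ ≤ 2 * (‖w‖ / z.im) + 2 * U := by gcongr
        _ = _ := by ring
    rcases le_total ‖w‖ 1 with h1 | h1
    · have : 0 ≤ (2 / z.im + 2 * U) / p := by positivity
      linarith
    · have : ‖w‖ ≤ (2 / z.im + 2 * U) / p := by
        rw [le_div_iff₀ hpos]
        have h4 : p * ‖w‖ ^ 2 ≤ (2 / z.im + 2 * U) * ‖w‖ := by nlinarith
        have h5 : 0 < ‖w‖ := by linarith
        nlinarith
      linarith

/-- The Dirichlet `m`-functions of the intervals `(a, a + n + 1)` converge to the Weyl function. -/
theorem exists_herglotz_tendsto_weyl (hV : IsL2Sparse V) (ha : 0 ≤ a) :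
    ∃ m : ℕ → ℂ → ℂ, (∀ n, IsHerglotz (m n)) ∧ ∀ z : ℂ, 0 < z.im →
      ∃ w, IsWeylValue V a z w ∧ Tendsto (fun n => m n z) atTop (𝓝 w) := by
  have hVl := hV.locallyIntegrable
  obtain ⟨u, u', hu, hud⟩ := exists_isSchrodingerSolution hVl ha 1 0
  obtain ⟨v, v', hv, hvd⟩ := exists_isSchrodingerSolution hVl ha 0 1
  have hVi : ∀ b, a ≤ b → IntervalIntegrable (fun t => (V t : ℂ)) volume a b := fun b hb =>
    intervalIntegrable_of_locallyIntegrableOn_Ici hVl ha (ha.trans hb)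
  have hvne : ∀ z : ℂ, 0 < z.im → ∀ b, a < b → v z b ≠ 0 := by
    intro z hz b hb h0
    have h1 := ((hv z).1.isSolutionOn hVl ha hb.le).lagrange_identity hb.le (hVi b hb.le)
    have h2 := (hv z).1.integral_norm_sq_pos hb (Or.inr (by rw [(hv z).2.2]; simp))
    rw [(hv z).2.1, h0] at h1
    simp only [map_zero, zero_mul, Complex.zero_im, sub_zero] at h1
    have := mul_pos hz h2
    linarith
  set B : ℕ → ℝ := fun n => a + n + 1 with hB
  have hBa : ∀ n, a < B n := fun n => by
    have : (0 : ℝ) ≤ n := n.cast_nonneg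
    simp only [hB]; linarith
  -- The value for which `u + m v` vanishes at `B n`. The right boundary term in Lagrange's identity
  -- is then zero, so the defining inequality of the disc holds with equality.
  set m : ℕ → ℂ → ℂ := fun n z => -u z (B n) / v z (B n) with hm
  have hsol : ∀ z w, IsSchrodingerSolution V z a (fun x => 1 * u z x + w * v z x)
      (fun x => 1 * u' z x + w * v' z x) := fun z w => (hu z).1.lin_comb (hv z).1 hVl ha 1 w
  have hdisc : ∀ z : ℂ, 0 < z.im → ∀ n,
      z.im * ∫ t in a..B n, ‖u z t + m n z * v z t‖ ^ 2 ≤ (m n z).im ∧ 0 < (m n z).im := by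
    intro z hz n
    have h1 := ((hsol z (m n z)).isSolutionOn hVl ha (hBa n).le).lagrange_identity (hBa n).le
      (hVi _ (hBa n).le)
    have h2 := (hsol z (m n z)).integral_norm_sq_pos (hBa n) (Or.inl (by
      simp only [(hu z).2.1, (hv z).2.1]; simp))
    have h3 : u z (B n) + m n z * v z (B n) = 0 := by
      simp only [hm]
      field_simp [hvne z hz _ (hBa n)]
      ring
    simp only [(hu z).2.1, (hv z).2.1, (hu z).2.2, (hv z).2.2, mul_zero,
      mul_one, add_zero, zero_add, map_one, one_mul] at h1 h2
    rw [h3, map_zero, zero_mul, Complex.zero_im, sub_zero] at h1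
    rw [h1]
    exact ⟨le_rfl, mul_pos hz h2⟩
  refine ⟨m, fun n => ⟨fun z hz => ?_, fun z hz => (hdisc z hz n).2⟩, fun z hz => ?_⟩
  · exact (((hud _ (hBa n).le).1.differentiableAt.neg).div
      ((hvd _ (hBa n).le).1.differentiableAt) (hvne z hz _ (hBa n))).differentiableWithinAt
  set D : ℕ → Set ℂ := fun n => {w : ℂ | z.im * ∫ t in a..B n, ‖u z t + w * v z t‖ ^ 2 ≤ w.im}
    with hD
  have hcu : ContinuousOn (u z) (Ici a) := (hu z).1.continuousOn
  have hcv : ContinuousOn (v z) (Ici a) := (hv z).1.continuousOn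
  have hci : ∀ w, ContinuousOn (fun t => ‖u z t + w * v z t‖ ^ 2) (Ici a) := fun w =>
    (hcu.add (hcv.const_smul w)).norm.pow 2
  have hDanti : Antitone D := by
    intro i j hij w hw
    refine le_trans ?_ (show z.im * ∫ t in a..B j, ‖u z t + w * v z t‖ ^ 2 ≤ w.im from hw)
    refine mul_le_mul_of_nonneg_left ?_ hz.le
    have hBij : B i ≤ B j := by
      simp only [hB]; gcongr
    exact intervalIntegral.integral_mono_interval le_rfl (hBa i).le hBij
      (ae_of_all _ fun t => by simp only [Pi.zero_apply]; positivity)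
      (ContinuousOn.intervalIntegrable (by
        rw [uIcc_of_le (hBa j).le]; exact (hci w).mono Icc_subset_Ici_self))
  have hDc : ∀ n, IsCompact (D n) := fun n =>
    isCompact_weyl_disc (hBa n).le (hcu.mono Icc_subset_Ici_self) (hcv.mono Icc_subset_Ici_self) hz
      ((hv z).1.integral_norm_sq_pos (hBa n) (Or.inr (by rw [(hv z).2.2]; simp)))
  have hDm : ∀ n, m n z ∈ D n := fun n => (hdisc z hz n).1
  have hweyl : ∀ w ∈ ⋂ n, D n, IsWeylValue V a z w := by
    intro w hw
    refine ⟨_, _, hsol z w, by simp [(hu z).2.1, (hv z).2.1], by simp [(hu z).2.2, (hv z).2.2], ?_⟩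
    simp only [one_mul]
    have hmeas : AEStronglyMeasurable (fun t => u z t + w * v z t) (volume.restrict (Ioi a)) :=
      ((hcu.add (hcv.const_smul w)).mono Ioi_subset_Ici_self).aestronglyMeasurable measurableSet_Ioi
    rw [memLp_two_iff_integrable_sq_norm hmeas]
    have hBt : Tendsto B atTop atTop :=
      tendsto_atTop_add_const_right _ 1
        (tendsto_atTop_add_const_left _ a tendsto_natCast_atTop_atTop)
    refine integrableOn_Ioi_of_intervalIntegral_norm_bounded (w.im / z.im) a (fun n => ?_) hBt
      (Eventually.of_forall fun n => ?_)
    · exact (((hci w).mono Icc_subset_Ici_self).integrableOn_Icc).mono_set Ioc_subset_Icc_self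
    · have := mem_iInter.1 hw n
      simp only [norm_pow, norm_norm]
      rw [le_div_iff₀ hz, mul_comm]
      exact this
  -- The discs are nested and compact, so they have a common point. Every common point is a Weyl
  -- value, hence there is only one, and the points `m n z` of the discs converge to it.
  obtain ⟨w, hw⟩ := IsCompact.nonempty_iInter_of_sequence_nonempty_isCompact_isClosed D
    (fun i => hDanti (Nat.le_succ i)) (fun i => ⟨_, hDm i⟩) (hDc 0) (fun i => (hDc i).isClosed)
  refine ⟨w, hweyl w hw, ?_⟩
  intro N hN
  obtain ⟨i, hi⟩ := exists_subset_nhds_of_isCompact (U := N) hDanti.directed_ge hDc (fun x hx => by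
    rwa [(hweyl x hx).unique hV ha hz (hweyl w hw)])
  refine mem_map.2 ?_
  filter_upwards [eventually_ge_atTop i] with n hn
  exact hi (hDanti hn (hDm n))

theorem existsUnique_isWeylValue (hV : IsL2Sparse V) (ha : 0 ≤ a) (hz : 0 < z.im) :
    ∃! w, IsWeylValue V a z w := by
  obtain ⟨m, -, hm⟩ := exists_herglotz_tendsto_weyl hV ha
  obtain ⟨w, hw, -⟩ := hm z hz
  exact ⟨w, hw, fun y hy => hy.unique hV ha hz hw⟩

theorem isWeylValue_weylM (hV : IsL2Sparse V) (ha : 0 ≤ a) (hz : 0 < z.im) :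
    IsWeylValue V a z (weylM V a z) := by
  have h := (existsUnique_isWeylValue hV ha hz).exists
  rw [weylM, dif_pos h]
  exact h.choose_spec

theorem isHerglotz_weylM (hV : IsL2Sparse V) (ha : 0 ≤ a) : IsHerglotz (weylM V a) := by
  obtain ⟨m, hm, hlim⟩ := exists_herglotz_tendsto_weyl hV ha
  refine IsHerglotz.of_tendsto hm (fun z hz => ?_) fun z hz =>
    (isWeylValue_weylM hV ha hz).im_pos hV ha hz
  obtain ⟨w, hw, h⟩ := hlim z hz
  rwa [(isWeylValue_weylM hV ha hz).unique hV ha hz hw]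

end

/-! ### Comparison with the free equation -/

/-- The Weyl function of the free Schrödinger operator, `i √z`. -/
noncomputable def freeWeyl (z : ℂ) : ℂ := Complex.I * z ^ (1 / 2 : ℂ)

theorem cpow_half_sq (z : ℂ) : (z ^ (1 / 2 : ℂ)) ^ 2 = z := by
  simp

theorem freeWeyl_sq (z : ℂ) : freeWeyl z ^ 2 = -z := by
  rw [freeWeyl, mul_pow, cpow_half_sq, Complex.I_sq]; ring

theorem cpow_half_eq {z : ℂ} (hz : z ≠ 0) :
    z ^ (1 / 2 : ℂ) = Real.exp (Real.log ‖z‖ / 2) * (Real.cos (z.arg / 2)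
      + Real.sin (z.arg / 2) * Complex.I) := by
  rw [Complex.cpow_def_of_ne_zero hz, Complex.ofReal_exp, Complex.ofReal_cos, Complex.ofReal_sin,
    ← Complex.exp_mul_I, ← Complex.exp_add, Complex.log]
  push_cast
  ring_nf

/-- Halving an argument in `(0, π)` puts the root into the open first quadrant, and multiplication
by `i` moves it to the second. The negative real part is what makes the exponential in the test
function decay. -/
theorem freeWeyl_re_neg_im_pos {z : ℂ} (hz : 0 < z.im) :
    (freeWeyl z).re < 0 ∧ 0 < (freeWeyl z).im := by
  have hz0 : z ≠ 0 := fun h => by simp [h] at hz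
  have h1 : 0 < z.arg := by
    refine lt_of_le_of_ne (Complex.arg_nonneg_iff.2 hz.le) fun h => ?_
    have := (Complex.arg_eq_zero_iff).1 h.symm
    linarith [this.2]
  have h2 : z.arg < Real.pi := by
    refine lt_of_le_of_ne (Complex.arg_le_pi z) fun h => ?_
    have := (Complex.arg_eq_pi_iff).1 h
    linarith [this.2]
  have hs : 0 < Real.sin (z.arg / 2) := Real.sin_pos_of_pos_of_lt_pi (by linarith) (by linarith)
  have hc : 0 < Real.cos (z.arg / 2) := Real.cos_pos_of_mem_Ioo ⟨by linarith, by linarith⟩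
  rw [freeWeyl, cpow_half_eq hz0]
  have := Real.exp_pos (Real.log ‖z‖ / 2)
  simp only [Complex.mul_re, Complex.mul_im, Complex.I_re, Complex.I_im, Complex.add_re,
    Complex.add_im, Complex.ofReal_re, Complex.ofReal_im]
  constructor
  · nlinarith [mul_pos this hs]
  · nlinarith [mul_pos this hc]

theorem isHerglotz_freeWeyl : IsHerglotz freeWeyl := by
  refine ⟨fun z hz => ?_, fun z hz => (freeWeyl_re_neg_im_pos hz).2⟩
  have hsl : z ∈ Complex.slitPlane := Or.inr (ne_of_gt hz)
  exact (((hasStrictDerivAt_id z).cpow_const hsl).hasDerivAt.differentiableAt.const_mul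
    _).differentiableWithinAt

/-! ### Boundary data tested against a cut-off exponential -/

section estimate

variable {V : ℝ → ℝ} {z κ : ℂ} {a b : ℝ} {f f' : ℝ → ℂ}

/-- The test function is a free solution times a cutoff with a double zero at `s = L`: there are no
boundary terms at the far end, and the defect in the free equation is `O(1/L)`. -/
theorem hasDerivAt_cutoff_exp (κ : ℂ) (L : ℝ) :
    (∀ s : ℝ, HasDerivAt (fun s : ℝ => (1 - (s : ℂ) / L) ^ 2 * Complex.exp (-κ * s))
      ((-2 / L * (1 - (s : ℂ) / L) - κ * (1 - (s : ℂ) / L) ^ 2) * Complex.exp (-κ * s)) s) ∧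
    (∀ s : ℝ, HasDerivAt (fun s : ℝ =>
      (-2 / L * (1 - (s : ℂ) / L) - κ * (1 - (s : ℂ) / L) ^ 2) * Complex.exp (-κ * s))
      ((2 / L ^ 2 + 4 * κ / L * (1 - (s : ℂ) / L) + κ ^ 2 * (1 - (s : ℂ) / L) ^ 2)
        * Complex.exp (-κ * s)) s) := by
  have hs : ∀ s : ℝ, HasDerivAt (fun s : ℝ => (s : ℂ)) 1 s := fun s =>
    Complex.ofRealCLM.hasDerivAt (x := s)
  have h1 : ∀ s : ℝ, HasDerivAt (fun s : ℝ => 1 - (s : ℂ) / L) (-(1 / L)) s := fun s =>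
    ((hs s).div_const (L : ℂ)).const_sub 1
  have h2 : ∀ s : ℝ, HasDerivAt (fun s : ℝ => Complex.exp (-κ * s))
      (Complex.exp (-κ * s) * (-κ)) s := fun s =>
    (((hs s).const_mul (-κ)).cexp).congr_deriv (by ring)
  refine ⟨fun s => (((h1 s).pow 2).mul (h2 s)).congr_deriv ?_, fun s =>
    ((((h1 s).const_mul (-2 / L : ℂ)).sub (((h1 s).pow 2).const_mul κ)).mul
      (h2 s)).congr_deriv ?_⟩
  · simp only [Pi.pow_apply]; push_cast; ring
  · simp only [Pi.pow_apply, Pi.sub_apply]; push_cast; ring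

theorem norm_cutoff_exp_le (hκ : 0 ≤ κ.re) {L s : ℝ} (hL : 0 < L) (hs : s ∈ Icc 0 L) :
    ‖(1 - (s : ℂ) / L) ^ 2 * Complex.exp (-κ * s)‖ ≤ 1 ∧
    ‖-κ ^ 2 * ((1 - (s : ℂ) / L) ^ 2 * Complex.exp (-κ * s)) +
      (2 / L ^ 2 + 4 * κ / L * (1 - (s : ℂ) / L) + κ ^ 2 * (1 - (s : ℂ) / L) ^ 2)
        * Complex.exp (-κ * s)‖ ≤ 2 / L ^ 2 + 4 * ‖κ‖ / L := by
  have he : ‖Complex.exp (-κ * s)‖ ≤ 1 := by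
    rw [Complex.norm_exp, Real.exp_le_one_iff]
    simp only [Complex.mul_re, Complex.neg_re, Complex.ofReal_re, Complex.ofReal_im, mul_zero,
      sub_zero]
    nlinarith [hs.1]
  have h0 : 0 ≤ 1 - s / L := by
    rw [sub_nonneg, div_le_one hL]; exact hs.2
  have h1 : 1 - s / L ≤ 1 := by
    have : 0 ≤ s / L := div_nonneg hs.1 hL.le
    linarith
  have hc : ‖1 - (s : ℂ) / L‖ ≤ 1 := by
    rw [show 1 - (s : ℂ) / L = ((1 - s / L : ℝ) : ℂ) by push_cast; ring, Complex.norm_real,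
      Real.norm_eq_abs, abs_of_nonneg h0]
    exact h1
  constructor
  · rw [norm_mul, norm_pow]
    exact mul_le_one₀ (pow_le_one₀ (norm_nonneg _) hc) (norm_nonneg _) he
  · rw [show -κ ^ 2 * ((1 - (s : ℂ) / L) ^ 2 * Complex.exp (-κ * s)) +
      (2 / L ^ 2 + 4 * κ / L * (1 - (s : ℂ) / L) + κ ^ 2 * (1 - (s : ℂ) / L) ^ 2)
        * Complex.exp (-κ * s)
        = (2 / L ^ 2 + 4 * κ / L * (1 - (s : ℂ) / L)) * Complex.exp (-κ * s) by ring, norm_mul]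
    refine (mul_le_of_le_one_right (norm_nonneg _) he).trans ((norm_add_le _ _).trans ?_)
    refine add_le_add ?_ ?_
    · rw [norm_div, norm_pow, Complex.norm_real, Real.norm_eq_abs, abs_of_pos hL]
      simp
    · rw [norm_mul]
      refine (mul_le_of_le_one_right (norm_nonneg _) hc).trans ?_
      rw [norm_div, norm_mul, Complex.norm_real, Real.norm_eq_abs, abs_of_pos hL]
      simp

/-- At `s = 0` the test function has value `1` and derivative `-κ - 2/L`, which produces the
combination on the left. For the right end it is reflected, `s = b - x`. The hypothesis `0 ≤ κ.re`
keeps its modulus at most `1`. -/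
theorem IsSolutionOn.norm_deriv_add_le (hκ : 0 ≤ κ.re) (hκz : κ ^ 2 = -z) (hab : a < b)
    (hV : IntervalIntegrable (fun t => (V t : ℂ)) volume a b)
    (hV2 : IntegrableOn (fun t => V t ^ 2) (Ioc a b))
    (h : IsSolutionOn (fun t => (V t : ℂ) - z) a b f f') :
    ‖f' a + (κ + 2 / (b - a : ℝ)) * f a‖ ≤ √(∫ t in a..b, ‖f t‖ ^ 2) *
      (√(∫ t in a..b, V t ^ 2) + (2 / (b - a) ^ 2 + 4 * ‖κ‖ / (b - a)) * √(b - a)) ∧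
    ‖f' b - (κ + 2 / (b - a : ℝ)) * f b‖ ≤ √(∫ t in a..b, ‖f t‖ ^ 2) *
      (√(∫ t in a..b, V t ^ 2) + (2 / (b - a) ^ 2 + 4 * ‖κ‖ / (b - a)) * √(b - a)) := by
  set L := b - a with hL
  have hL0 : 0 < L := sub_pos.2 hab
  have hLc : (L : ℂ) ≠ 0 := by exact_mod_cast hL0.ne'
  obtain ⟨d1, d2⟩ := hasDerivAt_cutoff_exp κ L
  have hz : z = -κ ^ 2 := by rw [hκz]; ring
  constructor
  · have := h.norm_green_le hab.le hV hV2 (fun x => (d1 (x - a)).comp_sub_const x a)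
      (fun x => (d2 (x - a)).comp_sub_const x a) (by fun_prop) (C := 1)
      (D := 2 / L ^ 2 + 4 * ‖κ‖ / L)
      (fun x hx => (norm_cutoff_exp_le hκ hL0 (s := x - a)
        ⟨by linarith [hx.1], by linarith [hx.2]⟩).1)
      (fun x hx => by
        rw [hz]
        exact (norm_cutoff_exp_le hκ hL0 (s := x - a)
          ⟨by linarith [hx.1], by linarith [hx.2]⟩).2)
    rw [one_mul] at this
    refine le_trans (le_of_eq ?_) this
    rw [← hL, sub_self, Complex.ofReal_zero, div_self hLc]
    rw [← norm_neg]
    congr 1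
    simp
    ring
  · have := h.norm_green_le hab.le hV hV2 (fun x => (d1 (b - x)).comp_const_sub b x)
      (fun x => ((d2 (b - x)).comp_const_sub b x).neg) (by fun_prop) (C := 1)
      (D := 2 / L ^ 2 + 4 * ‖κ‖ / L)
      (fun x hx => (norm_cutoff_exp_le hκ hL0 (s := b - x)
        ⟨by linarith [hx.2], by linarith [hx.1]⟩).1)
      (fun x hx => by
        rw [hz, neg_neg]
        exact (norm_cutoff_exp_le hκ hL0 (s := b - x)
          ⟨by linarith [hx.2], by linarith [hx.1]⟩).2)
    rw [one_mul] at this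
    refine le_trans (le_of_eq ?_) this
    rw [← hL, sub_self, Complex.ofReal_zero, div_self hLc]
    congr 1
    simp
    ring

end estimate

/-- The unknown `w` occurs on both sides, but only under a square root on the right. Hence `w` stays
bounded, and then the bound itself tends to zero. -/
theorem tendsto_of_norm_add_le {w : ℕ → ℂ} {L η : ℕ → ℝ} {κ : ℂ} {y : ℝ} (hy : 0 < y)
    (hL : Tendsto L atTop atTop) (hη : Tendsto η atTop (𝓝 0))
    (h : ∀ᶠ k in atTop, ‖w k + (κ + 2 / (L k : ℂ))‖ ≤ √((w k).im / y) *
      (√(η k) + (2 / L k ^ 2 + 4 * ‖κ‖ / L k) * √(L k))) :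
    Tendsto w atTop (𝓝 (-κ)) := by
  set ε := fun k => √(η k) + (2 / L k ^ 2 + 4 * ‖κ‖ / L k) * √(L k) with hε
  have hε0 : Tendsto ε atTop (𝓝 0) := by
    have h1 : Tendsto (fun k => √(η k)) atTop (𝓝 0) := by
      simpa using hη.sqrt
    have h2 : Tendsto (fun x : ℝ => (2 / x ^ 2 + 4 * ‖κ‖ / x) * √x) atTop (𝓝 0) := by
      have h3 : Tendsto (fun x : ℝ => (2 / x + 4 * ‖κ‖) * (√x)⁻¹) atTop (𝓝 0) := by
        have h4 : Tendsto (fun x : ℝ => 2 / x + 4 * ‖κ‖) atTop (𝓝 (0 + 4 * ‖κ‖)) :=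
          (tendsto_const_nhds.div_atTop tendsto_id).add_const _
        have h5 : Tendsto (fun x : ℝ => (√x)⁻¹) atTop (𝓝 0) :=
          tendsto_inv_atTop_zero.comp Real.tendsto_sqrt_atTop
        simpa using h4.mul h5
      refine h3.congr' ?_
      filter_upwards [eventually_gt_atTop 0] with x hx
      have hs : √x ≠ 0 := (Real.sqrt_pos.2 hx).ne'
      have hx2 : x = √x ^ 2 := (Real.sq_sqrt hx.le).symm
      field_simp
      rw [← hx2]
    simpa using h1.add (h2.comp hL)
  have hL2 : Tendsto (fun k => 2 / L k) atTop (𝓝 0) := tendsto_const_nhds.div_atTop hL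
  -- Once `2 / L ≤ 1` and `ε ≤ 1`, the inequality `√(‖w‖ / y) ≤ ‖w‖ / 2 + 1 / (2 y)` lets half of
  -- `‖w‖` be absorbed, leaving `‖w‖ ≤ M`.
  set M := 2 * (‖κ‖ + 1) + 1 / y with hM
  have hM0 : 0 < M := by positivity
  have hbound : ∀ᶠ k in atTop, ‖w k + κ‖ ≤ 2 / L k + √(M / y) * ε k := by
    filter_upwards [h, hε0.eventually (gt_mem_nhds one_pos), hL.eventually_ge_atTop 2]
      with k hk hε1 hLk
    have hL0 : 0 < L k := by linarith
    have hεk : 0 ≤ ε k := by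
      simp only [hε]; positivity
    have hn : ‖(2 / (L k : ℂ))‖ = 2 / L k := by
      rw [norm_div, Complex.norm_real, Real.norm_eq_abs, abs_of_pos hL0]; simp
    have hLk1 : 2 / L k ≤ 1 := by rw [div_le_one hL0]; exact hLk
    have him : (w k).im ≤ ‖w k‖ := (le_abs_self _).trans (Complex.abs_im_le_norm _)
    have hs : √((w k).im / y) ≤ √(‖w k‖ / y) := Real.sqrt_le_sqrt (by gcongr)
    have hsq : √(‖w k‖ / y) ^ 2 = ‖w k‖ / y := Real.sq_sqrt (by positivity)
    have hk' : ‖w k + (κ + 2 / (L k : ℂ))‖ ≤ √(‖w k‖ / y) * ε k := hk.trans (by gcongr)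
    have h1 : ‖w k‖ ≤ ‖κ‖ + 2 / L k + √(‖w k‖ / y) * ε k := by
      calc ‖w k‖ = ‖(w k + (κ + 2 / (L k : ℂ))) - (κ + 2 / (L k : ℂ))‖ := by congr 1; ring
        _ ≤ ‖w k + (κ + 2 / (L k : ℂ))‖ + (‖κ‖ + ‖(2 / (L k : ℂ))‖) :=
          (norm_sub_le _ _).trans (by gcongr; exact norm_add_le _ _)
        _ ≤ _ := by rw [hn]; linarith
    have h2 : √(‖w k‖ / y) * ε k ≤ ‖w k‖ / 2 + 1 / (2 * y) := by
      set r := √(‖w k‖ / y)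
      have h3 : ‖w k‖ = r ^ 2 * y := by rw [hsq]; field_simp
      have h4 : r * ε k ≤ r := mul_le_of_le_one_right (Real.sqrt_nonneg _) hε1.le
      refine h4.trans ?_
      rw [h3]
      have h5 : r ^ 2 * y / 2 + 1 / (2 * y) - r = (r * y - 1) ^ 2 / (2 * y) := by
        field_simp; ring
      have h6 : 0 ≤ (r * y - 1) ^ 2 / (2 * y) := by positivity
      linarith
    have h7 : ‖w k‖ ≤ M := by
      have : 1 / (2 * y) = 1 / y / 2 := by field_simp
      rw [hM]; linarith
    calc ‖w k + κ‖ = ‖(w k + (κ + 2 / (L k : ℂ))) - 2 / (L k : ℂ)‖ := by congr 1; ring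
      _ ≤ ‖w k + (κ + 2 / (L k : ℂ))‖ + ‖(2 / (L k : ℂ))‖ := norm_sub_le _ _
      _ ≤ √(‖w k‖ / y) * ε k + 2 / L k := by rw [hn]; linarith
      _ ≤ √(M / y) * ε k + 2 / L k := by gcongr
      _ = _ := by ring
  rw [tendsto_iff_norm_sub_tendsto_zero]
  simp only [sub_neg_eq_add]
  refine squeeze_zero' (Eventually.of_forall fun _ => norm_nonneg _) hbound ?_
  simpa using hL2.add (hε0.const_mul √(M / y))

/-! ### Convergence of the two `m`-functions in the upper half-plane -/

section convergence

variable {V : ℝ → ℝ} {z : ℂ} {a b : ℕ → ℝ}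

/-- For finitely many `k` the integral of `V²` may be infinite, so integrability is only claimed
eventually. -/
theorem tendsto_integral_sq (hV : IsL2Sparse V) (ha : ∀ k, 0 ≤ a k) (hab : ∀ k, a k < b k)
    (hint : Tendsto (fun k => ∫⁻ x in Ioo (a k) (b k), ENNReal.ofReal (V x ^ 2)) atTop (𝓝 0)) :
    (∀ᶠ k in atTop, IntegrableOn (fun t => V t ^ 2) (Ioc (a k) (b k))) ∧
      Tendsto (fun k => ∫ t in (a k)..(b k), V t ^ 2) atTop (𝓝 0) := by
  have h1 : ∀ᶠ k in atTop, ∫⁻ x in Ioo (a k) (b k), ENNReal.ofReal (V x ^ 2) < ⊤ :=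
    hint.eventually (gt_mem_nhds ENNReal.zero_lt_top)
  refine ⟨?_, ?_⟩
  · filter_upwards [h1] with k hk
    exact (integrableOn_sq_of_lintegral_lt_top hV.locallyIntegrable (ha k) (hab k).le hk).1
  · have h2 := (ENNReal.tendsto_toReal ENNReal.zero_ne_top).comp hint
    rw [ENNReal.toReal_zero] at h2
    refine h2.congr' ?_
    filter_upwards [h1] with k hk
    exact (integrableOn_sq_of_lintegral_lt_top hV.locallyIntegrable (ha k) (hab k).le hk).2.symm

/-- The `L²` norm over `(a k, b k)` is at most that over `(a k, ∞)`, whose square is `Im m / Im z`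
for the Weyl solution; this is the form that the convergence criterion requires. -/
theorem tendsto_weylM_freeWeyl (hV : IsL2Sparse V) (ha : ∀ k, 0 ≤ a k) (hab : ∀ k, a k < b k)
    (hlen : Tendsto (fun k => b k - a k) atTop atTop)
    (hint : Tendsto (fun k => ∫⁻ x in Ioo (a k) (b k), ENNReal.ofReal (V x ^ 2)) atTop (𝓝 0))
    (hz : 0 < z.im) : Tendsto (fun k => weylM V (a k) z) atTop (𝓝 (freeWeyl z)) := by
  obtain ⟨hi, ht⟩ := tendsto_integral_sq hV ha hab hint
  obtain ⟨hre, -⟩ := freeWeyl_re_neg_im_pos hz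
  rw [← neg_neg (freeWeyl z)]
  refine tendsto_of_norm_add_le hz hlen ht ?_
  filter_upwards [hi] with k hk
  obtain ⟨f, f', hf, hfa, hfa', hL⟩ := isWeylValue_weylM hV (ha k) hz
  have him := IsWeylValue.im_eq hV (ha k) hf hfa hL
  have key := ((hf.isSolutionOn hV.locallyIntegrable (ha k) (hab k).le).norm_deriv_add_le
    (κ := -freeWeyl z) (by simp only [Complex.neg_re]; linarith)
    (by rw [neg_sq, freeWeyl_sq]) (hab k)
    (intervalIntegrable_of_locallyIntegrableOn_Ici hV.locallyIntegrable (ha k)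
      ((ha k).trans (hab k).le)) hk).1
  rw [hfa, hfa', mul_one] at key
  refine key.trans (mul_le_mul_of_nonneg_right (Real.sqrt_le_sqrt ?_) ?_)
  · rw [hfa'] at him
    rw [him, mul_div_cancel_left₀ _ hz.ne', intervalIntegral.integral_of_le (hab k).le]
    exact setIntegral_mono_set ((memLp_two_iff_integrable_sq_norm hL.aestronglyMeasurable).1 hL)
      (ae_of_all _ fun t => by simp only [Pi.zero_apply]; positivity)
      (LE.le.eventuallyLE fun t ht => ht.1)
  · have := sub_pos.2 (hab k)
    positivity

/-- The Dirichlet condition removes the boundary term at `0`, so `-v'/v` at `b` acts as an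
`m`-function that looks to the left. In particular `v b = 0` would force the `L²` norm to vanish. -/
theorem lagrange_dirichlet {b : ℝ} (hV : LocallyIntegrableOn V (Ici 0) volume) (hb : 0 < b)
    {v v' : ℝ → ℂ} (hv : IsSchrodingerSolution V z 0 v v') (h0 : v 0 = 0) (h0' : v' 0 = 1)
    (hz : 0 < z.im) : v b ≠ 0 ∧ 0 < ∫ t in (0 : ℝ)..b, ‖v t‖ ^ 2 ∧
      (-v' b / v b).im * ‖v b‖ ^ 2 = z.im * ∫ t in (0 : ℝ)..b, ‖v t‖ ^ 2 := by
  have h1 := (hv.isSolutionOn hV le_rfl hb.le).lagrange_identity hb.le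
      (intervalIntegrable_of_locallyIntegrableOn_Ici hV le_rfl hb.le)
  have h2 := hv.integral_norm_sq_pos hb (Or.inr (by rw [h0']; simp))
  rw [h0, map_zero, zero_mul, Complex.zero_im, zero_sub] at h1
  have hne : v b ≠ 0 := fun h => by
    rw [h, map_zero, zero_mul, Complex.zero_im, neg_zero] at h1
    have := mul_pos hz h2
    linarith
  refine ⟨hne, h2, ?_⟩
  have h3 : -v' b / v b * ((‖v b‖ ^ 2 : ℝ) : ℂ) = -((starRingEnd ℂ) (v b) * v' b) := by
    rw [← Complex.normSq_eq_norm_sq, Complex.normSq_eq_conj_mul_self]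
    field_simp
  rw [← h1, ← Complex.im_mul_ofReal, h3, Complex.neg_im]

/-- The estimate at the right end, divided by `‖v (b k)‖`; the norm over `(a k, b k)` is bounded by
that over `(0, b k)`, which Lagrange's identity evaluates. -/
theorem tendsto_dirichlet_freeWeyl (hV : IsL2Sparse V) (ha : ∀ k, 0 ≤ a k) (hab : ∀ k, a k < b k)
    (hlen : Tendsto (fun k => b k - a k) atTop atTop)
    (hint : Tendsto (fun k => ∫⁻ x in Ioo (a k) (b k), ENNReal.ofReal (V x ^ 2)) atTop (𝓝 0))
    (hz : 0 < z.im) {v v' : ℝ → ℂ} (hv : IsSchrodingerSolution V z 0 v v') (h0 : v 0 = 0)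
    (h0' : v' 0 = 1) : Tendsto (fun k => -v' (b k) / v (b k)) atTop (𝓝 (freeWeyl z)) := by
  obtain ⟨hi, ht⟩ := tendsto_integral_sq hV ha hab hint
  obtain ⟨hre, -⟩ := freeWeyl_re_neg_im_pos hz
  rw [← neg_neg (freeWeyl z)]
  refine tendsto_of_norm_add_le hz hlen ht ?_
  filter_upwards [hi] with k hk
  have hb0 : 0 < b k := (ha k).trans_lt (hab k)
  have hVi : ∀ {s t : ℝ}, 0 ≤ s → 0 ≤ t → IntervalIntegrable (fun t => (V t : ℂ)) volume s t :=
    fun hs ht => intervalIntegrable_of_locallyIntegrableOn_Ici hV.locallyIntegrable hs ht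
  obtain ⟨hne, -, him⟩ := lagrange_dirichlet hV.locallyIntegrable hb0 hv h0 h0' hz
  have hs := hv.isSolutionOn hV.locallyIntegrable le_rfl hb0.le
  have hs' : IsSolutionOn (fun t => (V t : ℂ) - z) (a k) (b k) v v' :=
    hs.restrict_left (ha k) (hab k).le (hVi le_rfl hb0.le |>.sub intervalIntegrable_const)
  have key := (hs'.norm_deriv_add_le (κ := -freeWeyl z) (by simp only [Complex.neg_re]; linarith)
    (by rw [neg_sq, freeWeyl_sq]) (hab k) (hVi (ha k) hb0.le) hk).2
  set ε := √(∫ t in (a k)..(b k), V t ^ 2) +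
    (2 / (b k - a k) ^ 2 + 4 * ‖-freeWeyl z‖ / (b k - a k)) * √(b k - a k) with hε
  have hε0 : 0 ≤ ε := by
    have := sub_pos.2 (hab k)
    positivity
  have hpos : 0 < ‖v (b k)‖ := norm_pos_iff.2 hne
  have hcv : ContinuousOn (fun t => ‖v t‖ ^ 2) (Icc 0 (b k)) := hs.cont.norm.pow 2
  have hmono : ∫ t in (a k)..(b k), ‖v t‖ ^ 2 ≤ ∫ t in (0 : ℝ)..(b k), ‖v t‖ ^ 2 :=
    intervalIntegral.integral_mono_interval (ha k) (hab k).le le_rfl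
      (ae_of_all _ fun t => by simp only [Pi.zero_apply]; positivity)
      (ContinuousOn.intervalIntegrable (by rwa [uIcc_of_le hb0.le]))
  have e1 : ‖-v' (b k) / v (b k) + (-freeWeyl z + 2 / ((b k - a k : ℝ) : ℂ))‖ * ‖v (b k)‖
      = ‖v' (b k) - (-freeWeyl z + 2 / ((b k - a k : ℝ) : ℂ)) * v (b k)‖ := by
    rw [← norm_mul, ← norm_neg]
    congr 1
    field_simp
    ring
  have e2 : √(∫ t in (0 : ℝ)..(b k), ‖v t‖ ^ 2)
      = √((-v' (b k) / v (b k)).im / z.im) * ‖v (b k)‖ := by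
    rw [← mul_div_cancel_left₀ (∫ t in (0 : ℝ)..(b k), ‖v t‖ ^ 2) hz.ne', ← him,
      mul_div_right_comm, Real.sqrt_mul' _ (by positivity), Real.sqrt_sq hpos.le]
  refine le_of_mul_le_mul_right ?_ hpos
  rw [e1]
  refine key.trans ?_
  calc √(∫ t in (a k)..(b k), ‖v t‖ ^ 2) * ε ≤ √(∫ t in (0 : ℝ)..(b k), ‖v t‖ ^ 2) * ε := by gcongr
    _ = _ := by rw [e2]; ring

end convergence

/-! ### Harmonic measure of the upper half-plane -/

open ProbabilityTheory in
/-- The harmonic measure of the upper half-plane at `w` (a point mass if `w` is real). -/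
noncomputable def harmonicMeasure (w : ℂ) : Measure ℝ := cauchyMeasure w.re ‖w.im‖₊

instance (w : ℂ) : IsProbabilityMeasure (harmonicMeasure w) := by
  unfold harmonicMeasure; infer_instance

theorem harmonicMeasure_of_im_eq_zero {w : ℂ} (hw : w.im = 0) :
    harmonicMeasure w = Measure.dirac w.re := by
  simp [harmonicMeasure, hw]

/-- The Poisson kernel of the upper half-plane, normalized to integral one. -/
noncomputable def halfPlanePoisson (z : ℂ) (t : ℝ) : ℝ :=
  Real.pi⁻¹ * z.im * ((t - z.re) ^ 2 + z.im ^ 2)⁻¹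

theorem cauchyPDFReal_eq_halfPlanePoisson {z : ℂ} (hz : 0 < z.im) :
    ProbabilityTheory.cauchyPDFReal z.re ‖z.im‖₊ = halfPlanePoisson z := by
  funext t
  simp [ProbabilityTheory.cauchyPDFReal_def, halfPlanePoisson, abs_of_pos hz]

theorem halfPlanePoisson_pos {z : ℂ} (hz : 0 < z.im) (t : ℝ) : 0 < halfPlanePoisson z t := by
  unfold halfPlanePoisson
  have := Real.pi_pos
  positivity

theorem continuous_halfPlanePoisson {z : ℂ} (hz : 0 < z.im) : Continuous (halfPlanePoisson z) := by
  unfold halfPlanePoisson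
  exact continuous_const.mul (Continuous.inv₀ (by fun_prop) fun t => by positivity)

theorem integrable_halfPlanePoisson {z : ℂ} (hz : 0 < z.im) : Integrable (halfPlanePoisson z) := by
  rw [← cauchyPDFReal_eq_halfPlanePoisson hz]
  exact ProbabilityTheory.integrable_cauchyPDFReal _

theorem integral_halfPlanePoisson {z : ℂ} (hz : 0 < z.im) : ∫ t, halfPlanePoisson z t = 1 := by
  rw [← cauchyPDFReal_eq_halfPlanePoisson hz]
  exact ProbabilityTheory.integral_cauchyPDFReal_eq_one _ (by simpa using hz.ne')

theorem harmonicMeasure_eq_withDensity {z : ℂ} (hz : 0 < z.im) :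
    harmonicMeasure z = volume.withDensity fun t => ENNReal.ofReal (halfPlanePoisson z t) := by
  rw [harmonicMeasure, ProbabilityTheory.cauchyMeasure_of_scale_ne_zero _ (by simpa using hz.ne')]
  congr 1
  funext t
  rw [ProbabilityTheory.cauchyPDF, cauchyPDFReal_eq_halfPlanePoisson hz]

theorem integral_harmonicMeasure {z : ℂ} (hz : 0 < z.im) (g : ℝ → ℝ) :
    ∫ t, g t ∂harmonicMeasure z = ∫ t, halfPlanePoisson z t * g t := by
  rw [harmonicMeasure_eq_withDensity hz, integral_withDensity_eq_integral_toReal_smul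
    (continuous_halfPlanePoisson hz).measurable.ennreal_ofReal (ae_of_all _ fun _ => by simp)]
  refine integral_congr_ae (ae_of_all _ fun t => ?_)
  simp only [smul_eq_mul, ENNReal.toReal_ofReal (halfPlanePoisson_pos hz t).le]

theorem harmonicMeasure_absolutelyContinuous {z : ℂ} (hz : 0 < z.im) :
    harmonicMeasure z ≪ volume := by
  rw [harmonicMeasure_eq_withDensity hz]
  exact withDensity_absolutelyContinuous _ _

theorem absolutelyContinuous_harmonicMeasure {z : ℂ} (hz : 0 < z.im) :
    volume ≪ harmonicMeasure z := by
  rw [harmonicMeasure_eq_withDensity hz]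
  exact withDensity_absolutelyContinuous'
    (continuous_halfPlanePoisson hz).measurable.ennreal_ofReal.aemeasurable
    (ae_of_all _ fun t => by simpa using halfPlanePoisson_pos hz t)

/-- The convention for real points matches the point mass, so one measure covers both cases of the
definition of the angle. -/
theorem angleSubtended_eq {w : ℂ} {S : Set ℝ} (hS : MeasurableSet S) :
    angleSubtended w S = Real.pi * (harmonicMeasure w).real S := by
  unfold angleSubtended
  split_ifs with h1 h2
  · rw [harmonicMeasure_of_im_eq_zero h1, measureReal_def, Measure.dirac_apply' _ hS]
    simp [h2]
  · rw [harmonicMeasure_of_im_eq_zero h1, measureReal_def, Measure.dirac_apply' _ hS]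
    simp [h2]
  · rw [measureReal_def, harmonicMeasure, ProbabilityTheory.cauchyMeasure_of_scale_ne_zero _
      (by simpa using h1), withDensity_apply _ hS]
    simp only [ProbabilityTheory.cauchyPDF]
    have hnn : ∀ t, 0 ≤ ProbabilityTheory.cauchyPDFReal w.re ‖w.im‖₊ t := fun t =>
      (ProbabilityTheory.cauchyPDF_pos _ (by simpa using h1) t).le
    rw [← integral_eq_lintegral_of_nonneg_ae (ae_of_all _ hnn)
      (ProbabilityTheory.measurable_cauchyPDFReal _ _).aestronglyMeasurable, ← integral_const_mul]
    refine integral_congr_ae (ae_of_all _ fun t => ?_)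
    have := Real.pi_pos.ne'
    simp only [ProbabilityTheory.cauchyPDFReal_def, coe_nnnorm, Real.norm_eq_abs, sq_abs]
    field_simp

/-! ### Poisson's formula -/

/-- The conformal map of the unit disc onto the upper half-plane with `0 ↦ z`. -/
noncomputable def discToHalfPlane (z ζ : ℂ) : ℂ := z.re + z.im * (Complex.I * ((1 + ζ) / (1 - ζ)))

theorem discToHalfPlane_zero (z : ℂ) : discToHalfPlane z 0 = z := by
  simp [discToHalfPlane, Complex.re_add_im]

theorem one_sub_ne_zero_of_norm_lt {ζ : ℂ} (hζ : ‖ζ‖ < 1) : 1 - ζ ≠ 0 := fun h => by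
  rw [← sub_eq_zero.1 h] at hζ
  simp at hζ

theorem discToHalfPlane_im_pos {z ζ : ℂ} (hz : 0 < z.im) (hζ : ‖ζ‖ < 1) :
    0 < (discToHalfPlane z ζ).im := by
  have h1 : 0 < Complex.normSq (1 - ζ) := Complex.normSq_pos.2 (one_sub_ne_zero_of_norm_lt hζ)
  have h2 : ζ.re ^ 2 + ζ.im ^ 2 < 1 := by
    have h3 : ‖ζ‖ ^ 2 < 1 := by nlinarith [norm_nonneg ζ]
    rw [← Complex.normSq_eq_norm_sq, Complex.normSq_apply] at h3
    nlinarith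
  have h4 : ((1 + ζ) / (1 - ζ)).re = (1 - (ζ.re ^ 2 + ζ.im ^ 2)) / Complex.normSq (1 - ζ) := by
    rw [Complex.div_re]
    simp only [Complex.add_re, Complex.one_re, Complex.sub_re, Complex.add_im, Complex.one_im,
      Complex.sub_im]
    ring
  have h5 : (discToHalfPlane z ζ).im = z.im * ((1 + ζ) / (1 - ζ)).re := by
    simp [discToHalfPlane]
  rw [h5, h4]
  exact mul_pos hz (div_pos (by linarith) h1)

theorem differentiableAt_discToHalfPlane (z : ℂ) {ζ : ℂ} (hζ : 1 - ζ ≠ 0) :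
    DifferentiableAt ℂ (discToHalfPlane z) ζ := by
  unfold discToHalfPlane
  fun_prop (disch := assumption)

/-- With `s = (t - Re z) / Im z` and `θ = π + 2 arctan s` one has `e^{iθ} = -(1 + i s) / (1 - i s)`,
which the Cayley map sends to `t`. The line covers the circle except for the point `1`, which
corresponds to infinity. -/
theorem discToHalfPlane_circleMap {z : ℂ} (hz : 0 < z.im) (t : ℝ) :
    1 - circleMap 0 1 (Real.pi + 2 * Real.arctan ((t - z.re) / z.im)) ≠ 0 ∧
    discToHalfPlane z (circleMap 0 1 (Real.pi + 2 * Real.arctan ((t - z.re) / z.im))) = t := by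
  set s := (t - z.re) / z.im with hs
  have hcs : (Real.cos (Real.arctan s)) ^ 2 * (1 + s ^ 2) = 1 := by
    rw [Real.cos_sq_arctan]
    have : 1 + s ^ 2 ≠ 0 := by positivity
    field_simp
  have hsin : Real.sin (Real.arctan s) = s * Real.cos (Real.arctan s) := by
    rw [Real.sin_arctan, Real.cos_arctan]; ring
  have h1 : (1 : ℂ) - Complex.I * s ≠ 0 := fun h => by
    have := congrArg Complex.re h
    simp at this
  have hE : circleMap 0 1 (Real.pi + 2 * Real.arctan s)
      = -((1 + Complex.I * s) / (1 - Complex.I * s)) := by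
    have e1 : Complex.exp (Real.arctan s * Complex.I)
        = Real.cos (Real.arctan s) * (1 + Complex.I * s) := by
      rw [Complex.exp_mul_I, ← Complex.ofReal_cos, ← Complex.ofReal_sin, hsin]
      push_cast; ring
    have e2 : circleMap 0 1 (Real.pi + 2 * Real.arctan s)
        = -(Complex.exp (Real.arctan s * Complex.I)) ^ 2 := by
      rw [circleMap, ← Complex.exp_nat_mul]
      push_cast
      rw [show ((Real.pi : ℂ) + 2 * Complex.arctan s) * Complex.I
        = Real.pi * Complex.I + 2 * (Complex.arctan s * Complex.I) by ring, Complex.exp_add,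
        Complex.exp_pi_mul_I]
      ring
    have hcs' : (Real.cos (Real.arctan s) : ℂ) ^ 2 * (1 + (s : ℂ) ^ 2) = 1 := by exact_mod_cast hcs
    rw [e2, e1, neg_inj, eq_div_iff h1]
    linear_combination (1 + Complex.I * s) * hcs' -
      (Real.cos (Real.arctan s) : ℂ) ^ 2 * (s : ℂ) ^ 2 * (1 + Complex.I * s) * Complex.I_sq
  have h2 : 1 - circleMap 0 1 (Real.pi + 2 * Real.arctan s) = 2 / (1 - Complex.I * s) := by
    rw [hE]; field_simp; ring
  have h3 : 1 + circleMap 0 1 (Real.pi + 2 * Real.arctan s)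
      = (-2 * Complex.I * s) / (1 - Complex.I * s) := by
    rw [hE]; field_simp; ring
  refine ⟨by rw [h2]; exact div_ne_zero two_ne_zero h1, ?_⟩
  have hzc : (z.im : ℂ) ≠ 0 := by exact_mod_cast hz.ne'
  rw [discToHalfPlane, h2, h3]
  have h5 : (t : ℂ) = z.re + z.im * s := by
    rw [hs]; push_cast; field_simp; ring
  rw [h5]
  field_simp
  linear_combination -(z.im : ℂ) * (s : ℂ) * Complex.I_sq

/-- Up to the factor `2π`, the Poisson kernel is the Jacobian of the parametrization of the circle
by the line. This turns circle averages into Poisson integrals. -/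
theorem integral_comp_arctan {z : ℂ} (hz : 0 < z.im) (g : ℝ → ℝ) :
    ∫ θ in (0 : ℝ)..(2 * Real.pi), g θ
      = (2 * Real.pi) * ∫ t, halfPlanePoisson z t *
          g (Real.pi + 2 * Real.arctan ((t - z.re) / z.im)) := by
  have hpi := Real.pi_pos
  set f : ℝ → ℝ := fun t => Real.pi + 2 * Real.arctan ((t - z.re) / z.im) with hf
  have hd : ∀ t, HasDerivAt f (2 * Real.pi * halfPlanePoisson z t) t := by
    intro t
    have h1 : HasDerivAt (fun t : ℝ => (t - z.re) / z.im) (1 / z.im) t :=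
      ((hasDerivAt_id t).sub_const _).div_const _
    refine ((h1.arctan.const_mul 2).const_add Real.pi).congr_deriv ?_
    unfold halfPlanePoisson
    have : (t - z.re) ^ 2 + z.im ^ 2 ≠ 0 := by positivity
    have : 1 + ((t - z.re) / z.im) ^ 2 ≠ 0 := by positivity
    field_simp
    ring
  have hinj : InjOn f univ := by
    intro t _ t' _ h
    have h1 : Real.arctan ((t - z.re) / z.im) = Real.arctan ((t' - z.re) / z.im) := by
      simp only [hf] at h; linarith
    have h2 := Real.arctan_injective h1
    have h3 : t - z.re = t' - z.re := by
      field_simp at h2; exact h2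
    linarith
  have himg : f '' univ = Ioo 0 (2 * Real.pi) := by
    ext θ
    simp only [image_univ, mem_range, mem_Ioo, hf]
    constructor
    · rintro ⟨t, rfl⟩
      have h1 := Real.neg_pi_div_two_lt_arctan ((t - z.re) / z.im)
      have h2 := Real.arctan_lt_pi_div_two ((t - z.re) / z.im)
      constructor <;> linarith
    · rintro ⟨h1, h2⟩
      refine ⟨z.re + z.im * Real.tan ((θ - Real.pi) / 2), ?_⟩
      rw [add_sub_cancel_left, mul_div_cancel_left₀ _ hz.ne', Real.arctan_tan (by linarith)
        (by linarith)]
      ring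
  have key := integral_image_eq_integral_abs_deriv_smul MeasurableSet.univ
    (fun t _ => (hd t).hasDerivWithinAt) hinj g
  rw [himg, setIntegral_univ] at key
  rw [intervalIntegral.integral_of_le (by linarith), integral_Ioc_eq_integral_Ioo, key,
    ← integral_const_mul]
  refine integral_congr_ae (ae_of_all _ fun t => ?_)
  have := halfPlanePoisson_pos hz t
  simp only [smul_eq_mul]
  rw [abs_of_pos (by positivity)]
  ring

/-- Poisson's formula for the imaginary part of a function that is holomorphic across the real
axis. -/
theorem im_eq_integral_harmonicMeasure {H : ℂ → ℂ} {ε M : ℝ} (hε : 0 < ε)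
    (hd : DifferentiableOn ℂ H {z | -ε < z.im}) (hb : ∀ z : ℂ, -ε < z.im → |(H z).im| ≤ M)
    {z : ℂ} (hz : 0 < z.im) : (H z).im = ∫ t : ℝ, (H t).im ∂harmonicMeasure z := by
  have hopen : IsOpen {z : ℂ | -ε < z.im} := isOpen_lt continuous_const Complex.continuous_im
  have hda : ∀ ζ : ℂ, ‖ζ‖ < 1 → DifferentiableAt ℂ (fun ζ => H (discToHalfPlane z ζ)) ζ := by
    intro ζ hζ
    have h1 : -ε < (discToHalfPlane z ζ).im := by linarith [discToHalfPlane_im_pos hz hζ]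
    exact (hd.differentiableAt (hopen.mem_nhds h1)).comp ζ
      (differentiableAt_discToHalfPlane z (one_sub_ne_zero_of_norm_lt hζ))
  set r : ℕ → ℝ := fun n => 1 - 1 / ((n : ℝ) + 1) with hr
  have hr0 : ∀ n, 0 ≤ r n := fun n => by
    simp only [hr, sub_nonneg]
    rw [div_le_one (by positivity)]
    linarith [n.cast_nonneg (α := ℝ)]
  have hr1 : ∀ n, r n < 1 := fun n => by
    have : 0 < 1 / ((n : ℝ) + 1) := by positivity
    simp only [hr]; linarith
  have hrlim : Tendsto r atTop (𝓝 1) := by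
    have h := (tendsto_one_div_add_atTop_nhds_zero_nat (𝕜 := ℝ)).const_sub 1
    rwa [sub_zero] at h
  have hnorm : ∀ n θ, ‖circleMap 0 (r n) θ‖ < 1 := fun n θ => by
    rw [norm_circleMap_zero, abs_of_nonneg (hr0 n)]; exact hr1 n
  have hcont : ∀ n, Continuous fun θ => H (discToHalfPlane z (circleMap 0 (r n) θ)) := fun n =>
    continuous_iff_continuousAt.2 fun θ =>
      (hda _ (hnorm n θ)).continuousAt.comp (continuous_circleMap 0 (r n)).continuousAt
  -- The mean value property on circles of radius `r n < 1`, where the composition is holomorphic;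
  -- afterwards `r n → 1`.
  have havg : ∀ n, ∫ θ in (0 : ℝ)..(2 * Real.pi),
      (H (discToHalfPlane z (circleMap 0 (r n) θ))).im = 2 * Real.pi * (H z).im := by
    intro n
    have h1 : DiffContOnCl ℂ (fun ζ => H (discToHalfPlane z ζ)) (Metric.ball 0 |r n|) := by
      refine DifferentiableOn.diffContOnCl fun ζ hζ => (hda ζ ?_).differentiableWithinAt
      have h2 := Metric.closure_ball_subset_closedBall hζ
      rw [mem_closedBall_zero_iff, abs_of_nonneg (hr0 n)] at h2
      exact h2.trans_lt (hr1 n)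
    have h2 := h1.circleAverage
    rw [Real.circleAverage_def, discToHalfPlane_zero] at h2
    have h3 := Complex.imCLM.intervalIntegral_comp_comm ((hcont n).intervalIntegrable (μ := volume) 0
      (2 * Real.pi))
    simp only [Complex.imCLM_apply] at h3
    rw [h3, ← h2, Complex.smul_im, smul_eq_mul]
    have := Real.pi_pos.ne'
    field_simp
  have hlim : Tendsto (fun n => ∫ θ in (0 : ℝ)..(2 * Real.pi),
      (H (discToHalfPlane z (circleMap 0 (r n) θ))).im) atTop
      (𝓝 (∫ θ in (0 : ℝ)..(2 * Real.pi), (H (discToHalfPlane z (circleMap 0 1 θ))).im)) := by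
    refine intervalIntegral.tendsto_integral_filter_of_dominated_convergence (fun _ => M) ?_ ?_ ?_ ?_
    · exact Eventually.of_forall fun n =>
        (Complex.continuous_im.comp (hcont n)).aestronglyMeasurable
    · refine Eventually.of_forall fun n => ae_of_all _ fun θ _ => ?_
      exact hb _ (by linarith [discToHalfPlane_im_pos hz (hnorm n θ)])
    · exact intervalIntegrable_const
    -- The angle `2π` corresponds to the point at infinity, where `H` need not be continuous.
    · have hne : ∀ᵐ θ : ℝ, θ ≠ 2 * Real.pi := by
        simp [ae_iff]
      filter_upwards [hne] with θ hθ hmem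
      rw [uIoc_of_le (by positivity)] at hmem
      have hθ0 : 0 < θ := hmem.1
      have hθ1 : θ < 2 * Real.pi := lt_of_le_of_ne hmem.2 hθ
      set t := z.re + z.im * Real.tan ((θ - Real.pi) / 2) with ht
      have hθt : θ = Real.pi + 2 * Real.arctan ((t - z.re) / z.im) := by
        rw [ht, add_sub_cancel_left, mul_div_cancel_left₀ _ hz.ne', Real.arctan_tan (by linarith)
          (by linarith)]
        ring
      obtain ⟨e1, e2⟩ := discToHalfPlane_circleMap hz t
      rw [← hθt] at e1 e2
      have c1 : ContinuousAt H (discToHalfPlane z (circleMap 0 1 θ)) := by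
        rw [e2]
        exact (hd.differentiableAt (hopen.mem_nhds (by simpa using hε))).continuousAt
      have c2 : ContinuousAt (discToHalfPlane z) (circleMap 0 1 θ) :=
        (differentiableAt_discToHalfPlane z e1).continuousAt
      have c3 : Tendsto (fun n => circleMap 0 (r n) θ) atTop (𝓝 (circleMap 0 1 θ)) := by
        simp only [circleMap]
        exact ((Complex.continuous_ofReal.tendsto _).comp hrlim |>.mul_const _).const_add _
      exact (Complex.continuous_im.tendsto _).comp (c1.tendsto.comp (c2.tendsto.comp c3))
  simp only [havg] at hlim
  have heq := tendsto_nhds_unique tendsto_const_nhds hlim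
  rw [integral_comp_arctan hz] at heq
  rw [integral_harmonicMeasure hz]
  have h2pi : (2 * Real.pi) ≠ 0 := by positivity
  rw [mul_left_cancel₀ h2pi heq]
  refine integral_congr_ae (ae_of_all _ fun t => ?_)
  simp only [(discToHalfPlane_circleMap hz t).2]

/-! ### Boundary functions of bounded harmonic functions -/

theorem integrable_of_abs_le {μ : Measure ℝ} [IsFiniteMeasure μ] {g : ℝ → ℝ} {M : ℝ}
    (hg : AEStronglyMeasurable g μ) (hM : ∀ t, |g t| ≤ M) : Integrable g μ :=
  Integrable.of_bound hg M (ae_of_all _ hM)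

/-- Evaluation at any `z` thereby becomes an inner product in the single Hilbert space `L²(ω_i)`.
The constant comes from `t² + 1 ≤ 2 (t - Re z)² + 2 (Re z)² + 1`. -/
theorem exists_bound_halfPlanePoisson_div {z : ℂ} (hz : 0 < z.im) :
    ∃ C, ∀ t, |halfPlanePoisson z t / halfPlanePoisson Complex.I t| ≤ C := by
  refine ⟨z.im * (2 + (2 * z.re ^ 2 + 1) / z.im ^ 2), fun t => ?_⟩
  have hI : 0 < Complex.I.im := by simp
  rw [abs_of_pos (div_pos (halfPlanePoisson_pos hz t) (halfPlanePoisson_pos hI t))]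
  rw [div_le_iff₀ (halfPlanePoisson_pos hI t)]
  unfold halfPlanePoisson
  simp only [Complex.I_re, Complex.I_im, sub_zero, one_pow, mul_one]
  have hpi := Real.pi_pos
  have h1 : 0 < (t - z.re) ^ 2 + z.im ^ 2 := by positivity
  have h2 : 0 < t ^ 2 + 1 := by positivity
  have h3 : t ^ 2 + 1 ≤ (2 + (2 * z.re ^ 2 + 1) / z.im ^ 2) * ((t - z.re) ^ 2 + z.im ^ 2) := by
    have h4 : (2 + (2 * z.re ^ 2 + 1) / z.im ^ 2) * ((t - z.re) ^ 2 + z.im ^ 2)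
        = 2 * (t - z.re) ^ 2 + 2 * z.im ^ 2 + (2 * z.re ^ 2 + 1) +
          (2 * z.re ^ 2 + 1) / z.im ^ 2 * (t - z.re) ^ 2 := by
      field_simp; ring
    rw [h4]
    have h5 : 0 ≤ (2 * z.re ^ 2 + 1) / z.im ^ 2 * (t - z.re) ^ 2 := by positivity
    nlinarith [sq_nonneg (t - 2 * z.re), sq_nonneg z.im]
  rw [mul_inv_le_iff₀ h1]
  calc Real.pi⁻¹ * z.im = Real.pi⁻¹ * z.im * ((t ^ 2 + 1) * (t ^ 2 + 1)⁻¹) := by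
        rw [mul_inv_cancel₀ h2.ne', mul_one]
    _ ≤ Real.pi⁻¹ * z.im * (((2 + (2 * z.re ^ 2 + 1) / z.im ^ 2) * ((t - z.re) ^ 2 + z.im ^ 2))
        * (t ^ 2 + 1)⁻¹) := by gcongr
    _ = _ := by ring

/-- A bounded harmonic function on the upper half-plane (given as the imaginary part of a
holomorphic function) is the Poisson integral of a bounded function. -/
theorem exists_boundary_function {G : ℂ → ℂ} {M : ℝ} (hd : DifferentiableOn ℂ G {z | 0 < z.im})
    (hb : ∀ z : ℂ, 0 < z.im → |(G z).im| ≤ M) :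
    ∃ g : ℝ → ℝ, Measurable g ∧ (∀ t, |g t| ≤ M) ∧
      ∀ z : ℂ, 0 < z.im → (G z).im = ∫ t, g t ∂harmonicMeasure z := by
  have hI : 0 < Complex.I.im := by simp
  set μ := harmonicMeasure Complex.I with hμ
  have hM : 0 ≤ M := (abs_nonneg _).trans (hb _ hI)
  set ε : ℕ → ℝ := fun n => 1 / ((n : ℝ) + 1) with hε
  have hε0 : ∀ n, 0 < ε n := fun n => by simp only [hε]; positivity
  set w : ℕ → ℝ → ℝ := fun n t => (G (t + ε n * Complex.I)).im with hw
  have hwM : ∀ n t, |w n t| ≤ M := fun n t => hb _ (by simpa using hε0 n)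
  have hwc : ∀ n, Continuous (w n) := fun n =>
    Complex.continuous_im.comp (hd.continuousOn.comp_continuous (by fun_prop)
      fun t => by simpa using hε0 n)
  have hL : ∀ n, MemLp (w n) 2 μ := fun n =>
    MemLp.of_bound (hwc n).aestronglyMeasurable M (ae_of_all _ (hwM n))
  set u : ℕ → Lp ℝ 2 μ := fun n => (hL n).toLp (w n) with hu
  have hun : ∀ n, ‖u n‖ ≤ M := by
    intro n
    have := Lp.norm_le_of_ae_bound (f := u n) hM (by
      filter_upwards [(hL n).coeFn_toLp] with t ht
      rw [ht]; exact hwM n t)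
    simpa [measureUnivNNReal] using this
  set Λ : ℕ → WeakDual ℝ (Lp ℝ 2 μ) := fun n =>
    StrongDual.toWeakDual (InnerProductSpace.toDual ℝ _ (u n)) with hΛ
  have hcpt := WeakDual.isCompact_closedBall (𝕜 := ℝ) (E := Lp ℝ 2 μ) 0 M
  -- The traces on the lines `Im = ε n` lie in a ball of `L²(ω_i)`. Banach–Alaoglu gives a weak
  -- limit along an ultrafilter, so no subsequence has to be chosen.
  set 𝒰 : Ultrafilter (WeakDual ℝ (Lp ℝ 2 μ)) := (hyperfilter ℕ).map Λ
  obtain ⟨l, -, hl⟩ := hcpt.ultrafilter_le_nhds 𝒰 (by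
    rw [le_principal_iff]
    refine Eventually.of_forall (f := (hyperfilter ℕ : Filter ℕ)) fun n => ?_
    simp only [mem_preimage, mem_closedBall_zero_iff]
    show ‖InnerProductSpace.toDual ℝ _ (u n)‖ ≤ M
    rw [LinearIsometryEquiv.norm_map]; exact hun n)
  set g₀ : Lp ℝ 2 μ := (InnerProductSpace.toDual ℝ _).symm (WeakDual.toStrongDual l) with hg₀
  have hlim : ∀ f : Lp ℝ 2 μ, Tendsto (fun n => inner ℝ (u n) f) (hyperfilter ℕ)
      (𝓝 (inner ℝ g₀ f)) := by
    intro f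
    have h1 : Tendsto Λ (hyperfilter ℕ) (𝓝 l) := hl
    have h2 := ((WeakDual.eval_continuous f).tendsto l).comp h1
    have h3 : inner ℝ g₀ f = l f := by
      rw [hg₀, InnerProductSpace.toDual_symm_apply]; rfl
    rw [h3]
    exact h2
  -- The pointwise bound `M` survives the weak limit, since it can be tested on indicator functions.
  have hset : ∀ s, MeasurableSet s → |∫ t in s, g₀ t ∂μ| ≤ M * μ.real s := by
    intro s hs
    have h1 := hlim (indicatorConstLp 2 hs (measure_ne_top μ s) 1)
    have e : ∀ f : Lp ℝ 2 μ, inner ℝ f (indicatorConstLp 2 hs (measure_ne_top μ s) (1 : ℝ))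
        = ∫ t in s, f t ∂μ := fun f => by
      rw [real_inner_comm, L2.inner_indicatorConstLp_one]
    simp only [e] at h1
    refine le_of_tendsto h1.abs (Eventually.of_forall fun n => ?_)
    refine norm_setIntegral_le_of_norm_le_const_ae (f := u n) (C := M) (measure_lt_top μ s) ?_
    refine ae_restrict_of_ae ?_
    filter_upwards [(hL n).coeFn_toLp] with t ht
    rw [ht]; exact hwM n t
  have hg₀i : Integrable g₀ μ := (Lp.memLp g₀).integrable (by norm_num)
  have hle : ∀ᵐ t ∂μ, g₀ t ≤ M := by
    refine ae_le_of_forall_setIntegral_le hg₀i (integrable_const M) fun s hs _ => ?_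
    rw [setIntegral_const, smul_eq_mul, mul_comm]
    exact (le_abs_self _).trans (hset s hs)
  have hge : ∀ᵐ t ∂μ, -M ≤ g₀ t := by
    refine ae_le_of_forall_setIntegral_le (integrable_const (-M)) hg₀i fun s hs _ => ?_
    rw [setIntegral_const, smul_eq_mul]
    have := (abs_le.1 (hset s hs)).1
    linarith
  have hg₀m : Measurable (g₀ : ℝ → ℝ) := (Lp.stronglyMeasurable g₀).measurable
  -- Clamping alters `g₀` only on a null set and makes the bound hold everywhere.
  refine ⟨fun t => max (-M) (min M (g₀ t)), measurable_const.max (measurable_const.min hg₀m),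
    fun t => abs_le.2 ⟨le_max_left _ _, max_le (by linarith) (min_le_left _ _)⟩, fun z hz => ?_⟩
  have hgeq : ∀ᵐ t ∂harmonicMeasure z, max (-M) (min M (g₀ t)) = g₀ t := by
    refine ((harmonicMeasure_absolutelyContinuous hz).trans
      (absolutelyContinuous_harmonicMeasure hI)).ae_le ?_
    filter_upwards [hle, hge] with t h1 h2
    rw [min_eq_right h1, max_eq_right h2]
  rw [integral_congr_ae hgeq]
  set p : ℝ → ℝ := fun t => halfPlanePoisson z t / halfPlanePoisson Complex.I t with hp
  obtain ⟨C, hC⟩ := exists_bound_halfPlanePoisson_div hz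
  have hpc : Continuous p := (continuous_halfPlanePoisson hz).div (continuous_halfPlanePoisson hI)
    fun t => (halfPlanePoisson_pos hI t).ne'
  have hpL : MemLp p 2 μ := MemLp.of_bound hpc.aestronglyMeasurable C (ae_of_all _ hC)
  have hpint : ∀ f : ℝ → ℝ, ∫ t, f t * p t ∂μ = ∫ t, f t ∂harmonicMeasure z := by
    intro f
    rw [hμ, integral_harmonicMeasure hI, integral_harmonicMeasure hz]
    refine integral_congr_ae (ae_of_all _ fun t => ?_)
    have := (halfPlanePoisson_pos hI t).ne'
    simp only [hp]
    field_simp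
  have hinner : ∀ f : Lp ℝ 2 μ, inner ℝ f (hpL.toLp p) = ∫ t, f t ∂harmonicMeasure z := by
    intro f
    rw [← hpint, L2.inner_def]
    refine integral_congr_ae ?_
    filter_upwards [hpL.coeFn_toLp] with t ht
    rw [ht]
    simp [mul_comm]
  have h1 := hlim (hpL.toLp p)
  rw [hinner] at h1
  refine tendsto_nhds_unique ?_ h1
  -- The shifted function is holomorphic across the real axis, so Poisson's formula applies to it;
  -- as the shift tends to zero its value at `z` tends to `G z`.
  have h2 : ∀ n, inner ℝ (u n) (hpL.toLp p) = (G (z + ε n * Complex.I)).im := by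
    intro n
    have h3 : ∀ᵐ t ∂harmonicMeasure z, (u n) t = w n t :=
      ((harmonicMeasure_absolutelyContinuous hz).trans
        (absolutelyContinuous_harmonicMeasure hI)).ae_le (hL n).coeFn_toLp
    rw [hinner, integral_congr_ae h3]
    have hmap : ∀ ζ : ℂ, -ε n < ζ.im → 0 < (ζ + ε n * Complex.I).im := fun ζ hζ => by
      simp; linarith
    exact (im_eq_integral_harmonicMeasure (H := fun ζ => G (ζ + ε n * Complex.I)) (hε0 n)
      (hd.comp (by fun_prop) fun ζ hζ => hmap ζ hζ) (fun ζ hζ => hb _ (hmap ζ hζ)) hz).symm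
  simp only [h2]
  have h4 : Tendsto (fun n => z + ε n * Complex.I) atTop (𝓝 z) := by
    have h5 : Tendsto ε atTop (𝓝 0) := tendsto_one_div_add_atTop_nhds_zero_nat
    have h6 := (((Complex.continuous_ofReal.tendsto 0).comp h5).mul_const Complex.I).const_add z
    simpa using h6
  have h7 : ContinuousAt G z :=
    (hd.differentiableAt (isOpen_setOf_im_pos.mem_nhds hz)).continuousAt
  exact ((Complex.continuous_im.tendsto _).comp (h7.tendsto.comp h4)).mono_left
    Nat.hyperfilter_le_atTop

/-! ### Fatou's theorem -/

theorem integrable_two_mul_sq_div : Integrable fun τ : ℝ => 2 * τ ^ 2 / (1 + τ ^ 2) ^ 2 := by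
  refine (integrable_inv_one_add_sq.const_mul 2).mono' ?_ (ae_of_all _ fun τ => ?_)
  · exact Continuous.aestronglyMeasurable (by fun_prop (disch := intro; positivity))
  · rw [Real.norm_eq_abs, abs_of_nonneg (by positivity), ← div_eq_mul_inv, div_le_div_iff₀
      (by positivity) (by positivity)]
    nlinarith [sq_nonneg τ, sq_nonneg (τ ^ 2)]

theorem abs_intervalIntegral_le {h : ℝ → ℝ} {M : ℝ} (hM : ∀ t, |h t| ≤ M) (x y : ℝ) :
    |∫ t in x..y, h t| ≤ M * |y - x| :=
  intervalIntegral.norm_integral_le_of_norm_le_const (f := h) fun t _ => hM t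

/-- Integration by parts against the Poisson kernel. -/
theorem integral_inv_one_add_sq_mul {h : ℝ → ℝ} {M : ℝ} (hm : Measurable h)
    (hM : ∀ t, |h t| ≤ M) :
    ∫ τ, (1 + τ ^ 2)⁻¹ * h τ = ∫ τ, 2 * τ / (1 + τ ^ 2) ^ 2 * ∫ s in (0 : ℝ)..τ, h s := by
  have hi : ∀ x y, IntervalIntegrable h volume x y := fun x y =>
    (intervalIntegrable_const (c := M)).mono_fun' hm.aestronglyMeasurable
      (ae_of_all _ fun t => hM t)
  have hHc : Continuous fun τ => ∫ s in (0 : ℝ)..τ, h s := intervalIntegral.continuous_primitive hi 0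
  have hM0 : 0 ≤ M := (abs_nonneg _).trans (hM 0)
  have i1 : Integrable fun τ => (1 + τ ^ 2)⁻¹ * h τ :=
    integrable_inv_one_add_sq.mul_bdd (c := M) hm.aestronglyMeasurable (ae_of_all _ hM)
  have hkc : Continuous fun τ : ℝ => 2 * τ / (1 + τ ^ 2) ^ 2 := by
    fun_prop (disch := intro; positivity)
  have i2 : Integrable fun τ => 2 * τ / (1 + τ ^ 2) ^ 2 * ∫ s in (0 : ℝ)..τ, h s := by
    refine (integrable_two_mul_sq_div.const_mul M).mono' (hkc.mul hHc).aestronglyMeasurable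
      (ae_of_all _ fun τ => ?_)
    have h1 := abs_intervalIntegral_le hM 0 τ
    rw [sub_zero] at h1
    rw [norm_mul, Real.norm_eq_abs, Real.norm_eq_abs, abs_div, abs_mul, abs_two,
      abs_of_nonneg (show (0 : ℝ) ≤ (1 + τ ^ 2) ^ 2 by positivity)]
    calc 2 * |τ| / (1 + τ ^ 2) ^ 2 * |∫ s in (0 : ℝ)..τ, h s|
        ≤ 2 * |τ| / (1 + τ ^ 2) ^ 2 * (M * |τ|) := by gcongr
      _ = M * (2 * (|τ| * |τ|) / (1 + τ ^ 2) ^ 2) := by ring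
      _ = _ := by rw [abs_mul_abs_self]; ring
  have hder : ∀ τ : ℝ, HasDerivAt (fun τ : ℝ => (1 + τ ^ 2)⁻¹) (-(2 * τ / (1 + τ ^ 2) ^ 2)) τ := by
    intro τ
    have := (((hasDerivAt_id τ).pow 2).const_add 1).inv
      (show 1 + (id ^ 2) τ ≠ 0 by simp only [Pi.pow_apply, id]; positivity)
    refine this.congr_deriv ?_
    simp only [Pi.pow_apply, id]
    ring
  have hparts : ∀ n : ℕ, (1 + (n : ℝ) ^ 2)⁻¹ * (∫ s in (0 : ℝ)..n, h s)
      - (1 + (-(n : ℝ)) ^ 2)⁻¹ * (∫ s in (0 : ℝ)..(-n), h s)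
      = (∫ τ in (-(n : ℝ))..n, (1 + τ ^ 2)⁻¹ * h τ)
        - ∫ τ in (-(n : ℝ))..n, 2 * τ / (1 + τ ^ 2) ^ 2 * ∫ s in (0 : ℝ)..τ, h s := by
    intro n
    have hn : -(n : ℝ) ≤ n := by linarith [n.cast_nonneg (α := ℝ)]
    have key := mul_sub_mul_eq_integral_of_primitive (f := fun τ : ℝ => (1 + τ ^ 2)⁻¹)
      (f' := fun τ => -(2 * τ / (1 + τ ^ 2) ^ 2)) (g := fun τ => ∫ s in (0 : ℝ)..τ, h s)
      (g' := h) hn (hkc.neg.intervalIntegrable _ _) (hi _ _)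
      (fun x _ => by
        rw [intervalIntegral.integral_eq_sub_of_hasDerivAt (fun t _ => hder t)
          (hkc.neg.intervalIntegrable _ _)]
        ring)
      (fun x _ => (intervalIntegral.integral_add_adjacent_intervals (hi _ _) (hi _ _)).symm)
    rw [key, ← intervalIntegral.integral_sub i1.intervalIntegrable i2.intervalIntegrable]
    refine intervalIntegral.integral_congr fun τ _ => ?_
    ring
  have hcast : Tendsto (fun n : ℕ => (n : ℝ)) atTop atTop := tendsto_natCast_atTop_atTop
  have hcast' : Tendsto (fun n : ℕ => -(n : ℝ)) atTop atBot := tendsto_neg_atTop_atBot.comp hcast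
  have t1 := (intervalIntegral_tendsto_integral i1 hcast' hcast).sub
    (intervalIntegral_tendsto_integral i2 hcast' hcast)
  simp only [← hparts] at t1
  have t0 : Tendsto (fun n : ℕ => M * (n : ℝ)⁻¹) atTop (𝓝 0) := by
    simpa using (tendsto_inv_atTop_zero.comp hcast).const_mul M
  -- The boundary terms at `±n` are `O(1/n)`: the primitive grows at most linearly, and the kernel
  -- decays quadratically.
  have hbd : ∀ y : ℝ, 0 < |y| → |(1 + y ^ 2)⁻¹ * ∫ s in (0 : ℝ)..y, h s| ≤ M * |y|⁻¹ := by
    intro y hy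
    have h1 := abs_intervalIntegral_le hM 0 y
    rw [sub_zero] at h1
    rw [abs_mul, abs_of_pos (show 0 < (1 + y ^ 2)⁻¹ by positivity)]
    have h2 : (1 + y ^ 2)⁻¹ ≤ |y|⁻¹ * |y|⁻¹ := by
      rw [← mul_inv, abs_mul_abs_self]
      have : 0 < y * y := by rw [← abs_mul_abs_self]; positivity
      gcongr
      nlinarith
    calc _ ≤ |y|⁻¹ * |y|⁻¹ * (M * |y|) := by gcongr
      _ = M * |y|⁻¹ := by field_simp
  have t2 : Tendsto (fun n : ℕ => (1 + (n : ℝ) ^ 2)⁻¹ * (∫ s in (0 : ℝ)..n, h s)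
      - (1 + (-(n : ℝ)) ^ 2)⁻¹ * (∫ s in (0 : ℝ)..(-n), h s)) atTop (𝓝 (0 - 0)) := by
    refine Tendsto.sub ?_ ?_
    · refine squeeze_zero_norm' ?_ t0
      filter_upwards [eventually_gt_atTop 0] with n hn
      have hn' : (0 : ℝ) < n := by exact_mod_cast hn
      have := hbd n (by rwa [abs_of_pos hn'])
      rwa [abs_of_pos hn'] at this
    · refine squeeze_zero_norm' ?_ t0
      filter_upwards [eventually_gt_atTop 0] with n hn
      have hn' : (0 : ℝ) < n := by exact_mod_cast hn
      have := hbd (-n) (by rwa [abs_neg, abs_of_pos hn'])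
      rwa [abs_neg, abs_of_pos hn'] at this
  have := tendsto_nhds_unique t1 t2
  linarith

theorem integral_two_mul_sq_div : ∫ τ : ℝ, 2 * τ / (1 + τ ^ 2) ^ 2 * τ = Real.pi := by
  have h := integral_inv_one_add_sq_mul (h := fun _ => 1) (M := 1) measurable_const (by simp)
  simp only [mul_one, intervalIntegral.integral_const, sub_zero, smul_eq_mul] at h
  rw [← h, integral_univ_inv_one_add_sq]

/-- Scaling by `t = x + d τ` and integrating by parts makes the Poisson integral a weighted average
of difference quotients of a primitive of `g`, with a weight independent of `d`. Fatou's theorem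
then follows from Lebesgue differentiation. -/
theorem integral_harmonicMeasure_eq {g : ℝ → ℝ} {M : ℝ} (hm : Measurable g) (hM : ∀ t, |g t| ≤ M)
    (x : ℝ) {d : ℝ} (hd : 0 < d) :
    ∫ t, g t ∂harmonicMeasure (x + d * Complex.I) = Real.pi⁻¹ *
      ∫ τ, 2 * τ / (1 + τ ^ 2) ^ 2 * (((∫ s in (0 : ℝ)..(x + d * τ), g s)
        - ∫ s in (0 : ℝ)..x, g s) / d) := by
  have hz : 0 < ((x : ℂ) + d * Complex.I).im := by simpa using hd
  have hi : ∀ x y, IntervalIntegrable g volume x y := fun x y =>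
    (intervalIntegrable_const (c := M)).mono_fun' hm.aestronglyMeasurable
      (ae_of_all _ fun t => hM t)
  rw [integral_harmonicMeasure hz]
  have h1 : ∀ τ, ∫ s in (0 : ℝ)..τ, g (x + d * s)
      = ((∫ s in (0 : ℝ)..(x + d * τ), g s) - ∫ s in (0 : ℝ)..x, g s) / d := by
    intro τ
    rw [intervalIntegral.integral_comp_add_mul _ hd.ne', mul_zero, add_zero,
      intervalIntegral.integral_interval_sub_left (hi _ _) (hi _ _), smul_eq_mul, div_eq_inv_mul]
  simp only [← h1]
  rw [← integral_inv_one_add_sq_mul (h := fun s => g (x + d * s)) (M := M)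
    (hm.comp (by fun_prop)) (fun t => hM _), ← integral_const_mul]
  have h2 := Measure.integral_comp_mul_left (fun τ => halfPlanePoisson (x + d * Complex.I) (x + τ)
    * g (x + τ)) d
  rw [integral_add_left_eq_self (fun τ => halfPlanePoisson (x + d * Complex.I) τ * g τ) x,
    abs_of_pos (inv_pos.2 hd), smul_eq_mul, eq_inv_mul_iff_mul_eq₀ hd.ne'] at h2
  rw [← h2, ← integral_const_mul]
  refine integral_congr_ae (ae_of_all _ fun τ => ?_)
  simp only [halfPlanePoisson]
  simp
  field_simp
  ring

/-- **Fatou's theorem**: Poisson integrals of bounded functions have vertical boundary values almost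
everywhere. -/
theorem ae_tendsto_integral_harmonicMeasure {g : ℝ → ℝ} {M : ℝ} (hm : Measurable g)
    (hM : ∀ t, |g t| ≤ M) :
    ∀ᵐ x : ℝ, Tendsto (fun d : ℝ => ∫ t, g t ∂harmonicMeasure (x + d * Complex.I)) (𝓝[>] 0)
      (𝓝 (g x)) := by
  have hi : ∀ x y, IntervalIntegrable g volume x y := fun x y =>
    (intervalIntegrable_const (c := M)).mono_fun' hm.aestronglyMeasurable
      (ae_of_all _ fun t => hM t)
  have hloc : LocallyIntegrable g volume :=
    locallyIntegrable_const M |>.mono hm.aestronglyMeasurable (ae_of_all _ fun t =>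
      (hM t).trans (le_abs_self M))
  have hM0 : 0 ≤ M := (abs_nonneg _).trans (hM 0)
  filter_upwards [LocallyIntegrable.ae_hasDerivAt_integral hloc] with x hx
  set K : ℝ → ℝ := fun y => ∫ s in (0 : ℝ)..y, g s with hK
  have hKd : HasDerivAt K (g x) x := hx 0
  have hKc : Continuous K := intervalIntegral.continuous_primitive hi 0
  -- The difference quotients are at most `M |τ|` and tend to `τ g(x)`; the weight times `|τ|` is
  -- integrable.
  have hlim : Tendsto (fun d : ℝ => ∫ τ, 2 * τ / (1 + τ ^ 2) ^ 2 * ((K (x + d * τ) - K x) / d))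
      (𝓝[>] 0) (𝓝 (∫ τ, 2 * τ / (1 + τ ^ 2) ^ 2 * (τ * g x))) := by
    refine tendsto_integral_filter_of_dominated_convergence
      (fun τ => M * (2 * τ ^ 2 / (1 + τ ^ 2) ^ 2)) ?_ ?_ (integrable_two_mul_sq_div.const_mul M) ?_
    · refine Eventually.of_forall fun d => Continuous.aestronglyMeasurable ?_
      have hkc : Continuous fun τ : ℝ => 2 * τ / (1 + τ ^ 2) ^ 2 := by
        fun_prop (disch := intro; positivity)
      exact hkc.mul (((hKc.comp (by fun_prop)).sub continuous_const).div_const d)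
    · filter_upwards [self_mem_nhdsWithin] with d hd
      have hd0 : 0 < d := hd
      refine ae_of_all _ fun τ => ?_
      have h1 : |K (x + d * τ) - K x| ≤ M * (d * |τ|) := by
        simp only [hK]
        rw [intervalIntegral.integral_interval_sub_left (hi _ _) (hi _ _)]
        refine (abs_intervalIntegral_le hM _ _).trans (le_of_eq ?_)
        rw [add_sub_cancel_left, abs_mul, abs_of_pos hd0]
      have h2 : |(K (x + d * τ) - K x) / d| ≤ M * |τ| := by
        rw [abs_div, abs_of_pos hd0, div_le_iff₀ hd0]
        linarith
      rw [norm_mul, Real.norm_eq_abs, Real.norm_eq_abs, abs_div, abs_mul, abs_two,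
        abs_of_nonneg (show (0 : ℝ) ≤ (1 + τ ^ 2) ^ 2 by positivity)]
      calc _ ≤ 2 * |τ| / (1 + τ ^ 2) ^ 2 * (M * |τ|) := by gcongr
        _ = M * (2 * (|τ| * |τ|) / (1 + τ ^ 2) ^ 2) := by ring
        _ = _ := by rw [abs_mul_abs_self]; ring
    · refine ae_of_all _ fun τ => Tendsto.const_mul _ ?_
      have h1 : HasDerivAt (fun d : ℝ => K (x + d * τ)) (g x * τ) 0 := by
        have h2 : HasDerivAt (fun d : ℝ => x + d * τ) τ 0 := by
          simpa using ((hasDerivAt_id (0 : ℝ)).mul_const τ).const_add x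
        have h3 : HasDerivAt K (g x) (x + 0 * τ) := by simpa using hKd
        exact h3.comp 0 h2
      have h4 := h1.tendsto_slope_zero_right
      simp only [zero_add, zero_mul, add_zero, smul_eq_mul] at h4
      rw [mul_comm τ]
      exact h4.congr fun d => by rw [div_eq_inv_mul]
  have hval : ∫ τ : ℝ, 2 * τ / (1 + τ ^ 2) ^ 2 * (τ * g x) = Real.pi * g x := by
    rw [← integral_two_mul_sq_div, ← integral_mul_const]
    refine integral_congr_ae (ae_of_all _ fun τ => ?_)
    simp only
    ring
  rw [hval] at hlim
  have h5 := hlim.const_mul Real.pi⁻¹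
  rw [inv_mul_cancel_left₀ Real.pi_pos.ne'] at h5
  refine h5.congr' ?_
  filter_upwards [self_mem_nhdsWithin] with d hd
  exact (integral_harmonicMeasure_eq hm hM x hd).symm

/-! ### Boundary values of Herglotz functions -/

/-- The jump of `arg` across the negative axis is invisible from the closed upper half-plane, so
only the origin is exceptional. -/
theorem continuousWithinAt_arg_of_im_nonneg {w : ℂ} (hw : w ≠ 0) :
    ContinuousWithinAt Complex.arg {z | 0 ≤ z.im} w := by
  by_cases hs : w ∈ Complex.slitPlane
  · exact (Complex.continuousAt_arg hs).continuousWithinAt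
  · rw [Complex.mem_slitPlane_iff, not_or, not_lt, not_ne_iff] at hs
    refine Complex.continuousWithinAt_arg_of_re_neg_of_im_zero (lt_of_le_of_ne hs.1 fun h0 => ?_) hs.2
    exact hw (Complex.ext h0 hs.2)

theorem tendsto_arg_sub {ι : Type*} {l : Filter ι} {f : ι → ℂ} {c : ℂ} {t : ℝ}
    (hf : Tendsto f l (𝓝 c)) (hp : ∀ᶠ i in l, 0 < (f i).im) (hct : c ≠ t) :
    Tendsto (fun i => Complex.arg (f i - t)) l (𝓝 (Complex.arg (c - t))) := by
  have h1 := continuousWithinAt_arg_of_im_nonneg (sub_ne_zero.2 hct)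
  refine Tendsto.comp (g := Complex.arg) h1 (tendsto_nhdsWithin_iff.2 ⟨hf.sub_const _, ?_⟩)
  filter_upwards [hp] with i hi
  simpa using hi.le

theorem im_pos_vertical {x d : ℝ} (hd : 0 < d) : 0 < ((x : ℂ) + (d : ℂ) * Complex.I).im := by
  simpa using hd

theorem IsHerglotz.eventually_im_pos {F : ℂ → ℂ} (hF : IsHerglotz F) (x : ℝ) :
    ∀ᶠ d : ℝ in 𝓝[>] 0, 0 < (F (x + d * Complex.I)).im :=
  eventually_nhdsWithin_of_forall fun _ hd => hF.im_pos _ (im_pos_vertical hd)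

theorem isHerglotz_id : IsHerglotz fun z => z := ⟨differentiableOn_id, fun _ h => h⟩

theorem IsHerglotz.neg_inv {F : ℂ → ℂ} (hF : IsHerglotz F) : IsHerglotz fun z => -(F z)⁻¹ := by
  have hne : ∀ z : ℂ, 0 < z.im → F z ≠ 0 := fun z hz h => by
    have := hF.im_pos z hz
    simp [h] at this
  refine ⟨(hF.differentiableOn.inv fun z hz => hne z hz).neg, fun z hz => ?_⟩
  rw [Complex.neg_im, Complex.inv_im, neg_div, neg_neg]
  exact div_pos (hF.im_pos z hz) (Complex.normSq_pos.2 (hne z hz))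

/-- `arg (F - t)` is the imaginary part of `log (F - t)`, so it is harmonic and bounded by `π`. The
representation theorem and Fatou's theorem therefore apply. -/
theorem IsHerglotz.exists_arg_boundary {F : ℂ → ℂ} (hF : IsHerglotz F) (t : ℝ) :
    ∃ g : ℝ → ℝ, Measurable g ∧ (∀ x, |g x| ≤ Real.pi) ∧
      (∀ z : ℂ, 0 < z.im → Complex.arg (F z - t) = ∫ x, g x ∂harmonicMeasure z) ∧
      ∀ᵐ x : ℝ, Tendsto (fun d : ℝ => Complex.arg (F (x + d * Complex.I) - t)) (𝓝[>] 0)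
        (𝓝 (g x)) := by
  obtain ⟨g, hm, hM, hg⟩ := exists_boundary_function (G := fun z => Complex.log (F z - t))
    (M := Real.pi) ((hF.differentiableOn.sub_const _).clog fun z hz => Or.inr (by
      simpa using (hF.im_pos z hz).ne')) fun z _ => by
        rw [Complex.log_im]; exact Complex.abs_arg_le_pi _
  simp only [Complex.log_im] at hg
  refine ⟨g, hm, hM, hg, ?_⟩
  filter_upwards [ae_tendsto_integral_harmonicMeasure hm hM] with x hx
  refine hx.congr' ?_
  filter_upwards [self_mem_nhdsWithin] with d hd
  exact (hg _ (im_pos_vertical hd)).symm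

/-- The angle `arg (w - t)` is `π` times the harmonic measure of `(-∞, t)`. -/
theorem arg_sub_eq {w : ℂ} (hw : 0 ≤ w.im) (t : ℝ) :
    Complex.arg (w - t) = Real.pi * (harmonicMeasure w).real (Iio t) := by
  rcases hw.eq_or_lt with hw | hw
  · rw [harmonicMeasure_of_im_eq_zero hw.symm, measureReal_def, Measure.dirac_apply' _ measurableSet_Iio]
    have e : w - t = ((w.re - t : ℝ) : ℂ) := by
      apply Complex.ext <;> simp [← hw]
    rw [e]
    by_cases h : w.re < t
    · rw [Complex.arg_ofReal_of_neg (by linarith)]; simp [h]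
    · rw [Complex.arg_ofReal_of_nonneg (by linarith)]; simp [h]
  -- For the identity function the boundary value of `arg (z - t)` is `π` to the left of `t` and `0`
  -- to the right.
  · obtain ⟨g, hm, hM, hg, hlim⟩ := isHerglotz_id.exists_arg_boundary t
    rw [hg w hw, ← integral_indicator_one measurableSet_Iio, ← integral_const_mul]
    refine integral_congr_ae ((harmonicMeasure_absolutelyContinuous hw).ae_le ?_)
    have hne : ∀ᵐ x : ℝ, x ≠ t := by simp [ae_iff]
    filter_upwards [hlim, hne] with x hx hxt
    have h1 : Tendsto (fun d : ℝ => (x : ℂ) + d * Complex.I) (𝓝[>] 0) (𝓝 x) := by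
      have : Continuous fun d : ℝ => (x : ℂ) + d * Complex.I := by fun_prop
      simpa using (this.tendsto 0).mono_left nhdsWithin_le_nhds
    have h2 := tendsto_arg_sub (t := t) h1 (isHerglotz_id.eventually_im_pos x)
      (by exact_mod_cast hxt)
    rw [tendsto_nhds_unique hx h2, ← Complex.ofReal_sub]
    rcases lt_or_gt_of_ne hxt with h | h
    · rw [Complex.arg_ofReal_of_neg (by linarith)]; simp [h]
    · rw [Complex.arg_ofReal_of_nonneg (by linarith)]; simp [h.le]

theorem arg_sub_mono {w : ℂ} (hw : 0 ≤ w.im) {s t : ℝ} (hst : s ≤ t) :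
    Complex.arg (w - s) ≤ Complex.arg (w - t) := by
  rw [arg_sub_eq hw, arg_sub_eq hw]
  exact mul_le_mul_of_nonneg_left (measureReal_mono (Iio_subset_Iio hst)) Real.pi_pos.le

/-- Where the boundary value is `t`, those of `arg (F - (t + δ))` and `arg (F - (t - δ))` differ by
`π`. Hence `π ω_i(E)` is at most the difference of these functions at `i`, which vanishes as `δ →
0`. -/
theorem IsHerglotz.ae_not_tendsto_real {F : ℂ → ℂ} (hF : IsHerglotz F) (t : ℝ) :
    ∀ᵐ x : ℝ, ¬ Tendsto (fun d : ℝ => F (x + d * Complex.I)) (𝓝[>] 0) (𝓝 (t : ℂ)) := by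
  have hI : 0 < Complex.I.im := by simp
  have hpi := Real.pi_pos
  refine (absolutelyContinuous_harmonicMeasure hI).ae_le ?_
  set μ := harmonicMeasure Complex.I with hμ
  set E : Set ℝ := {x | Tendsto (fun d : ℝ => F (x + d * Complex.I)) (𝓝[>] 0) (𝓝 (t : ℂ))} with hE
  have key : ∀ δ : ℝ, 0 < δ → Real.pi * μ.real E ≤
      Complex.arg (F Complex.I - (t + δ : ℝ)) - Complex.arg (F Complex.I - (t - δ : ℝ)) := by
    intro δ hδ
    obtain ⟨g, hm, hM, hg, hlim⟩ := hF.exists_arg_boundary (t + δ)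
    obtain ⟨g', hm', hM', hg', hlim'⟩ := hF.exists_arg_boundary (t - δ)
    have ig : Integrable g μ := integrable_of_abs_le hm.aestronglyMeasurable hM
    have ig' : Integrable g' μ := integrable_of_abs_le hm'.aestronglyMeasurable hM'
    rw [hg _ hI, hg' _ hI, ← integral_sub ig ig']
    have h0 : 0 ≤ᵐ[μ] fun x => g x - g' x := by
      refine (harmonicMeasure_absolutelyContinuous hI).ae_le ?_
      filter_upwards [hlim, hlim'] with x h1 h2
      refine sub_nonneg.2 (le_of_tendsto_of_tendsto h2 h1 ?_)
      filter_upwards [hF.eventually_im_pos x] with d hd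
      exact arg_sub_mono hd.le (by linarith)
    refine le_trans ?_ (mul_meas_ge_le_integral_of_nonneg h0 (ig.sub ig') Real.pi)
    refine mul_le_mul_of_nonneg_left ?_ hpi.le
    refine ENNReal.toReal_mono (measure_ne_top _ _) (measure_mono_ae ?_)
    refine (harmonicMeasure_absolutelyContinuous hI).ae_le ?_
    filter_upwards [hlim, hlim'] with x h1 h2 hx
    have hx : Tendsto (fun d : ℝ => F (x + d * Complex.I)) (𝓝[>] 0) (𝓝 (t : ℂ)) := hx
    have e1 := tendsto_arg_sub (t := t + δ) hx (hF.eventually_im_pos x)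
      (by exact_mod_cast (by linarith : t < t + δ).ne)
    have e2 := tendsto_arg_sub (t := t - δ) hx (hF.eventually_im_pos x)
      (by exact_mod_cast (by linarith : t - δ < t).ne')
    show Real.pi ≤ g x - g' x
    rw [tendsto_nhds_unique h1 e1, tendsto_nhds_unique h2 e2, ← Complex.ofReal_sub,
      ← Complex.ofReal_sub, Complex.arg_ofReal_of_neg (by linarith),
      Complex.arg_ofReal_of_nonneg (by linarith)]
    linarith
  have hlim : Tendsto (fun δ : ℝ => Complex.arg (F Complex.I - (t + δ : ℝ)) -
      Complex.arg (F Complex.I - (t - δ : ℝ))) (𝓝[>] 0) (𝓝 0) := by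
    have him := hF.im_pos _ hI
    have hc : ContinuousAt (fun δ : ℝ => Complex.arg (F Complex.I - (t + δ : ℝ)) -
        Complex.arg (F Complex.I - (t - δ : ℝ))) 0 := by
      refine ContinuousAt.sub ?_ ?_
      · refine ContinuousAt.comp (g := Complex.arg) (Complex.continuousAt_arg (Or.inr ?_))
          (by fun_prop)
        simpa using him.ne'
      · refine ContinuousAt.comp (g := Complex.arg) (Complex.continuousAt_arg (Or.inr ?_))
          (by fun_prop)
        simpa using him.ne'
    have := hc.tendsto.mono_left (nhdsWithin_le_nhds (s := Ioi 0))
    simpa using this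
  have h1 : Real.pi * μ.real E ≤ 0 := ge_of_tendsto hlim (by
    filter_upwards [self_mem_nhdsWithin] with δ hδ using key δ hδ)
  have h2 : μ.real E = 0 := le_antisymm (by nlinarith [measureReal_nonneg (μ := μ) (s := E)])
    measureReal_nonneg
  rw [measureReal_eq_zero_iff] at h2
  change ∀ᵐ x ∂μ, x ∉ E
  exact measure_eq_zero_iff_ae_notMem.1 h2

/-- The real part is recovered as the imaginary part of `i h`, so Fatou's theorem for imaginary
parts is applied twice. -/
theorem ae_exists_tendsto_of_norm_le_one {h : ℂ → ℂ} (hd : DifferentiableOn ℂ h {z | 0 < z.im})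
    (hb : ∀ z : ℂ, 0 < z.im → ‖h z‖ ≤ 1) :
    ∀ᵐ x : ℝ, ∃ c, Tendsto (fun d : ℝ => h (x + d * Complex.I)) (𝓝[>] 0) (𝓝 c) := by
  obtain ⟨g, hm, hM, hg⟩ := exists_boundary_function hd
    fun z hz => (Complex.abs_im_le_norm _).trans (hb z hz)
  obtain ⟨g', hm', hM', hg'⟩ := exists_boundary_function (hd.const_mul Complex.I)
    (M := 1) fun z hz => (Complex.abs_im_le_norm _).trans (by simpa using hb z hz)
  filter_upwards [ae_tendsto_integral_harmonicMeasure hm hM,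
    ae_tendsto_integral_harmonicMeasure hm' hM'] with x h1 h2
  refine ⟨(g' x : ℂ) + (g x : ℂ) * Complex.I, ?_⟩
  refine (((Complex.continuous_ofReal.tendsto _).comp h2).add
    (((Complex.continuous_ofReal.tendsto _).comp h1).mul_const Complex.I)).congr' ?_
  filter_upwards [self_mem_nhdsWithin] with d hd
  simp only [Function.comp]
  rw [← hg _ (im_pos_vertical hd), ← hg' _ (im_pos_vertical hd)]
  simp

/-- A Herglotz function has finite vertical boundary values almost everywhere. -/
theorem IsHerglotz.ae_tendsto_boundaryValue {F : ℂ → ℂ} (hF : IsHerglotz F) :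
    ∀ᵐ x : ℝ, Tendsto (fun d : ℝ => F (x + d * Complex.I)) (𝓝[>] 0) (𝓝 (boundaryValue F x)) := by
  filter_upwards [ae_exists_tendsto_of_norm_le_one hF.differentiableOn_inv_add_I
    fun z hz => norm_inv_add_I_le (hF.im_pos z hz), hF.neg_inv.ae_not_tendsto_real 0] with x h1 h2
  obtain ⟨c, hc⟩ := h1
  -- Limit zero of `1 / (F + i)` would mean `F → ∞`, that is `-1/F → 0`. Since `-1/F` is Herglotz as
  -- well, this happens only on a null set.
  have hc0 : c ≠ 0 := by
    rintro rfl
    refine h2 ?_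
    have h3 : Tendsto (fun d : ℝ => -((F (x + d * Complex.I) + Complex.I)⁻¹ /
        (1 - Complex.I * (F (x + d * Complex.I) + Complex.I)⁻¹))) (𝓝[>] 0) (𝓝 (-(0 / (1 - Complex.I * 0)))) :=
      (hc.div ((hc.const_mul _).const_sub _) (by simp)).neg
    simp only [mul_zero, sub_zero, zero_div, neg_zero] at h3
    simp only [Complex.ofReal_zero]
    refine h3.congr' ?_
    filter_upwards [hF.eventually_im_pos x] with d hd
    generalize F (x + d * Complex.I) = w at hd
    have e1 := add_I_ne_zero hd
    have e2 : w ≠ 0 := fun h => by simp [h] at hd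
    have e3 : 1 - Complex.I * (w + Complex.I)⁻¹ = w * (w + Complex.I)⁻¹ := by
      field_simp; ring
    rw [e3]
    field_simp
  have h4 : Tendsto (fun d : ℝ => F (x + d * Complex.I)) (𝓝[>] 0) (𝓝 (c⁻¹ - Complex.I)) := by
    refine ((hc.inv₀ hc0).sub_const Complex.I).congr fun d => ?_
    simp
  have h5 := h4.limUnder_eq
  rw [boundaryValue, h5]
  exact h4

theorem IsHerglotz.ae_boundaryValue_im_nonneg {F : ℂ → ℂ} (hF : IsHerglotz F) :
    ∀ᵐ x : ℝ, 0 ≤ (boundaryValue F x).im := by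
  filter_upwards [hF.ae_tendsto_boundaryValue] with x hx
  refine ge_of_tendsto ((Complex.continuous_im.tendsto _).comp hx) ?_
  filter_upwards [hF.eventually_im_pos x] with d hd using hd.le

theorem IsHerglotz.aemeasurable_boundaryValue {F : ℂ → ℂ} (hF : IsHerglotz F) :
    AEMeasurable (boundaryValue F) := by
  have h0 : Tendsto (fun n : ℕ => 1 / ((n : ℝ) + 1)) atTop (𝓝[>] 0) :=
    tendsto_nhdsWithin_iff.2 ⟨tendsto_one_div_add_atTop_nhds_zero_nat,
      Eventually.of_forall fun n => by simp only [mem_Ioi]; positivity⟩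
  refine aemeasurable_of_tendsto_metrizable_ae (u := atTop)
    (f := fun (n : ℕ) (x : ℝ) => F (x + (1 / ((n : ℝ) + 1) : ℝ) * Complex.I)) (fun n => ?_) ?_
  · refine Continuous.aemeasurable (hF.differentiableOn.continuousOn.comp_continuous (by fun_prop)
      fun x => im_pos_vertical (by positivity))
  · filter_upwards [hF.ae_tendsto_boundaryValue] with x hx
    exact hx.comp h0

/-- Half-lines form a generating π-system, and on them the measure is given by `arg`. It depends on
the imaginary part only through its modulus, which allows the point to be moved into the closed
upper half-plane. -/
theorem measurable_harmonicMeasure : Measurable harmonicMeasure := by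
  refine Measurable.measure_of_isPiSystem_of_isProbabilityMeasure (borel_eq_generateFrom_Iio ℝ ▸
    BorelSpace.measurable_eq) isPiSystem_Iio ?_
  rintro _ ⟨t, rfl⟩
  have e : ∀ w : ℂ, harmonicMeasure w (Iio t) = ENNReal.ofReal
      (Complex.arg ((w.re + |w.im| * Complex.I) - t) / Real.pi) := by
    intro w
    have h1 : harmonicMeasure w = harmonicMeasure (w.re + |w.im| * Complex.I) := by
      simp [harmonicMeasure]
    rw [arg_sub_eq (by simp), mul_div_cancel_left₀ _ Real.pi_pos.ne', ← h1, ofReal_measureReal]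
  simp only [e]
  exact ENNReal.measurable_ofReal.comp ((Complex.measurable_arg.comp (by fun_prop)).div_const _)

theorem IsHerglotz.aemeasurable_harmonicMeasure_boundaryValue {F : ℂ → ℂ} (hF : IsHerglotz F) :
    AEMeasurable (fun x => harmonicMeasure (boundaryValue F x)) :=
  measurable_harmonicMeasure.comp_aemeasurable hF.aemeasurable_boundaryValue

theorem IsHerglotz.aemeasurable_harmonicMeasure_real {F : ℂ → ℂ} (hF : IsHerglotz F) {S : Set ℝ}
    (hS : MeasurableSet S) :
    AEMeasurable (fun x => (harmonicMeasure (boundaryValue F x)).real S) :=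
  ((Measure.measurable_coe hS).comp_aemeasurable
    hF.aemeasurable_harmonicMeasure_boundaryValue).ennreal_toReal

/-- Both sides are probability measures, so half-lines suffice, where the claim is the Poisson
representation of `arg (F - t)`. The points with boundary value exactly `t`, where `arg` is not
continuous, form a null set. -/
theorem IsHerglotz.harmonicMeasure_eq_bind {F : ℂ → ℂ} (hF : IsHerglotz F) {z : ℂ}
    (hz : 0 < z.im) : harmonicMeasure (F z) =
      (harmonicMeasure z).bind fun x => harmonicMeasure (boundaryValue F x) := by
  have hmeas : AEMeasurable (fun x => harmonicMeasure (boundaryValue F x)) (harmonicMeasure z) :=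
    hF.aemeasurable_harmonicMeasure_boundaryValue.mono_ac (harmonicMeasure_absolutelyContinuous hz)
  refine ext_of_generate_finite _ (borel_eq_generateFrom_Iio ℝ ▸ BorelSpace.measurable_eq)
    isPiSystem_Iio ?_ ?_
  · rintro _ ⟨t, rfl⟩
    rw [Measure.bind_apply measurableSet_Iio hmeas]
    obtain ⟨g, hm, hM, hg, hlim⟩ := hF.exists_arg_boundary t
    have hpi := Real.pi_pos
    have hgae : ∀ᵐ x ∂harmonicMeasure z, g x =
        Real.pi * (harmonicMeasure (boundaryValue F x)).real (Iio t) := by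
      refine (harmonicMeasure_absolutelyContinuous hz).ae_le ?_
      filter_upwards [hlim, hF.ae_tendsto_boundaryValue, hF.ae_boundaryValue_im_nonneg,
        hF.ae_not_tendsto_real t] with x h1 h2 h3 h4
      rw [← arg_sub_eq h3]
      refine tendsto_nhds_unique h1 (tendsto_arg_sub h2 (hF.eventually_im_pos x) ?_)
      intro h5
      exact h4 (h5 ▸ h2)
    have h1 : Real.pi * (harmonicMeasure (F z)).real (Iio t) =
        Real.pi * ∫ x, (harmonicMeasure (boundaryValue F x)).real (Iio t) ∂harmonicMeasure z := by
      rw [← arg_sub_eq (hF.im_pos z hz).le, hg z hz, integral_congr_ae hgae, integral_const_mul]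
    have h2 := mul_left_cancel₀ hpi.ne' h1
    rw [← ofReal_measureReal, h2, ofReal_integral_eq_lintegral_ofReal]
    · exact lintegral_congr fun x => ofReal_measureReal
    · refine Integrable.of_bound ?_ 1 (ae_of_all _ fun x => ?_)
      · exact ((Measure.measurable_coe measurableSet_Iio).comp_aemeasurable
          hmeas).ennreal_toReal.aestronglyMeasurable
      · rw [Real.norm_of_nonneg measureReal_nonneg]
        exact measureReal_le_one
    · exact ae_of_all _ fun _ => measureReal_nonneg
  · rw [Measure.bind_apply MeasurableSet.univ hmeas]
    simp

/-- The harmonic measure of a Herglotz function is the Poisson integral of its boundary values. -/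
theorem IsHerglotz.harmonicMeasure_real_eq {F : ℂ → ℂ} (hF : IsHerglotz F) {z : ℂ}
    (hz : 0 < z.im) {S : Set ℝ} (hS : MeasurableSet S) : (harmonicMeasure (F z)).real S =
      ∫ x, (harmonicMeasure (boundaryValue F x)).real S ∂harmonicMeasure z := by
  have hmeas : AEMeasurable (fun x => harmonicMeasure (boundaryValue F x)) (harmonicMeasure z) :=
    hF.aemeasurable_harmonicMeasure_boundaryValue.mono_ac (harmonicMeasure_absolutelyContinuous hz)
  rw [measureReal_def, hF.harmonicMeasure_eq_bind hz, Measure.bind_apply hS hmeas]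
  exact (integral_toReal ((Measure.measurable_coe hS).comp_aemeasurable hmeas)
    (ae_of_all _ fun x => measure_lt_top _ _)).symm

/-! ### Convergence in value distribution -/

/-- **Scheffé's lemma**. -/
theorem tendsto_integral_abs_sub_of_integral_eq {α ι : Type*} [MeasurableSpace α] {μ : Measure α}
    {l : Filter ι} [l.IsCountablyGenerated] {f : ι → α → ℝ} {g : α → ℝ}
    (hf : ∀ᶠ i in l, Integrable (f i) μ) (hg : Integrable g μ) (hf0 : ∀ᶠ i in l, 0 ≤ᵐ[μ] f i)
    (hlim : ∀ᵐ x ∂μ, Tendsto (fun i => f i x) l (𝓝 (g x)))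
    (hint : ∀ᶠ i in l, ∫ x, f i x ∂μ = ∫ x, g x ∂μ) :
    Tendsto (fun i => ∫ x, |g x - f i x| ∂μ) l (𝓝 0) := by
  -- The positive part of `g - f i` is dominated by `|g|`, and `|h| = 2 h⁺ - h` where `h = g - f i`
  -- has integral zero.
  have h1 : Tendsto (fun i => ∫ x, max (g x - f i x) 0 ∂μ) l (𝓝 (∫ _, 0 ∂μ)) := by
    refine tendsto_integral_filter_of_dominated_convergence (fun x => |g x|) ?_ ?_ hg.abs ?_
    · filter_upwards [hf] with i hi using (hg.sub hi).pos_part.aestronglyMeasurable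
    · filter_upwards [hf0] with i hi
      filter_upwards [hi] with x hx
      rw [Real.norm_of_nonneg (le_max_right _ _)]
      have hx : 0 ≤ f i x := hx
      exact max_le (by linarith [le_abs_self (g x)]) (abs_nonneg _)
    · filter_upwards [hlim] with x hx
      have h2 := (hx.const_sub (g x)).max (tendsto_const_nhds (x := (0 : ℝ)))
      simpa using h2
  have h2 := h1.const_mul 2
  simp only [integral_zero, mul_zero] at h2
  refine h2.congr' ?_
  filter_upwards [hf, hint] with i hi hii
  have e : ∀ x, |g x - f i x| = 2 * max (g x - f i x) 0 - (g x - f i x) := fun x => by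
    rcases le_total 0 (g x - f i x) with h | h
    · rw [abs_of_nonneg h, max_eq_left h]; ring
    · rw [abs_of_nonpos h, max_eq_right h]; ring
  have hsub : Integrable (fun x => g x - f i x) μ := hg.sub hi
  simp only [e]
  rw [integral_sub (hsub.pos_part.const_mul 2) hsub, integral_const_mul, integral_sub hg hi, hii]
  ring

theorem harmonicMeasure_real_eq_setIntegral {z : ℂ} (hz : 0 < z.im) {S : Set ℝ}
    (hS : MeasurableSet S) : (harmonicMeasure z).real S = ∫ t in S, halfPlanePoisson z t := by
  rw [← integral_indicator_one hS, integral_harmonicMeasure hz, ← integral_indicator hS]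
  refine integral_congr_ae (ae_of_all _ fun t => ?_)
  by_cases h : t ∈ S <;> simp [h]

/-- By Scheffé's lemma the Poisson kernels converge in `L¹`, which gives the limit for every Borel
set; for real `c` this would fail. -/
theorem tendsto_harmonicMeasure_real {ι : Type*} {l : Filter ι} [l.IsCountablyGenerated]
    {w : ι → ℂ} {c : ℂ} (hw : Tendsto w l (𝓝 c)) (hc : 0 < c.im) {S : Set ℝ}
    (hS : MeasurableSet S) :
    Tendsto (fun i => (harmonicMeasure (w i)).real S) l (𝓝 ((harmonicMeasure c).real S)) := by
  have him : ∀ᶠ i in l, 0 < (w i).im :=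
    ((Complex.continuous_im.tendsto _).comp hw).eventually_const_lt hc
  have h1 : Tendsto (fun i => ∫ t, |halfPlanePoisson c t - halfPlanePoisson (w i) t|) l (𝓝 0) := by
    refine tendsto_integral_abs_sub_of_integral_eq ?_ (integrable_halfPlanePoisson hc) ?_ ?_ ?_
    · filter_upwards [him] with i hi using integrable_halfPlanePoisson hi
    · filter_upwards [him] with i hi using ae_of_all _ fun t => (halfPlanePoisson_pos hi t).le
    · refine ae_of_all _ fun t => ?_
      have hre := (Complex.continuous_re.tendsto _).comp hw
      have him := (Complex.continuous_im.tendsto _).comp hw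
      unfold halfPlanePoisson
      exact (him.const_mul _).mul ((((hre.const_sub t).pow 2).add (him.pow 2)).inv₀ (by positivity))
    · filter_upwards [him] with i hi
      rw [integral_halfPlanePoisson hi, integral_halfPlanePoisson hc]
  rw [tendsto_iff_dist_tendsto_zero]
  refine squeeze_zero' (Eventually.of_forall fun _ => dist_nonneg) ?_ h1
  filter_upwards [him] with i hi
  have i1 := integrable_halfPlanePoisson hi
  have i2 := integrable_halfPlanePoisson hc
  rw [dist_comm, Real.dist_eq, harmonicMeasure_real_eq_setIntegral hi hS,
    harmonicMeasure_real_eq_setIntegral hc hS, ← integral_sub i2.integrableOn i1.integrableOn]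
  refine abs_integral_le_integral_abs.trans ?_
  exact setIntegral_le_integral (i2.sub i1).abs (ae_of_all _ fun _ => abs_nonneg _)

theorem halfPlanePoisson_vertical_symm (x t d : ℝ) :
    halfPlanePoisson (x + d * Complex.I) t = halfPlanePoisson (t + d * Complex.I) x := by
  simp only [halfPlanePoisson, Complex.add_re, Complex.ofReal_re, Complex.mul_re, Complex.I_re,
    mul_zero, Complex.ofReal_im, Complex.I_im, mul_one, sub_self, add_zero, Complex.add_im,
    Complex.mul_im, zero_add]
  rw [← neg_sub x t, neg_sq]

theorem integrable_prod_halfPlanePoisson {A : Set ℝ} (hA' : volume A < ⊤)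
    {d : ℝ} (hd : 0 < d) :
    Integrable (fun p : ℝ × ℝ => halfPlanePoisson (p.1 + d * Complex.I) p.2)
      ((volume.restrict A).prod volume) := by
  have hc : Continuous fun p : ℝ × ℝ => halfPlanePoisson (p.1 + d * Complex.I) p.2 := by
    simp only [halfPlanePoisson, Complex.add_re, Complex.ofReal_re, Complex.mul_re, Complex.I_re,
      mul_zero, Complex.ofReal_im, Complex.I_im, mul_one, sub_self, add_zero, Complex.add_im,
      Complex.mul_im, zero_add]
    fun_prop (disch := intro; positivity)
  rw [integrable_prod_iff hc.aestronglyMeasurable]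
  refine ⟨ae_of_all _ fun x => integrable_halfPlanePoisson (im_pos_vertical hd), ?_⟩
  have : ∀ x : ℝ, ∫ t, ‖halfPlanePoisson (x + d * Complex.I) t‖ = 1 := fun x => by
    rw [← integral_halfPlanePoisson (im_pos_vertical (x := x) hd)]
    exact integral_congr_ae (ae_of_all _ fun t => Real.norm_of_nonneg
      (halfPlanePoisson_pos (im_pos_vertical hd) t).le)
  simp only [this]
  exact integrableOn_const hA'.ne

/-- Fubini and the symmetry of the Poisson kernel in `x` and `t` shift the smoothing from `ω` to the
indicator function of `A`. -/
theorem setIntegral_integral_harmonicMeasure {A : Set ℝ} (hA : MeasurableSet A)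
    (hA' : volume A < ⊤) {d : ℝ} (hd : 0 < d) {ω : ℝ → ℝ} {M : ℝ}
    (hω : AEStronglyMeasurable ω volume) (hM : ∀ t, |ω t| ≤ M) :
    ∫ x in A, ∫ t, ω t ∂harmonicMeasure (x + d * Complex.I) =
      ∫ t, ω t * (harmonicMeasure (t + d * Complex.I)).real A := by
  have h1 := integrable_prod_halfPlanePoisson hA' hd
  have h2 : Integrable (fun p : ℝ × ℝ => halfPlanePoisson (p.1 + d * Complex.I) p.2 * ω p.2)
      ((volume.restrict A).prod volume) :=
    h1.mul_bdd (c := M) hω.comp_snd (ae_of_all _ fun p => hM p.2)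
  have h3 := integral_integral_swap (f := fun x t : ℝ => halfPlanePoisson (x + d * Complex.I) t * ω t) h2
  calc _ = ∫ x in A, ∫ t, halfPlanePoisson (x + d * Complex.I) t * ω t :=
        integral_congr_ae (ae_of_all _ fun x => integral_harmonicMeasure (im_pos_vertical hd) _)
    _ = _ := h3
    _ = _ := by
      refine integral_congr_ae (ae_of_all _ fun t => ?_)
      simp only
      rw [integral_mul_const, mul_comm,
        harmonicMeasure_real_eq_setIntegral (im_pos_vertical hd) hA]
      simp only [halfPlanePoisson_vertical_symm]

theorem integrable_harmonicMeasure_vertical {A : Set ℝ} (hA : MeasurableSet A)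
    (hA' : volume A < ⊤) {d : ℝ} (hd : 0 < d) :
    Integrable fun t : ℝ => (harmonicMeasure (t + d * Complex.I)).real A := by
  refine (integrable_prod_halfPlanePoisson hA' hd).integral_prod_right.congr
    (ae_of_all _ fun t => ?_)
  simp only [halfPlanePoisson_vertical_symm,
    harmonicMeasure_real_eq_setIntegral (im_pos_vertical hd) hA]

/-- Fatou's theorem gives convergence almost everywhere and all integrals equal `|A|`, so Scheffé's
lemma applies. The rate depends on `A` alone. -/
theorem tendsto_integral_abs_indicator_sub {A : Set ℝ} (hA : MeasurableSet A)
    (hA' : volume A < ⊤) :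
    Tendsto (fun d : ℝ => ∫ t, |A.indicator 1 t - (harmonicMeasure (t + d * Complex.I)).real A|)
      (𝓝[>] 0) (𝓝 0) := by
  refine tendsto_integral_abs_sub_of_integral_eq ?_ ?_ ?_ ?_ ?_
  · filter_upwards [self_mem_nhdsWithin] with d hd
    exact integrable_harmonicMeasure_vertical hA hA' hd
  · exact (integrable_indicator_iff hA).2 (integrableOn_const hA'.ne)
  · exact Eventually.of_forall fun d => ae_of_all _ fun t => measureReal_nonneg
  · have h1 : ∀ t, |A.indicator (1 : ℝ → ℝ) t| ≤ 1 := fun t => by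
      by_cases h : t ∈ A <;> simp [h]
    filter_upwards [ae_tendsto_integral_harmonicMeasure (measurable_one.indicator hA) h1] with x hx
    simpa only [integral_indicator_one hA] using hx
  · filter_upwards [self_mem_nhdsWithin] with d hd
    have h1 := setIntegral_integral_harmonicMeasure hA hA' hd (ω := fun _ => 1) (M := 1)
      aestronglyMeasurable_const (by simp)
    simp only [one_mul] at h1
    rw [← h1, integral_indicator_one hA]
    simp

/-- If Herglotz functions converge pointwise in the upper half-plane, then their boundary values
converge in value distribution. -/
theorem tendsto_setIntegral_harmonicMeasure_boundaryValue {F : ℕ → ℂ → ℂ} {G : ℂ → ℂ}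
    (hF : ∀ k, IsHerglotz (F k)) (hG : IsHerglotz G)
    (hlim : ∀ z : ℂ, 0 < z.im → Tendsto (fun k => F k z) atTop (𝓝 (G z))) {A S : Set ℝ}
    (hA : MeasurableSet A) (hS : MeasurableSet S) (hA' : volume A < ⊤) :
    Tendsto (fun k => ∫ x in A, (harmonicMeasure (boundaryValue (F k) x)).real S) atTop
      (𝓝 (∫ x in A, (harmonicMeasure (boundaryValue G x)).real S)) := by
  have hfin : IsFiniteMeasure (volume.restrict A) := ⟨by simpa using hA'⟩
  have hb : ∀ w, |(harmonicMeasure w).real S| ≤ 1 := fun w => by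
    rw [abs_of_nonneg measureReal_nonneg]; exact measureReal_le_one
  -- The cost of moving up to height `d` is bounded uniformly over all Herglotz functions and over
  -- `S`.
  have hswap : ∀ {H : ℂ → ℂ}, IsHerglotz H → ∀ {d : ℝ}, 0 < d →
      dist (∫ x in A, (harmonicMeasure (boundaryValue H x)).real S)
        (∫ x in A, (harmonicMeasure (H (x + d * Complex.I))).real S) ≤
      ∫ t, |A.indicator 1 t - (harmonicMeasure (t + d * Complex.I)).real A| := by
    intro H hH d hd
    have hm : AEStronglyMeasurable (fun x => (harmonicMeasure (boundaryValue H x)).real S) volume :=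
      (hH.aemeasurable_harmonicMeasure_real hS).aestronglyMeasurable
    have e1 : ∫ x in A, (harmonicMeasure (H (x + d * Complex.I))).real S =
        ∫ t, (harmonicMeasure (boundaryValue H t)).real S *
          (harmonicMeasure (t + d * Complex.I)).real A := by
      rw [← setIntegral_integral_harmonicMeasure hA hA' hd hm fun t => hb _]
      exact integral_congr_ae (ae_of_all _ fun x => hH.harmonicMeasure_real_eq (im_pos_vertical hd) hS)
    have e2 : ∫ x in A, (harmonicMeasure (boundaryValue H x)).real S =
        ∫ t, (harmonicMeasure (boundaryValue H t)).real S * A.indicator 1 t := by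
      rw [← integral_indicator hA]
      refine integral_congr_ae (ae_of_all _ fun t => ?_)
      by_cases h : t ∈ A <;> simp [h]
    have i1 : Integrable (A.indicator (1 : ℝ → ℝ)) :=
      (integrable_indicator_iff hA).2 (integrableOn_const hA'.ne)
    have i2 := integrable_harmonicMeasure_vertical hA hA' hd
    rw [e1, e2, Real.dist_eq, ← integral_sub (i1.bdd_mul (c := 1) hm (ae_of_all _ fun _ => hb _))
      (i2.bdd_mul (c := 1) hm (ae_of_all _ fun _ => hb _))]
    refine abs_integral_le_integral_abs.trans (integral_mono_of_nonneg (ae_of_all _ fun _ =>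
      abs_nonneg _) (i1.sub i2).abs (ae_of_all _ fun t => ?_))
    simp only
    rw [← mul_sub, abs_mul]
    exact mul_le_of_le_one_left (abs_nonneg _) (hb _)
  have hvert : ∀ d : ℝ, 0 < d → Tendsto
      (fun k => ∫ x in A, (harmonicMeasure (F k (x + d * Complex.I))).real S) atTop
      (𝓝 (∫ x in A, (harmonicMeasure (G (x + d * Complex.I))).real S)) := by
    intro d hd
    refine tendsto_integral_of_dominated_convergence (fun _ => 1) (fun k => ?_)
      (integrable_const _) (fun k => ae_of_all _ fun x => hb _) (ae_of_all _ fun x => ?_)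
    · refine Measurable.aestronglyMeasurable ?_
      refine ((Measure.measurable_coe hS).comp (measurable_harmonicMeasure.comp ?_)).ennreal_toReal
      exact ((hF k).differentiableOn.continuousOn.comp_continuous (by fun_prop)
        fun x => im_pos_vertical hd).measurable
    · exact tendsto_harmonicMeasure_real (hlim _ (im_pos_vertical hd))
        (hG.im_pos _ (im_pos_vertical hd)) hS
  rw [Metric.tendsto_nhds]
  intro ε hε
  -- First fix a height at which both moves cost less than `ε / 3`, then use convergence along that
  -- line.
  obtain ⟨d, hd1, hd⟩ := (((tendsto_integral_abs_indicator_sub hA hA').eventually_lt_const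
    (show 0 < ε / 3 by positivity)).and self_mem_nhdsWithin).exists
  filter_upwards [Metric.tendsto_nhds.1 (hvert d hd) (ε / 3) (by positivity)] with k hk
  have h1 := hswap (hF k) hd
  have h2 := hswap hG hd
  rw [dist_comm] at h2
  have h3 := dist_triangle4 (∫ x in A, (harmonicMeasure (boundaryValue (F k) x)).real S)
    (∫ x in A, (harmonicMeasure (F k (x + d * Complex.I))).real S)
    (∫ x in A, (harmonicMeasure (G (x + d * Complex.I))).real S)
    (∫ x in A, (harmonicMeasure (boundaryValue G x)).real S)
  linarith

/-! ### Boundary values of the free Weyl function -/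

theorem freeWeyl_ofReal (l : ℝ) : freeWeyl l = iSqrt l := by
  unfold freeWeyl iSqrt
  split_ifs with h
  · rw [Real.sqrt_eq_rpow, Complex.ofReal_cpow h]
    norm_num
  · rw [Complex.ofReal_cpow_of_nonpos (not_le.1 h).le, Real.sqrt_eq_rpow, Complex.ofReal_neg,
      Complex.ofReal_cpow (by linarith)]
    have e : Complex.exp (Real.pi * Complex.I * (1 / 2)) = Complex.I := by
      rw [show (Real.pi : ℂ) * Complex.I * (1 / 2) = Real.pi / 2 * Complex.I by ring,
        Complex.exp_mul_I, Complex.cos_pi_div_two, Complex.sin_pi_div_two]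
      simp
    rw [e]
    push_cast
    linear_combination ((-l : ℂ) ^ (1 / 2 : ℂ)) * Complex.I_sq

/-- For negative `l` the power is discontinuous on its cut, but the cut is approached from above;
the polar form reduces the claim to the one-sided continuity of `arg`. -/
theorem boundaryValue_freeWeyl {l : ℝ} (hl : l ≠ 0) : boundaryValue freeWeyl l = iSqrt l := by
  have h1 : Tendsto (fun d : ℝ => (l : ℂ) + d * Complex.I) (𝓝[>] 0) (𝓝 l) := by
    have : Continuous fun d : ℝ => (l : ℂ) + d * Complex.I := by fun_prop
    simpa using (this.tendsto 0).mono_left nhdsWithin_le_nhds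
  have hl' : (l : ℂ) ≠ 0 := by exact_mod_cast hl
  have h2 := tendsto_arg_sub (t := 0) h1 (isHerglotz_id.eventually_im_pos l) (by simpa using hl)
  simp only [Complex.ofReal_zero, sub_zero] at h2
  have h3 := h1.norm.log (norm_ne_zero_iff.2 hl')
  refine Tendsto.limUnder_eq ?_
  rw [← freeWeyl_ofReal, freeWeyl, cpow_half_eq hl']
  have hE : Continuous fun p : ℝ × ℝ => Complex.I * (Real.exp (p.1 / 2) *
    (Real.cos (p.2 / 2) + Real.sin (p.2 / 2) * Complex.I)) := by fun_prop
  refine ((hE.tendsto _).comp (h3.prodMk_nhds h2)).congr' ?_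
  filter_upwards [self_mem_nhdsWithin] with d hd
  have hne : (l : ℂ) + d * Complex.I ≠ 0 := fun h => by
    have := im_pos_vertical (x := l) hd
    simp [h] at this
  simp only [Function.comp]
  rw [freeWeyl, cpow_half_eq hne]

/-! ### The Dirichlet solution -/

theorem isHerglotz_dirichlet {V : ℝ → ℝ} (hV : LocallyIntegrableOn V (Ici 0) volume)
    {w w' : ℂ → ℝ → ℂ} (hw : ∀ z, IsSchrodingerSolution V z 0 (w z) (w' z) ∧ w z 0 = 0 ∧ w' z 0 = 1)
    (hd : ∀ x, 0 ≤ x → Differentiable ℂ (fun z => w z x) ∧ Differentiable ℂ (fun z => w' z x))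
    {b : ℝ} (hb : 0 < b) : IsHerglotz fun z => -w' z b / w z b := by
  have key : ∀ z : ℂ, 0 < z.im → _ := fun z hz =>
    lagrange_dirichlet hV hb (hw z).1 (hw z).2.1 (hw z).2.2 hz
  refine ⟨DifferentiableOn.div (hd b hb.le).2.neg.differentiableOn (hd b hb.le).1.differentiableOn
    fun z hz => (key z hz).1, fun z hz => ?_⟩
  obtain ⟨h1, h2, h3⟩ := key z hz
  have h4 : 0 < z.im * ∫ t in (0 : ℝ)..b, ‖w z t‖ ^ 2 := mul_pos hz h2
  rw [← h3] at h4
  exact pos_of_mul_pos_left h4 (by positivity)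

/-- The Wronskian with the solution `u` normalized by `u(0) = 1`, `u'(0) = 0` is one, so `v` and
`v'` have no common zero. -/
theorem dirichlet_deriv_ne_zero {V : ℝ → ℝ} (hV : LocallyIntegrableOn V (Ici 0) volume) {z : ℂ}
    {v v' : ℝ → ℂ} (hv : IsSchrodingerSolution V z 0 v v') (h0 : v 0 = 0) (h0' : v' 0 = 1)
    {b : ℝ} (hb : 0 ≤ b) (hvb : v b = 0) : v' b ≠ 0 := by
  intro h
  obtain ⟨u, u', hu, -⟩ := exists_isSchrodingerSolution hV le_rfl 1 0
  have hq : IntervalIntegrable (fun t => (V t : ℂ) - z) volume 0 b :=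
    (intervalIntegrable_of_locallyIntegrableOn_Ici hV le_rfl hb).sub intervalIntegrable_const
  have h1 := ((hu z).1.isSolutionOn hV le_rfl hb).wronskian_eq hb hq (hv.isSolutionOn hV le_rfl hb)
  rw [h, hvb, h0, h0', (hu z).2.1] at h1
  simp at h1

/-- The quotient of entire functions is continuous off the zeros of its denominator. At a zero, a
finite boundary value would force the numerator to vanish too, which is impossible. So the a.e.
finiteness of Herglotz boundary values already shows that the Dirichlet eigenvalues are a null set.
-/
theorem ae_boundaryValue_dirichlet {V : ℝ → ℝ} (hV : LocallyIntegrableOn V (Ici 0) volume)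
    {w w' : ℂ → ℝ → ℂ} (hw : ∀ z, IsSchrodingerSolution V z 0 (w z) (w' z) ∧ w z 0 = 0 ∧ w' z 0 = 1)
    (hd : ∀ x, 0 ≤ x → Differentiable ℂ (fun z => w z x) ∧ Differentiable ℂ (fun z => w' z x))
    {b : ℝ} (hb : 0 < b) : ∀ᵐ l : ℝ, w l b ≠ 0 ∧
      boundaryValue (fun z => -w' z b / w z b) l = -w' l b / w l b := by
  have hF := isHerglotz_dirichlet hV hw hd hb
  filter_upwards [hF.ae_tendsto_boundaryValue] with l hl
  have h1 : Tendsto (fun d : ℝ => (l : ℂ) + d * Complex.I) (𝓝[>] 0) (𝓝 l) := by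
    have : Continuous fun d : ℝ => (l : ℂ) + d * Complex.I := by fun_prop
    simpa using (this.tendsto 0).mono_left nhdsWithin_le_nhds
  have h2 := ((hd b hb.le).1.continuous.tendsto _).comp h1
  have h3 := ((hd b hb.le).2.continuous.tendsto _).comp h1
  have hne : w l b ≠ 0 := by
    intro h0
    refine dirichlet_deriv_ne_zero hV (hw l).1 (hw l).2.1 (hw l).2.2 hb.le h0 ?_
    rw [← neg_eq_zero]
    refine tendsto_nhds_unique h3.neg ?_
    have h4 := hl.mul h2
    rw [h0, mul_zero] at h4
    refine h4.congr' ?_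
    filter_upwards [self_mem_nhdsWithin] with d hd'
    have h5 := (lagrange_dirichlet hV hb (hw _).1 (hw _).2.1 (hw _).2.2
      (im_pos_vertical (x := l) hd')).1
    simp only [Function.comp]
    rw [div_mul_cancel₀ _ h5]
  exact ⟨hne, tendsto_nhds_unique hl (h3.neg.div h2 hne)⟩

theorem theorem2 (V : ℝ → ℝ) (hV : IsL2Sparse V)
    (v v' : ℝ → ℝ → ℝ)
    (hv : ∀ l : ℝ, IsSchrodingerSolution V (l : ℂ) 0
      (fun x => (v x l : ℂ)) (fun x => (v' x l : ℂ)))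
    (hv0 : ∀ l : ℝ, v 0 l = 0) (hv0' : ∀ l : ℝ, v' 0 l = 1)
    (a b : ℕ → ℝ) (ha : ∀ k, 0 ≤ a k) (hab : ∀ k, a k < b k)
    (hlen : Tendsto (fun k => b k - a k) atTop atTop)
    (hint : Tendsto (fun k => ∫⁻ x in Ioo (a k) (b k), ENNReal.ofReal (V x ^ 2)) atTop (𝓝 0)) :
    -- the Weyl functions and, almost everywhere, their boundary values are well defined
    (∀ k, (∀ z : ℂ, 0 < z.im → ∃! w : ℂ, IsWeylValue V (a k) z w) ∧
      ∀ᵐ l : ℝ, Tendsto (fun d : ℝ => weylM V (a k) ((l : ℂ) + (d : ℂ) * Complex.I)) (𝓝[>] 0)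
        (𝓝 (boundaryValue (weylM V (a k)) l))) ∧
    ∀ A S : Set ℝ, MeasurableSet A → MeasurableSet S → volume A < ⊤ →
      (∀ k, IntegrableOn
        (fun l => angleSubtended (boundaryValue (weylM V (a k)) l) S) A volume) ∧
      Tendsto (fun k => (1 / Real.pi) *
          ∫ l in A, angleSubtended (boundaryValue (weylM V (a k)) l) S) atTop
        (𝓝 ((1 / Real.pi) * ∫ l in A, angleSubtended (iSqrt l) S)) ∧
      Tendsto (fun k => volume.real {l | l ∈ A ∧ v (b k) l ≠ 0 ∧ v' (b k) l / v (b k) l ∈ S}) atTop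
        (𝓝 ((1 / Real.pi) * ∫ l in A, angleSubtended (iSqrt l) (-S))) := by
  have hVl := hV.locallyIntegrable
  have hpi := Real.pi_pos.ne'
  have hfree : ∀ {A S : Set ℝ}, MeasurableSet S →
      (1 / Real.pi) * ∫ l in A, angleSubtended (iSqrt l) S =
        ∫ l in A, (harmonicMeasure (boundaryValue freeWeyl l)).real S := by
    intro A S hS
    rw [← integral_const_mul]
    have hne : ∀ᵐ l ∂volume.restrict A, l ≠ 0 := ae_restrict_of_ae (by simp [ae_iff])
    refine integral_congr_ae ?_
    filter_upwards [hne] with l hl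
    rw [boundaryValue_freeWeyl hl, angleSubtended_eq hS, one_div, inv_mul_cancel_left₀ hpi]
  refine ⟨fun k => ⟨fun z hz => existsUnique_isWeylValue hV (ha k) hz,
    (isHerglotz_weylM hV (ha k)).ae_tendsto_boundaryValue⟩, fun A S hA hS hA' => ⟨fun k => ?_, ?_, ?_⟩⟩
  · have : IsFiniteMeasure (volume.restrict A) := ⟨by simpa using hA'⟩
    simp only [angleSubtended_eq hS]
    refine Integrable.const_mul (Integrable.of_bound (C := 1)
      ((isHerglotz_weylM hV (ha k)).aemeasurable_harmonicMeasure_real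
        hS).restrict.aestronglyMeasurable (ae_of_all _ fun l => ?_)) _
    rw [Real.norm_of_nonneg measureReal_nonneg]
    exact measureReal_le_one
  · rw [hfree hS]
    have h1 := tendsto_setIntegral_harmonicMeasure_boundaryValue
      (fun k => isHerglotz_weylM hV (ha k)) isHerglotz_freeWeyl
      (fun z hz => tendsto_weylM_freeWeyl hV ha hab hlen hint hz) hA hS hA'
    refine h1.congr fun k => ?_
    simp only [angleSubtended_eq hS]
    rw [integral_const_mul, one_div, inv_mul_cancel_left₀ hpi]
  · rw [hfree hS.neg]
    -- The given `v` lives on real spectral parameters only; `w` is its extension to complex ones,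
    -- entire in `z`.
    obtain ⟨w, w', hw, hd⟩ := exists_isSchrodingerSolution hVl le_rfl 0 1
    have hb : ∀ k, 0 < b k := fun k => (ha k).trans_lt (hab k)
    have hvw : ∀ k (l : ℝ), w l (b k) = v (b k) l ∧ w' l (b k) = v' (b k) l := fun k l =>
      (hw l).1.unique (hv l) hVl le_rfl (by simp [(hw l).2.1, hv0]) (by simp [(hw l).2.2, hv0'])
        (hb k).le
    have h1 := tendsto_setIntegral_harmonicMeasure_boundaryValue
      (fun k => isHerglotz_dirichlet hVl hw hd (hb k)) isHerglotz_freeWeyl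
      (fun z hz => tendsto_dirichlet_freeWeyl hV ha hab hlen hint hz (hw z).1 (hw z).2.1
        (hw z).2.2) hA hS.neg hA'
    refine h1.congr fun k => ?_
    set E : Set ℝ := {l | v (b k) l ≠ 0 ∧ v' (b k) l / v (b k) l ∈ S} with hE
    have hvc : Continuous (v (b k)) := by
      have : v (b k) = fun l : ℝ => (w l (b k)).re := funext fun l => by simp [(hvw k l).1]
      rw [this]
      exact Complex.continuous_re.comp ((hd _ (hb k).le).1.continuous.comp Complex.continuous_ofReal)
    have hvc' : Continuous (v' (b k)) := by
      have : v' (b k) = fun l : ℝ => (w' l (b k)).re := funext fun l => by simp [(hvw k l).2]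
      rw [this]
      exact Complex.continuous_re.comp ((hd _ (hb k).le).2.continuous.comp Complex.continuous_ofReal)
    have hEm : MeasurableSet E :=
      (hvc.measurable (measurableSet_singleton 0).compl).inter
        ((hvc'.measurable.div hvc.measurable) hS)
    -- The boundary value `-v'/v` is real, so its harmonic measure is a point mass and `-v'/v ∈ -S`
    -- means `v'/v ∈ S`.
    have h2 : ∀ᵐ l ∂volume.restrict A, (harmonicMeasure (boundaryValue
        (fun z => -w' z (b k) / w z (b k)) l)).real (-S) = E.indicator 1 l := by
      refine ae_restrict_of_ae ?_
      filter_upwards [ae_boundaryValue_dirichlet hVl hw hd (hb k)] with l ⟨hl0, hl⟩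
      have e : boundaryValue (fun z => -w' z (b k) / w z (b k)) l =
          ((-(v' (b k) l / v (b k) l) : ℝ) : ℂ) := by
        rw [hl, (hvw k l).1, (hvw k l).2]
        push_cast
        ring
      rw [(hvw k l).1, Complex.ofReal_ne_zero] at hl0
      rw [e, harmonicMeasure_of_im_eq_zero (Complex.ofReal_im _), Complex.ofReal_re,
        measureReal_def, Measure.dirac_apply' _ hS.neg]
      by_cases h : v' (b k) l / v (b k) l ∈ S <;> simp [hE, h, hl0]
    rw [integral_congr_ae h2, integral_indicator_one hEm, measureReal_restrict_apply hEm]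
    congr 1
    ext l
    simp only [hE, mem_inter_iff, mem_ofPred_eq]
    tauto
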